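/- **Parameters.** Let $\eta,\lambda,\omega,\delta>0$, $n_\delta=\lceil\delta\rceil$, $\nu>0$ with $\nu n_\delta<1$; let $\gamma\ge 0$, $0<\alpha\le 1$, $0<\beta\le 1$ and, if $\gamma\neq 0$, $0<\beta\lceil\gamma\rceil/\gamma-r\alpha<1$ for all $r=0,\dots,\lceil\gamma\rceil$. If $\gamma=0$, read $\lceil\gamma\rceil/\gamma$ and $\gamma/\lceil\gamma\rceil$ as $1$. A stable subordinator of index $a\in(0,1]$ is a subordinator with Laplace exponent $\mu^a$ (for $a=1$: $V_t=t$). **Processes.** (i) Let $V^{\nu r}$ ($r=1,\dots,n_\delta$) be $\nu r$-stable subordinators and $\mathscr V$ a subordinator with Laplace exponent $(\eta^{n_\delta}+\mu)^{\delta/n_\delta}-\eta^\delta$, all mutually independent, and put $${}_\eta\mathfrak V^{\nu,\delta}_t=\sum_{r=1}^{n_\delta}V^{\nu r}_{\binom{n_\delta}{r}\eta^{n_\delta-r}\mathscr V_t}.$$ (ii) Let $N$ be a homogeneous Poisson process of rate $\lambda$ independent of the process ${}_\eta\mathfrak V^{\nu,\delta}$. (iii) Let $V^{(r)}$ ($r=0,\dots,\lceil\gamma\rceil$)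 be stable subordinators of index $\beta\lceil\gamma\rceil/\gamma-r\alpha$ and $S$ a stable subordinator of index $\gamma/\lceil\gamma\rceil$, all mutually independent, and put $$\mathfrak W_t=\sum_{r=0}^{\lceil\gamma\rceil}V^{(r)}_{\Phi_r(t)},\quad \Phi_r(t)=\binom{\lceil\gamma\rceil}{r}\omega^r S_t,\qquad \mathfrak U_t=\inf\{s\ge 0:\mathfrak W_s>t\}.$$ Assume that the process $N({}_\eta\mathfrak V^{\nu,\delta}_t)$, $t\ge0$, is independent of the process $\mathfrak U$. Let $p_k(t)=\mathbb P\big(N({}_\eta\mathfrak V^{\nu,\delta}_{\mathfrak U_t})=k\big)$, $k\ge 0$, $t\ge 0$. Write $E^{g}_{\kappa,\varpi}(x)=\sum_{r\ge 0}\frac{x^r (g)_r}{r!\,\Gamma(\kappa r+\varpi)}$, where $(g)_r=g(g+1)\cdots(g+r-1)$, and $\phi(x)=(\eta+\lambda^\nu(1-x)^\nu)^\delta-\eta^\delta$. **Theorem.** 1. For all $t\ge 0$ and $u\in[-1,1]$, $$\sum_{k\ge0}u^kp_k(t)=\sum_{n\ge 0}\big(-\phi(u)\,t^\beta\big)^nE^{\gamma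 n}_{\alpha,\beta n+1}(-\omega t^\alpha),$$ both series converging absolutely. 2. For every $k$ such that for all $r\ge 0$ the innermost series (over $m$) below converges, and for all $t\ge 0$, $$p_k(t)=\frac{(-1)^k}{k!}\sum_{n=0}^\infty(-t^\beta)^nE^{\gamma n}_{\alpha,\beta n+1}(-\omega t^\alpha)\sum_{r=0}^n\binom nr(-\eta^\delta)^{n-r}\sum_{m=0}^\infty\binom{r\delta}{m}\eta^{\delta r-m}\lambda^{\nu m}\frac{\Gamma(\nu m+1)}{\Gamma(\nu m-k+1)},$$ where $1/\Gamma$ is $0$ at the poles of $\Gamma$ and the series over $n$ converges absolutely. If $\lambda^\nu<\eta$ or $\delta\in\mathbb N$, the series over $m$ converge absolutely for all $k$ and $r$. 3. The $p_k$ solve the Cauchy problem $${}^C\mathbf D^{\gamma}_{\alpha,\beta,-\omega,0^+}p_k(t)=-\left\{[\eta+\lambda^\nu(1-\mathsf B)^\nu]^\delta-\eta^\delta\right\}p_k(t)\quad(t>0),\qquad p_k(0)=\delta_{k,0}.$$ Here $\mathsf B$ is the backward shift $\mathsf B p_k=p_{k-1}$ (with $p_i=0$ for $i<0$) and the operator in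 braces is $\phi(\mathsf B)=\sum_{j\ge0}\frac{\phi^{(j)}(0)}{j!}\mathsf B^j$. Each $p_k$ is absolutely continuous on every $[0,b]$, and ${}^C\mathbf D^{\gamma}_{\alpha,\beta,-\omega,0^+}f=D^{\beta+\theta}_{0+}\int_0^{\cdot}(\cdot-y)^{\theta-1}E^{-\gamma}_{\alpha,\theta}[-\omega(\cdot-y)^\alpha]\,(f(y)-f(0^+))\,\mathrm dy$, for every choice of $\theta>0$, where $D^{\mu}_{0+}g(t)=\frac{\mathrm d^m}{\mathrm dt^m}\frac1{\Gamma(m-\mu)}\int_0^t(t-y)^{m-\mu-1}g(y)\,\mathrm dy$, $m=\lfloor\mu\rfloor+1$, is the Riemann–Liouville derivative; the derivatives involved exist and are continuous on $(0,\infty)$. -/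

import Mathlib

open MeasureTheory ProbabilityTheory Filter Set
open scoped NNReal Topology

noncomputable section

section Processes

variable {Ω : Type*} [MeasurableSpace Ω]

/-- `X` is a (strict) subordinator: a `[0, ∞)`-valued process starting at zero, with
right-continuous nondecreasing paths and independent stationary increments, whose Laplace exponent
is `Φ`, i.e. `𝔼 exp (-μ X_t) = exp (-t Φ(μ))`. -/
structure IsSubordinator (X : ℝ≥0 → Ω → ℝ≥0) (Φ : ℝ → ℝ) (P : Measure Ω) : Prop where
  measurable : ∀ t, Measurable (X t)
  zero : ∀ w, X 0 w = 0
  mono : ∀ w, Monotone fun t => X t w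
  right_cont : ∀ w t, ContinuousWithinAt (fun s => X s w) (Ici t) t
  indep_increments : HasIndepIncrements X P
  stationary : ∀ s t, IdentDistrib (fun w => X (s + t) w - X s w) (X t) P P
  laplace : ∀ (t : ℝ≥0) (μ : ℝ), 0 ≤ μ →
    ∫ w, Real.exp (-(μ * (X t w : ℝ))) ∂P = Real.exp (-((t : ℝ) * Φ μ))

/-- Stable subordinator of index `a`, with Laplace exponent `μ ^ a`; for `a = 1` this is the
trivial subordinator `X_t = t`. -/
def IsStableSubordinator (X : ℝ≥0 → Ω → ℝ≥0) (a : ℝ) (P : Measure Ω) : Prop :=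
  IsSubordinator X (fun μ => μ ^ a) P

/-- Tempered stable subordinator of index `a` and tempering parameter `ξ`. -/
def IsTemperedStableSubordinator (X : ℝ≥0 → Ω → ℝ≥0) (a ξ : ℝ) (P : Measure Ω) : Prop :=
  IsSubordinator X (fun μ => (ξ + μ) ^ a - ξ ^ a) P

/-- Homogeneous Poisson process of rate `lam`. -/
structure IsPoissonProcess (N : ℝ≥0 → Ω → ℕ) (lam : ℝ≥0) (P : Measure Ω) : Prop where
  measurable : ∀ t, Measurable (N t)
  zero : ∀ w, N 0 w = 0
  mono : ∀ w, Monotone fun t => N t w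
  right_cont : ∀ w t, ContinuousWithinAt (fun s => N s w) (Ici t) t
  indep_increments : HasIndepIncrements N P
  law : ∀ s t, P.map (fun w => N (s + t) w - N s w) = poissonMeasure (lam * t)

/-- `∑_{r=1}^n V^r_{binom(n,r) η^{n-r} t}`; the process `V^r` is `A i` with `r = i + 1`. -/
def weightedStableSum (η : ℝ≥0) (n : ℕ) (A : Fin n → ℝ≥0 → Ω → ℝ≥0) (t : ℝ≥0) (w : Ω) : ℝ≥0 :=
  ∑ i : Fin n, A i ((n.choose (i + 1) : ℝ≥0) * η ^ (n - (i + 1)) * t) w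

/-- The weighted stable sum evaluated at the independent random time `T_t`. -/
def subordinatedStableSum (η : ℝ≥0) (n : ℕ) (A : Fin n → ℝ≥0 → Ω → ℝ≥0) (T : ℝ≥0 → Ω → ℝ≥0)
    (t : ℝ≥0) (w : Ω) : ℝ≥0 :=
  weightedStableSum η n A (T t w) w

/-- `∑_{r=0}^c V^r_{Φ_r(t)}` with `Φ_r(t) = binom(c,r) om^r S_t`. -/
def clockedStableSum (om : ℝ≥0) (c : ℕ) (B : Fin (c + 1) → ℝ≥0 → Ω → ℝ≥0) (S : ℝ≥0 → Ω → ℝ≥0)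
    (t : ℝ≥0) (w : Ω) : ℝ≥0 :=
  ∑ r : Fin (c + 1), B r ((c.choose r : ℝ≥0) * om ^ (r : ℕ) * S t w) w

/-- The hitting time `inf {s ≥ 0 : X_s > t}`. -/
def hittingTimeProcess (X : ℝ≥0 → Ω → ℝ≥0) (t : ℝ≥0) (w : Ω) : ℝ≥0 :=
  sInf {s : ℝ≥0 | t < X s w}

/-- `ℙ (M_t = k)` as a function of the real variable `t` (used for `t ≥ 0`). -/
def stateProb (P : Measure Ω) (M : ℝ≥0 → Ω → ℕ) (k : ℕ) (t : ℝ) : ℝ :=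
  P.real {w | M t.toNNReal w = k}

end Processes

/-- `γ / ⌈γ⌉`, read as `1` when `γ = 0`. -/
def ceilRatio (γ : ℝ) : ℝ := if γ = 0 then 1 else γ / (⌈γ⌉₊ : ℝ)

/-- Three-parameter Mittag-Leffler function `E^g_{κ,ϖ}(x)`. -/
def mittagLeffler (κ ϖ g x : ℝ) : ℝ :=
  ∑' r : ℕ, x ^ r * (ascPochhammer ℝ r).eval g / ((r.factorial : ℝ) * Real.Gamma (κ * r + ϖ))

/-- Riemann-Liouville fractional integral of order `μ` on `(0, t)`. -/
def rlIntegral (μ : ℝ) (f : ℝ → ℝ) (t : ℝ) : ℝ :=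
  1 / Real.Gamma μ * ∫ y in (0 : ℝ)..t, (t - y) ^ (μ - 1) * f y

/-- The integer `m = [μ] + 1`. -/
def rlOrder (μ : ℝ) : ℕ := ⌊μ⌋₊ + 1

/-- Riemann-Liouville fractional derivative of order `μ`. -/
def rlDeriv (μ : ℝ) (f : ℝ → ℝ) (t : ℝ) : ℝ :=
  iteratedDeriv (rlOrder μ) (rlIntegral (rlOrder μ - μ) f) t

/-- The integral `∫_0^t (t-y)^{θ-1} E^{-γ}_{α,θ}(ζ (t-y)^α) f(y) dy`. -/
def prabhakarIntegral (θ γ α ζ : ℝ) (f : ℝ → ℝ) (t : ℝ) : ℝ :=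
  ∫ y in (0 : ℝ)..t, (t - y) ^ (θ - 1) * mittagLeffler α θ (-γ) (ζ * (t - y) ^ α) * f y

/-- Prabhakar derivative, computed with the auxiliary parameter `θ > 0`. -/
def prabhakarDeriv (θ γ α β ζ : ℝ) (f : ℝ → ℝ) : ℝ → ℝ :=
  rlDeriv (β + θ) (prabhakarIntegral θ γ α ζ f)

/-- `f` minus its Taylor polynomial at `0+` of degree `⌈β⌉ - 1`. -/
def taylorRemainder (β : ℝ) (f : ℝ → ℝ) (x : ℝ) : ℝ :=
  f x - ∑ k ∈ Finset.range ⌈β⌉₊,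
    x ^ k / (k.factorial : ℝ) * limUnder (𝓝[>] (0 : ℝ)) (iteratedDeriv k f)

/-- Regularized Prabhakar derivative. -/
def regPrabhakarDeriv (θ γ α β ζ : ℝ) (f : ℝ → ℝ) : ℝ → ℝ :=
  prabhakarDeriv θ γ α β ζ (taylorRemainder β f)

/-- The `[β + θ] + 1` derivatives that occur in the regularized Prabhakar derivative of `f`
exist, and are continuous, on `(0, ∞)`. -/
def HasRegPrabhakarDeriv (θ γ α β ζ : ℝ) (f : ℝ → ℝ) : Prop :=
  ContDiffOn ℝ (rlOrder (β + θ))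
    (rlIntegral (rlOrder (β + θ) - (β + θ))
      (prabhakarIntegral θ γ α ζ (taylorRemainder β f))) (Ioi 0)

/-- The difference operator `φ(B)`, where `B` is the backward shift and `φ` is a function with
Taylor series `∑_j c_j x^j` at `0`: `φ(B) p_k = ∑_j c_j p_{k-j}`, with `p_i = 0` for `i < 0`. -/
def shiftOperator (φ : ℝ → ℝ) (p : ℕ → ℝ) (k : ℕ) : ℝ :=
  ∑ j ∈ Finset.range (k + 1), iteratedDeriv j φ 0 / (j.factorial : ℝ) * p (k - j)

/-- The function `x ↦ (η + lam^ν (1 - x)^ν)^δ - η^δ`. -/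
def spaceSymbol (η lam ν δ x : ℝ) : ℝ :=
  (η + lam ^ ν * (1 - x) ^ ν) ^ δ - η ^ δ

/-- The `n`-th term of the series for the probability generating function. -/
def genTerm (η lam ν δ α β γ om u t : ℝ) (n : ℕ) : ℝ :=
  (-(spaceSymbol η lam ν δ u * t ^ β)) ^ n *
    mittagLeffler α (β * n + 1) (γ * n) (-(om * t ^ α))

/-- The `m`-th term of the innermost series of the state probabilities. -/
def innerTerm (η lam ν δ : ℝ) (k r m : ℕ) : ℝ :=
  Ring.choose ((r : ℝ) * δ) m * η ^ (δ * r - m) * lam ^ (ν * m) *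
    (Real.Gamma (ν * m + 1) / Real.Gamma (ν * m - k + 1))

/-- The `n`-th term of the outer series of the state probabilities, `L r` being the sum of the
`r`-th innermost series. -/
def outerTerm (η δ α β γ om : ℝ) (k : ℕ) (L : ℕ → ℝ) (t : ℝ) (n : ℕ) : ℝ :=
  (-1) ^ k / (k.factorial : ℝ) * ((-(t ^ β)) ^ n *
    mittagLeffler α (β * n + 1) (γ * n) (-(om * t ^ α)) *
    ∑ r ∈ Finset.range (n + 1), (n.choose r : ℝ) * (-(η ^ δ)) ^ (n - r) * L r)

end

/-!
Write `Ψ(μ) = μ ^ β (1 + om μ ^ (-α)) ^ γ` and let `φ` be the space symbol. Two binomial expansions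
show that the counting process `M_s = N(V_s)` satisfies `𝔼 u ^ (M_s) = exp (-s φ(u))`
(`isCountingProcess_subordinated`) and that the process `W` whose hitting time is `U` has Laplace
exponent `Ψ` (`isStableClock_clockedStableSum`). Random times are handled by freezing
(`integral_randomTime`), so that `∑ u ^ k p_k(t) = 𝔼 exp (-φ(u) U_t)`.

Integrating the equivalence of `s < U_t` and `W_s ≤ t` against `exp (-μ t)`
(`lintegral_hittingTimeProcess`), the mean of `U_t ^ n / n!` has the Laplace transform
`1 / (μ Ψ(μ) ^ n)` in `t`. The termwise transform of the Mittag-Leffler series identifies it with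
`t ^ (β n) E^{γ n}_{α, β n + 1}(-om t ^ α)` (`IsStableClock.integral_pow_div_factorial`), by
uniqueness of Laplace transforms. Expanding the exponential gives the series for the probability
generating function.

The series for `p_k` is obtained by comparing Taylor coefficients at `u = 0`. The innermost series
is a power series at the point `1`, possibly on the boundary of its disc of convergence; Abel's limit
theorem and the identity theorem evaluate it by the derivatives at `u = 0` of powers of
`η + lam ^ ν (1 - u) ^ ν` (`eq_of_tendsto_taylorCoeff`, `taylorCoeff_spaceSymbol_pow`).

For the Cauchy problem, the generating function of the Laplace transforms `P_k` of `p_k` is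
`Ψ / (μ (Ψ + φ(u)))`, whence `∑ φ_j P_{k - j} = Ψ (δ_{k,0} / μ - P_k)`, where `φ_j` are the Taylor
coefficients of `φ` (`exists_hasLaplaceAt_stateProb`). The fractional integral in the regularized
derivative multiplies the transform of `p_k - p_k(0)` by `Ψ μ ^ (-m)`, hence coincides with the
`m`-fold integral of `-φ(B) p_k`; this also shows that the derivatives exist
(`regPrabhakarDeriv_of_hasLaplaceAt`). Continuity and absolute continuity of `p_k` hold because the
law of `M_s` is Lipschitz in `s`, so that `p_k` varies at most by a multiple of the increments of
`𝔼 U_t`, a primitive of an integrable kernel (`dist_stateProb_le`, `momentFunction_one_eq_integral`).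
-/

noncomputable section

/-! ### Laplace transforms on the half-line -/

/-- The function `f` has the absolutely convergent Laplace transform `F` at the point `μ`. -/
def HasLaplaceAt (f : ℝ → ℝ) (μ F : ℝ) : Prop :=
  IntegrableOn (fun t => Real.exp (-(μ * t)) * f t) (Ioi 0) ∧
    ∫ t in Ioi (0 : ℝ), Real.exp (-(μ * t)) * f t = F

namespace HasLaplaceAt

variable {f g : ℝ → ℝ} {μ F G : ℝ}

theorem sub (hf : HasLaplaceAt f μ F) (hg : HasLaplaceAt g μ G) :
    HasLaplaceAt (fun t => f t - g t) μ (F - G) := by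
  refine ⟨?_, ?_⟩
  · simpa only [mul_sub, Pi.sub_def] using hf.1.sub hg.1
  · simp only [mul_sub]
    rw [integral_sub hf.1 hg.1, hf.2, hg.2]

theorem const_mul (c : ℝ) (hf : HasLaplaceAt f μ F) :
    HasLaplaceAt (fun t => c * f t) μ (c * F) := by
  refine ⟨?_, ?_⟩
  · simpa only [mul_left_comm _ c] using! hf.1.const_mul c
  · simp only [mul_left_comm _ c]
    rw [integral_const_mul, hf.2]

theorem neg (hf : HasLaplaceAt f μ F) : HasLaplaceAt (fun t => -f t) μ (-F) := by
  simpa using hf.const_mul (-1)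

theorem congr (hf : HasLaplaceAt f μ F) (h : EqOn f g (Ioi 0)) : HasLaplaceAt g μ F := by
  have e : EqOn (fun t => Real.exp (-(μ * t)) * f t) (fun t => Real.exp (-(μ * t)) * g t)
      (Ioi 0) := fun t ht => by simp only [h ht]
  exact ⟨hf.1.congr_fun e measurableSet_Ioi, by
    rw [← setIntegral_congr_fun measurableSet_Ioi e, hf.2]⟩

theorem finset_sum {ι : Type*} (s : Finset ι) {f : ι → ℝ → ℝ} {F : ι → ℝ}
    (h : ∀ i ∈ s, HasLaplaceAt (f i) μ (F i)) :
    HasLaplaceAt (fun t => ∑ i ∈ s, f i t) μ (∑ i ∈ s, F i) := by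
  refine ⟨?_, ?_⟩
  · simp only [Finset.mul_sum]
    exact integrable_finsetSum _ fun i hi => (h i hi).1
  · simp only [Finset.mul_sum]
    rw [integral_finsetSum _ fun i hi => (h i hi).1]
    exact Finset.sum_congr rfl fun i hi => (h i hi).2

/-- The Laplace transform turns the convolution on the half-line into a product. -/
theorem conv (hf : HasLaplaceAt f μ F) (hg : HasLaplaceAt g μ G) :
    HasLaplaceAt (fun t => ∫ y in (0 : ℝ)..t, f (t - y) * g y) μ (F * G) := by
  have e : ∀ t, Real.exp (-(μ * t)) * ∫ y in (0 : ℝ)..t, f (t - y) * g y =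
      ∫ y in (0 : ℝ)..t, ContinuousLinearMap.mul ℝ ℝ (Real.exp (-(μ * y)) * g y)
        (Real.exp (-(μ * (t - y))) * f (t - y)) := by
    intro t
    rw [← intervalIntegral.integral_const_mul]
    refine intervalIntegral.integral_congr fun y _ => ?_
    have : Real.exp (-(μ * t)) = Real.exp (-(μ * y)) * Real.exp (-(μ * (t - y))) := by
      rw [← Real.exp_add]; ring_nf
    simp only [ContinuousLinearMap.mul_apply']
    rw [this]; ring
  refine ⟨?_, ?_⟩
  · have := integrable_posConvolution hg.1 hf.1 (ContinuousLinearMap.mul ℝ ℝ)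
    refine (this.integrableOn (s := Ioi 0)).congr_fun (fun t ht => ?_) measurableSet_Ioi
    simp only [posConvolution, indicator_of_mem ht]
    rw [e]
  · simp only [e]
    have := integral_posConvolution hg.1 hf.1 (ContinuousLinearMap.mul ℝ ℝ)
    rw [this, hg.2, hf.2]
    simp [mul_comm]

/-- Power functions: the transform of `t ^ (a - 1)` is `Γ(a) μ ^ (-a)`. -/
theorem rpow {a : ℝ} (ha : 0 < a) (hμ : 0 < μ) :
    HasLaplaceAt (fun t => t ^ (a - 1)) μ (Real.Gamma a * μ ^ (-a)) := by
  refine ⟨?_, ?_⟩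
  · have := integrableOn_rpow_mul_exp_neg_mul_rpow (s := a - 1) (p := 1) (b := μ)
      (by linarith) one_pos hμ
    refine this.congr_fun (fun t _ => ?_) measurableSet_Ioi
    simp only [Real.rpow_one]
    rw [mul_comm, neg_mul]
  · have := Real.integral_rpow_mul_exp_neg_mul_Ioi ha hμ
    simp only [mul_comm (Real.exp _)]
    rw [this, one_div, Real.inv_rpow hμ.le, Real.rpow_neg hμ.le, mul_comm]

/-- Termwise transformation of a series of functions. -/
theorem hasSum {f : ℕ → ℝ → ℝ} {F A : ℕ → ℝ} (h : ∀ n, HasLaplaceAt (f n) μ (F n))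
    (habs : ∀ n, HasLaplaceAt (fun t => |f n t|) μ (A n)) (hA : Summable A)
    (hm : AEStronglyMeasurable (fun t => ∑' n, f n t) (volume.restrict (Ioi 0))) :
    HasLaplaceAt (fun t => ∑' n, f n t) μ (∑' n, F n) := by
  have hn : ∀ n t, ‖Real.exp (-(μ * t)) * f n t‖ = Real.exp (-(μ * t)) * |f n t| := by
    intro n t
    rw [norm_mul, Real.norm_of_nonneg (Real.exp_nonneg _), Real.norm_eq_abs]
  have hs : Summable fun n => ∫ t in Ioi (0 : ℝ), ‖Real.exp (-(μ * t)) * f n t‖ := by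
    simp only [hn]
    simpa only [(habs _).2] using hA
  have hsum := hasSum_integral_of_summable_integral_norm (fun n => (h n).1) hs
  simp only [tsum_mul_left, (h _).2] at hsum
  refine ⟨?_, hsum.tsum_eq.symm⟩
  have h1 : ∑' n, ∫⁻ t in Ioi (0 : ℝ), ‖Real.exp (-(μ * t)) * f n t‖ₑ ≠ ⊤ := by
    have : ∀ n, ∫⁻ t in Ioi (0 : ℝ), ‖Real.exp (-(μ * t)) * f n t‖ₑ = ENNReal.ofReal (A n) := by
      intro n
      rw [← ofReal_integral_norm_eq_lintegral_enorm (h n).1]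
      simp only [hn, (habs n).2]
    simp only [this]
    exact hA.tsum_ofReal_ne_top
  refine ⟨(by fun_prop : Continuous fun t => Real.exp (-(μ * t))).aestronglyMeasurable.mul hm, ?_⟩
  refine lt_of_le_of_lt (lintegral_mono fun t => ?_) (lt_top_iff_ne_top.2
    ((lintegral_tsum fun n => (h n).1.aestronglyMeasurable.enorm).trans_ne h1))
  simp only [← tsum_mul_left]
  exact enorm_tsum_le_tsum_enorm

end HasLaplaceAt

theorem HasLaplaceAt.aestronglyMeasurable {f : ℝ → ℝ} {μ F : ℝ} (h : HasLaplaceAt f μ F) :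
    AEStronglyMeasurable f (volume.restrict (Ioi 0)) := by
  have := ((by fun_prop : Continuous fun t => Real.exp (μ * t)).aestronglyMeasurable
    (μ := volume.restrict (Ioi (0 : ℝ)))).mul h.1.aestronglyMeasurable
  refine this.congr (Eventually.of_forall fun t => ?_)
  simp only [Pi.mul_apply]
  rw [← mul_assoc, ← Real.exp_add]
  simp

theorem HasLaplaceAt.exp {c μ : ℝ} (h : c < μ) :
    HasLaplaceAt (fun t => Real.exp (c * t)) μ (1 / (μ - c)) := by
  have e : ∀ t, Real.exp (-(μ * t)) * Real.exp (c * t) = Real.exp ((c - μ) * t) := fun t => by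
    rw [← Real.exp_add]; ring_nf
  refine ⟨?_, ?_⟩
  · simp only [e]
    exact integrableOn_exp_mul_Ioi (by linarith) 0
  · simp only [e]
    rw [integral_exp_mul_Ioi (by linarith)]
    rw [mul_zero, Real.exp_zero, ← neg_sub μ c, neg_div_neg_eq]

theorem HasLaplaceAt.one {μ : ℝ} (h : 0 < μ) : HasLaplaceAt (fun _ => 1) μ (1 / μ) := by
  simpa using HasLaplaceAt.exp h

/-- A function with a Laplace transform is locally integrable. -/
theorem HasLaplaceAt.intervalIntegrable {f : ℝ → ℝ} {μ F : ℝ} (h : HasLaplaceAt f μ F) {a b : ℝ}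
    (ha : 0 ≤ a) (hb : 0 ≤ b) : IntervalIntegrable f volume a b := by
  have h0 : ∀ b : ℝ, 0 ≤ b → IntervalIntegrable f volume 0 b := by
    intro b hb
    have h1 : IntervalIntegrable (fun t => Real.exp (-(μ * t)) * f t) volume 0 b :=
      (intervalIntegrable_iff_integrableOn_Ioc_of_le hb).2 (h.1.mono_set fun x hx => hx.1)
    have h2 := h1.continuousOn_mul (g := fun t => Real.exp (μ * t)) (by fun_prop)
    refine h2.congr fun t _ => ?_
    rw [← mul_assoc, ← Real.exp_add, add_neg_cancel, Real.exp_zero, one_mul]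
  exact (h0 a ha).symm.trans (h0 b hb)

/-- Lerch's theorem: a function whose Laplace transform vanishes on a half-line is null. In the
variable `x = exp (-t)` all moments of the function vanish, so that Weierstrass' theorem applies. -/
theorem ae_eq_zero_of_hasLaplaceAt_zero {h : ℝ → ℝ} {μ₀ : ℝ}
    (H : ∀ μ, μ₀ < μ → HasLaplaceAt h μ 0) : ∀ᵐ t, t ∈ Ioi (0 : ℝ) → h t = 0 := by
  set w : ℝ → ℝ := fun t => Real.exp (-((μ₀ + 1) * t)) * h t with hw
  have hwi : IntegrableOn w (Ioi 0) := (H (μ₀ + 1) (by linarith)).1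
  -- The transform at `μ₀ + 1 + n` is the `n`-th moment of `w` in the variable `exp (-t)`.
  have hmom : ∀ n : ℕ, IntegrableOn (fun t => Real.exp (-t) ^ n * w t) (Ioi 0) ∧
      ∫ t in Ioi (0 : ℝ), Real.exp (-t) ^ n * w t = 0 := by
    intro n
    have := H (μ₀ + 1 + n) (by linarith [n.cast_nonneg (α := ℝ)])
    have e : ∀ t, Real.exp (-((μ₀ + 1 + n) * t)) * h t = Real.exp (-t) ^ n * w t := by
      intro t
      rw [hw, ← Real.exp_nat_mul]
      simp only
      rw [← mul_assoc, ← Real.exp_add]; ring_nf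
    simpa only [HasLaplaceAt, e] using this
  have hpoly : ∀ q : Polynomial ℝ, IntegrableOn (fun t => q.eval (Real.exp (-t)) * w t) (Ioi 0) ∧
      ∫ t in Ioi (0 : ℝ), q.eval (Real.exp (-t)) * w t = 0 := by
    intro q
    simp only [Polynomial.eval_eq_sum_range, Finset.sum_mul, mul_assoc]
    have hi : ∀ i ∈ Finset.range (q.natDegree + 1),
        IntegrableOn (fun t => q.coeff i * (Real.exp (-t) ^ i * w t)) (Ioi 0) :=
      fun i _ => (hmom i).1.const_mul _
    refine ⟨integrable_finsetSum _ hi, ?_⟩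
    rw [integral_finsetSum _ hi]
    refine Finset.sum_eq_zero fun i _ => ?_
    rw [integral_const_mul, (hmom i).2, mul_zero]
  have hcont : ∀ Φ : ℝ → ℝ, ContinuousOn Φ (Icc 0 1) →
      AEStronglyMeasurable (fun t => Φ (Real.exp (-t)) * w t) (volume.restrict (Ioi 0)) →
      ∫ t in Ioi (0 : ℝ), Φ (Real.exp (-t)) * w t = 0 := by
    intro Φ hΦ hm
    set C := ∫ t in Ioi (0 : ℝ), ‖w t‖ with hC
    have hC0 : 0 ≤ C := integral_nonneg fun _ => norm_nonneg _
    by_contra hne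
    have hpos : 0 < ‖∫ t in Ioi (0 : ℝ), Φ (Real.exp (-t)) * w t‖ := norm_pos_iff.2 hne
    set I := ∫ t in Ioi (0 : ℝ), Φ (Real.exp (-t)) * w t with hI
    obtain ⟨q, hq⟩ := exists_polynomial_near_of_continuousOn 0 1 Φ hΦ (‖I‖ / (C + 1))
      (by positivity)
    have hmem : ∀ t ∈ Ioi (0 : ℝ), Real.exp (-t) ∈ Icc (0 : ℝ) 1 := fun t ht =>
      ⟨(Real.exp_pos _).le, Real.exp_le_one_iff.2 (by simpa using (le_of_lt ht))⟩
    have hbd : ∀ᵐ t ∂volume.restrict (Ioi (0 : ℝ)),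
        ‖(q.eval (Real.exp (-t)) - Φ (Real.exp (-t))) * w t‖ ≤ ‖I‖ / (C + 1) * ‖w t‖ := by
      filter_upwards [ae_restrict_mem measurableSet_Ioi] with t ht
      rw [norm_mul]
      exact mul_le_mul_of_nonneg_right (hq _ (hmem t ht)).le (norm_nonneg _)
    have hdi : IntegrableOn (fun t => (q.eval (Real.exp (-t)) - Φ (Real.exp (-t))) * w t)
        (Ioi 0) := by
      refine Integrable.mono' (hwi.norm.const_mul _) ?_ hbd
      simp only [sub_mul]
      exact (hpoly q).1.aestronglyMeasurable.sub hm
    have h1 : ‖∫ t in Ioi (0 : ℝ), (q.eval (Real.exp (-t)) - Φ (Real.exp (-t))) * w t‖ ≤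
        ‖I‖ / (C + 1) * C := by
      rw [hC, ← integral_const_mul]
      exact norm_integral_le_of_norm_le (hwi.norm.const_mul _) hbd
    have hΦi : IntegrableOn (fun t => Φ (Real.exp (-t)) * w t) (Ioi 0) := by
      have := (hpoly q).1.sub hdi
      refine this.congr_fun (fun t _ => ?_) measurableSet_Ioi
      simp only [Pi.sub_apply]; ring
    simp only [sub_mul] at h1
    rw [integral_sub (hpoly q).1 hΦi, (hpoly q).2, zero_sub, norm_neg, ← hI] at h1
    have : ‖I‖ / (C + 1) * C < ‖I‖ := by
      rw [div_mul_eq_mul_div, div_lt_iff₀ (by positivity)]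
      nlinarith
    linarith
  have hz : ∀ᵐ t, t ∈ Ioi (0 : ℝ) → w t = 0 := by
    refine isOpen_Ioi.ae_eq_zero_of_integral_contDiff_smul_eq_zero hwi.locallyIntegrableOn ?_
    intro g hg hgc hgs
    have hg0 : ∀ t, t ≤ 0 → g t = 0 := fun t ht => by
      by_contra hne
      exact absurd (hgs (subset_tsupport _ hne)) (not_lt.2 ht)
    obtain ⟨M, hM⟩ : ∃ M, ∀ t, M < t → g t = 0 := by
      obtain ⟨M, hM⟩ := hgc.isCompact.bddAbove
      refine ⟨M, fun t ht => ?_⟩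
      by_contra hne
      exact absurd (hM (subset_tsupport _ hne)) (not_le.2 ht)
    -- At `x = 0` the junk value `log 0 = 0` does no harm: `g` vanishes at `0`, and at large times.
    have hΦ : ContinuousOn (fun x => g (-Real.log x)) (Icc 0 1) := by
      intro x hx
      rcases hx.1.eq_or_lt with rfl | hx0
      · have : (fun x => g (-Real.log x)) =ᶠ[𝓝 0] fun _ => 0 := by
          have h0 : Tendsto (fun y : ℝ => |y|) (𝓝 0) (𝓝 0) := by
            simpa using (continuous_abs (G := ℝ)).tendsto 0
          filter_upwards [h0.eventually (gt_mem_nhds (Real.exp_pos (-M)))] with y hy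
          rcases eq_or_ne y 0 with rfl | h
          · simp [hg0 0 le_rfl]
          · refine hM _ ?_
            have := Real.log_lt_log (abs_pos.2 h) hy
            rw [Real.log_exp, Real.log_abs] at this
            linarith
        exact (continuousAt_const.congr this.symm).continuousWithinAt
      · exact (hg.continuous.continuousAt.comp (Real.continuousAt_log hx0.ne').neg).continuousWithinAt
    have := hcont (fun x => g (-Real.log x)) hΦ (by
      simp only [Real.log_exp, neg_neg]
      exact hg.continuous.aestronglyMeasurable.mul hwi.aestronglyMeasurable)
    simp only [Real.log_exp, neg_neg] at this
    rw [← setIntegral_eq_integral_of_forall_compl_eq_zero (s := Ioi 0)]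
    · simpa using this
    · intro t ht
      rw [hg0 t (not_lt.1 ht), zero_smul]
  filter_upwards [hz] with t ht h0
  simpa [hw, (Real.exp_pos _).ne'] using ht h0

/-- Continuous functions with the same Laplace transform on a half-line coincide. -/
theorem eqOn_of_hasLaplaceAt {f g : ℝ → ℝ} {μ₀ : ℝ} {F : ℝ → ℝ}
    (hf : ∀ μ, μ₀ < μ → HasLaplaceAt f μ (F μ)) (hg : ∀ μ, μ₀ < μ → HasLaplaceAt g μ (F μ))
    (hfc : ContinuousOn f (Ioi 0)) (hgc : ContinuousOn g (Ioi 0)) : EqOn f g (Ioi 0) := by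
  have := ae_eq_zero_of_hasLaplaceAt_zero (h := fun t => f t - g t) (μ₀ := μ₀)
    fun μ hμ => by simpa using (hf μ hμ).sub (hg μ hμ)
  refine Measure.eqOn_open_of_ae_eq (μ := volume) ?_ isOpen_Ioi hfc hgc
  rw [EventuallyEq, ae_restrict_iff' measurableSet_Ioi]
  filter_upwards [this] with t ht h0
  linarith [ht h0]

/-- A monotone function with the same Laplace transform as a continuous one coincides with it. -/
theorem eqOn_of_hasLaplaceAt_of_monotoneOn {f g : ℝ → ℝ} {μ₀ : ℝ} {F : ℝ → ℝ}
    (hf : ∀ μ, μ₀ < μ → HasLaplaceAt f μ (F μ)) (hg : ∀ μ, μ₀ < μ → HasLaplaceAt g μ (F μ))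
    (hfm : MonotoneOn f (Ioi 0)) (hgc : ContinuousOn g (Ioi 0)) : EqOn f g (Ioi 0) := by
  have h0 := ae_eq_zero_of_hasLaplaceAt_zero (h := fun t => f t - g t) (μ₀ := μ₀)
    fun μ hμ => by simpa using (hf μ hμ).sub (hg μ hμ)
  have hd : Dense {t : ℝ | t ∈ Ioi (0 : ℝ) → f t - g t = 0} := Measure.dense_of_ae h0
  intro t ht
  have hgt : ContinuousAt g t := hgc.continuousAt (isOpen_Ioi.mem_nhds ht)
  refine le_antisymm ?_ ?_
  · refine le_of_forall_gt_imp_ge_of_dense fun c hc => ?_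
    obtain ⟨ε, hε, hb⟩ := Metric.eventually_nhds_iff.1 (hgt.eventually (gt_mem_nhds hc))
    obtain ⟨s, hs, hs1⟩ := hd.exists_between (show t < t + ε by linarith)
    have hs0 : s ∈ Ioi (0 : ℝ) := lt_trans ht hs1.1
    have : g s < c := hb (by rw [Real.dist_eq, abs_lt]; constructor <;> linarith [hs1.1, hs1.2])
    have := hfm ht hs0 hs1.1.le
    linarith [hs hs0]
  · refine le_of_forall_lt_imp_le_of_dense fun c hc => ?_
    obtain ⟨ε, hε, hb⟩ := Metric.eventually_nhds_iff.1 (hgt.eventually (lt_mem_nhds hc))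
    have ht' : (0 : ℝ) < t := ht
    obtain ⟨s, hs, hs1⟩ := hd.exists_between (show max (t - ε) 0 < t from max_lt (by linarith) ht')
    have hs0 : s ∈ Ioi (0 : ℝ) := lt_of_le_of_lt (le_max_right _ _) hs1.1
    have h2 := lt_of_le_of_lt (le_max_left _ _) hs1.1
    have : c < g s := hb (by rw [Real.dist_eq, abs_lt]; constructor <;> linarith [hs1.2])
    have := hfm hs0 ht hs1.2.le
    linarith [hs hs0]

/-! ### Prabhakar kernels -/

/-- The coefficients of the negative binomial series. -/
theorem choose_add_sub_one_eq (g : ℝ) (n : ℕ) :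
    Ring.choose (g + n - 1) n = (ascPochhammer ℝ n).eval g / n.factorial := by
  rw [Ring.choose, eq_div_iff (by positivity), mul_comm, ← nsmul_eq_mul,
    Ring.factorial_nsmul_multichoose_eq_ascPochhammer, Polynomial.ascPochhammer_smeval_eq_eval]
  ring_nf

theorem hasSum_ascPochhammer_mul_pow (g : ℝ) {x : ℝ} (hx : |x| < 1) :
    HasSum (fun r : ℕ => (ascPochhammer ℝ r).eval g / r.factorial * x ^ r) ((1 - x) ^ (-g)) := by
  have h := (Real.one_div_one_sub_rpow_hasFPowerSeriesOnBall_zero g).hasSum (y := x)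
    (by simpa [Metric.mem_eball, edist_dist, ENNReal.ofReal_lt_one] using hx)
  simp only [FormalMultilinearSeries.ofScalars_apply_eq, zero_add, choose_add_sub_one_eq,
    smul_eq_mul] at h
  rwa [one_div, ← Real.rpow_neg (by linarith [(abs_lt.1 hx).2])] at h

theorem summable_ascPochhammer_mul_pow (g : ℝ) {x : ℝ} (hx : |x| < 1) :
    Summable fun r : ℕ => |(ascPochhammer ℝ r).eval g / r.factorial| * |x| ^ r := by
  simpa only [abs_mul, abs_pow] using (hasSum_ascPochhammer_mul_pow g hx).summable.abs

/-- The Gamma function grows faster than every exponential: keep only the times in `(1, 2]` in the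
integral for `Γ(s) μ ^ (-s)`. -/
theorem rpow_mul_exp_le_Gamma {s μ : ℝ} (hs : 1 ≤ s) (hμ : 0 < μ) :
    μ ^ s * Real.exp (-(2 * μ)) ≤ Real.Gamma s := by
  have h := HasLaplaceAt.rpow (a := s) (by linarith) hμ
  have h1 : Real.exp (-(2 * μ)) ≤ Real.Gamma s * μ ^ (-s) := by
    rw [← h.2]
    calc Real.exp (-(2 * μ)) = ∫ t in Ioc (1 : ℝ) 2, Real.exp (-(2 * μ)) := by
          simp; norm_num
      _ ≤ ∫ t in Ioc (1 : ℝ) 2, Real.exp (-(μ * t)) * t ^ (s - 1) := by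
          refine setIntegral_mono_on (by simp) (h.1.mono_set fun t ht => ?_) measurableSet_Ioc
            fun t ht => ?_
          · exact lt_trans one_pos ht.1
          · have h2 : 1 ≤ t ^ (s - 1) := Real.one_le_rpow ht.1.le (by linarith)
            have h3 : Real.exp (-(2 * μ)) ≤ Real.exp (-(μ * t)) :=
              Real.exp_le_exp.2 (by nlinarith [ht.2])
            nlinarith [Real.exp_pos (-(μ * t))]
      _ ≤ _ := by
          refine setIntegral_mono_set h.1 ?_ (Eventually.of_forall fun t ht => ?_)
          · filter_upwards [ae_restrict_mem measurableSet_Ioi] with t ht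
            exact mul_nonneg (Real.exp_nonneg _) (Real.rpow_nonneg (le_of_lt ht) _)
          · exact lt_trans one_pos ht.1
  calc μ ^ s * Real.exp (-(2 * μ)) ≤ μ ^ s * (Real.Gamma s * μ ^ (-s)) := by gcongr
    _ = Real.Gamma s := by
      rw [Real.rpow_neg hμ.le]
      field_simp

section MittagLeffler

variable {α : ℝ}

/-- The Mittag-Leffler series converges absolutely everywhere: for `μ ^ α = 2 (|x| + 1)` the bound
`Γ(α r + ϖ) ≥ μ ^ (α r + ϖ) exp (-2 μ)` dominates it by a binomial series at `1 / 2`. -/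
theorem summable_mittagLeffler_abs (hα : 0 < α) (ϖ g x : ℝ) :
    Summable fun r : ℕ =>
      |x ^ r * (ascPochhammer ℝ r).eval g / ((r.factorial : ℝ) * Real.Gamma (α * r + ϖ))| := by
  set M : ℝ := 2 * (|x| + 1) with hM
  have hM0 : 0 < M := by positivity
  set μ : ℝ := M ^ (1 / α) with hμ
  have hμ0 : 0 < μ := Real.rpow_pos_of_pos hM0 _
  have hμα : μ ^ α = M := by
    rw [hμ, ← Real.rpow_mul hM0.le, one_div_mul_cancel hα.ne', Real.rpow_one]
  have hs := summable_ascPochhammer_mul_pow g (x := 1 / 2) (by norm_num [abs_of_pos])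
  refine Summable.of_norm_bounded_eventually_nat
    (g := fun r => Real.exp (2 * μ) * μ ^ (-ϖ) *
      (|(ascPochhammer ℝ r).eval g / r.factorial| * |(1 / 2 : ℝ)| ^ r)) (hs.mul_left _) ?_
  have hev : ∀ᶠ r : ℕ in atTop, 1 ≤ α * r + ϖ := by
    have : Tendsto (fun r : ℕ => α * (r : ℝ) + ϖ) atTop atTop :=
      tendsto_atTop_add_const_right _ _ (tendsto_natCast_atTop_atTop.const_mul_atTop hα)
    exact this.eventually_ge_atTop 1
  filter_upwards [hev] with r hr
  have hG := rpow_mul_exp_le_Gamma hr hμ0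
  have hG0 : 0 < Real.Gamma (α * r + ϖ) := Real.Gamma_pos_of_pos (by linarith)
  have hsplit : μ ^ (α * r + ϖ) = M ^ r * μ ^ ϖ := by
    rw [Real.rpow_add hμ0, Real.rpow_mul hμ0.le, hμα, Real.rpow_natCast]
  have hx : |x| ^ r / M ^ r ≤ |(1 / 2 : ℝ)| ^ r := by
    rw [← div_pow]
    refine pow_le_pow_left₀ (by positivity) ?_ _
    rw [abs_of_pos (by norm_num : (0 : ℝ) < 1 / 2), div_le_iff₀ hM0, hM]
    linarith
  rw [Real.norm_eq_abs, abs_abs]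
  have e : |x ^ r * (ascPochhammer ℝ r).eval g / ((r.factorial : ℝ) * Real.Gamma (α * r + ϖ))| =
      |(ascPochhammer ℝ r).eval g / r.factorial| * (|x| ^ r / Real.Gamma (α * r + ϖ)) := by
    rw [abs_div, abs_mul, abs_mul, abs_pow, abs_of_pos hG0, abs_div]
    field_simp
  rw [e]
  have h2 : |x| ^ r / Real.Gamma (α * r + ϖ) ≤
      Real.exp (2 * μ) * μ ^ (-ϖ) * |(1 / 2 : ℝ)| ^ r := by
    calc |x| ^ r / Real.Gamma (α * r + ϖ)
        ≤ |x| ^ r / (M ^ r * μ ^ ϖ * Real.exp (-(2 * μ))) := by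
          rw [← hsplit]; gcongr
      _ = Real.exp (2 * μ) * μ ^ (-ϖ) * (|x| ^ r / M ^ r) := by
          rw [Real.exp_neg, Real.rpow_neg hμ0.le]
          field_simp
      _ ≤ _ := by gcongr
  calc _ ≤ |(ascPochhammer ℝ r).eval g / r.factorial| *
        (Real.exp (2 * μ) * μ ^ (-ϖ) * |(1 / 2 : ℝ)| ^ r) := by gcongr
    _ = _ := by ring

theorem continuous_mittagLeffler (hα : 0 < α) (ϖ g : ℝ) :
    Continuous (mittagLeffler α ϖ g) := by
  rw [continuous_iff_continuousAt]
  intro x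
  have : ContinuousOn (mittagLeffler α ϖ g) (Icc (-(|x| + 1)) (|x| + 1)) := by
    refine continuousOn_tsum (fun r => by fun_prop)
      (summable_mittagLeffler_abs hα ϖ g (|x| + 1)) fun r y hy => ?_
    have hyx : |y| ≤ |x| + 1 := abs_le.2 hy
    have hx : |(|x| + 1) ^ r| = (|x| + 1) ^ r := abs_of_nonneg (by positivity)
    rw [Real.norm_eq_abs, abs_div, abs_mul, abs_pow, abs_div, abs_mul ((|x| + 1) ^ r), hx]
    gcongr
  refine this.continuousAt (Icc_mem_nhds ?_ ?_)
  · linarith [neg_abs_le x]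
  · linarith [le_abs_self x]

/-- The kernel `t ^ (ϖ - 1) E^g_{α,ϖ}(-om t ^ α)`. -/
def prabhakarKernel (α om g ϖ t : ℝ) : ℝ :=
  t ^ (ϖ - 1) * mittagLeffler α ϖ g (-(om * t ^ α))

theorem continuousOn_prabhakarKernel (hα : 0 < α) (om g ϖ : ℝ) :
    ContinuousOn (prabhakarKernel α om g ϖ) (Ioi 0) := by
  refine ContinuousOn.mul (fun t ht => ?_) ?_
  · exact (Real.continuousAt_rpow_const _ _ (Or.inl (ne_of_gt ht))).continuousWithinAt
  · exact ((continuous_mittagLeffler hα ϖ g).comp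
      (((Real.continuous_rpow_const hα.le).const_mul om).neg)).continuousOn

/-- The transform of the kernel is `μ ^ (-ϖ) (1 + om μ ^ (-α)) ^ (-g)`: transform the series
termwise, and sum the resulting binomial series. -/
theorem hasLaplaceAt_prabhakarKernel (hα : 0 < α) {om ϖ μ : ℝ} (g : ℝ) (hom : 0 ≤ om)
    (hϖ : 0 < ϖ) (hμ : 0 < μ) (h : om < μ ^ α) :
    HasLaplaceAt (prabhakarKernel α om g ϖ) μ
      (μ ^ (-ϖ) * (1 + om * μ ^ (-α)) ^ (-g)) := by
  set c : ℕ → ℝ := fun r => (ascPochhammer ℝ r).eval g / r.factorial with hc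
  have hμα : μ ^ (-α) = (μ ^ α)⁻¹ := Real.rpow_neg hμ.le _
  have hx1 : |-(om * μ ^ (-α))| < 1 := by
    rw [abs_neg, abs_of_nonneg (by positivity), hμα, ← div_eq_mul_inv,
      div_lt_one (by positivity)]
    exact h
  have hpos : ∀ r : ℕ, 0 < α * r + ϖ := fun r => by positivity
  have hμr : ∀ r : ℕ, μ ^ (-(α * r + ϖ)) = μ ^ (-ϖ) * (μ ^ (-α)) ^ r := by
    intro r
    rw [← Real.rpow_natCast (μ ^ (-α)), ← Real.rpow_mul hμ.le, ← Real.rpow_add hμ]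
    ring_nf
  have hterm : ∀ r : ℕ, HasLaplaceAt (fun t => c r * (-om) ^ r / Real.Gamma (α * r + ϖ) *
      t ^ (α * r + ϖ - 1)) μ (μ ^ (-ϖ) * (c r * (-(om * μ ^ (-α))) ^ r)) := by
    intro r
    have hG := (Real.Gamma_pos_of_pos (hpos r)).ne'
    convert (HasLaplaceAt.rpow (hpos r) hμ).const_mul (c r * (-om) ^ r / Real.Gamma (α * r + ϖ))
      using 1
    rw [hμr, ← neg_mul, mul_pow]
    field_simp
  have habs : ∀ r : ℕ, HasLaplaceAt (fun t => |c r * (-om) ^ r / Real.Gamma (α * r + ϖ) *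
      t ^ (α * r + ϖ - 1)|) μ (μ ^ (-ϖ) * (|c r| * |-(om * μ ^ (-α))| ^ r)) := by
    intro r
    have hG := Real.Gamma_pos_of_pos (hpos r)
    have e : μ ^ (-ϖ) * (|c r| * |-(om * μ ^ (-α))| ^ r) =
        |c r| * om ^ r / Real.Gamma (α * r + ϖ) *
          (Real.Gamma (α * r + ϖ) * μ ^ (-(α * r + ϖ))) := by
      rw [hμr, abs_neg, abs_of_nonneg (by positivity : 0 ≤ om * μ ^ (-α)), mul_pow]
      field_simp
    rw [e]
    refine ((HasLaplaceAt.rpow (hpos r) hμ).const_mul _).congr fun t ht => ?_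
    simp only
    rw [abs_mul _ (t ^ _), abs_div (c r * _), abs_mul (c r), abs_pow, abs_neg, abs_of_nonneg hom,
      abs_of_pos hG, abs_of_nonneg (Real.rpow_nonneg (le_of_lt ht) _)]
  have hseries : EqOn (fun t => ∑' r : ℕ, c r * (-om) ^ r / Real.Gamma (α * r + ϖ) *
      t ^ (α * r + ϖ - 1)) (prabhakarKernel α om g ϖ) (Ioi 0) := by
    intro t ht
    have ht : 0 < t := ht
    simp only [prabhakarKernel, mittagLeffler, ← tsum_mul_left]
    refine tsum_congr fun r => ?_
    rw [show α * r + ϖ - 1 = (ϖ - 1) + α * r by ring, Real.rpow_add ht, Real.rpow_mul ht.le,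
      Real.rpow_natCast, ← neg_mul, mul_pow]
    simp only [hc]
    have hG := (Real.Gamma_pos_of_pos (hpos r)).ne'
    field_simp
  have hfin := HasLaplaceAt.hasSum hterm habs
    ((summable_ascPochhammer_mul_pow g hx1).mul_left _)
    (((continuousOn_prabhakarKernel hα om g ϖ).congr hseries).aestronglyMeasurable
      measurableSet_Ioi)
  rw [tsum_mul_left, (hasSum_ascPochhammer_mul_pow g hx1).tsum_eq, sub_neg_eq_add] at hfin
  exact hfin.congr hseries

end MittagLeffler

/-! ### Processes at random times -/

section RandomTime

variable {Ω : Type*} [MeasurableSpace Ω]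

/-- The approximation of `y` from above by points of the lattice of mesh `1 / (n + 1)`. -/
def gridAbove (n : ℕ) (y : ℝ≥0) : ℝ≥0 := ((⌊(n + 1) * y⌋₊ : ℝ≥0) + 1) / (n + 1)

theorem le_gridAbove (n : ℕ) (y : ℝ≥0) : y ≤ gridAbove n y := by
  rw [gridAbove, le_div_iff₀ (by positivity), mul_comm]
  exact (Nat.lt_floor_add_one _).le

theorem gridAbove_le (n : ℕ) (y : ℝ≥0) : gridAbove n y ≤ y + 1 / (n + 1) := by
  rw [gridAbove, add_div]
  gcongr
  rw [div_le_iff₀ (by positivity), mul_comm y]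
  exact Nat.floor_le (by positivity)

theorem tendsto_gridAbove (y : ℝ≥0) : Tendsto (fun n => gridAbove n y) atTop (𝓝[≥] y) := by
  refine tendsto_nhdsWithin_iff.2 ⟨?_, Eventually.of_forall fun n => le_gridAbove n y⟩
  refine tendsto_of_tendsto_of_tendsto_of_le_of_le tendsto_const_nhds ?_
    (fun n => le_gridAbove n y) (fun n => gridAbove_le n y)
  have : Tendsto (fun n : ℕ => y + 1 / ((n : ℝ≥0) + 1)) atTop (𝓝 (y + 0)) := by
    refine tendsto_const_nhds.add ?_
    rw [← NNReal.tendsto_coe]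
    simpa using tendsto_one_div_add_atTop_nhds_zero_nat (𝕜 := ℝ)
  simpa using this

/-- A jointly measurable evaluation of paths at lattice points. -/
theorem measurable_eval_gridAbove {α E : Type*} [MeasurableSpace α] [MeasurableSpace E]
    {X : ℝ≥0 → α → E} (hX : ∀ s, Measurable (X s)) (n : ℕ) :
    Measurable fun q : ℝ≥0 × α => X (gridAbove n q.1) q.2 := by
  have h1 : Measurable fun q : ℕ × α => X (((q.1 : ℝ≥0) + 1) / (n + 1)) q.2 :=
    measurable_from_prod_countable_right fun k => hX (((k : ℝ≥0) + 1) / (n + 1))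
  have h2 : Measurable fun q : ℝ≥0 × α => ((⌊((n : ℝ≥0) + 1) * q.1⌋₊ : ℕ), q.2) :=
    (Nat.measurable_floor.comp (measurable_fst.const_mul _)).prodMk measurable_snd
  have h3 := h1.comp h2
  unfold gridAbove
  exact h3

/-- A process with right-continuous paths is jointly measurable. -/
theorem measurable_uncurry_of_right_cont {E : Type*} [MeasurableSpace E] [TopologicalSpace E]
    [TopologicalSpace.PseudoMetrizableSpace E] [BorelSpace E] {X : ℝ≥0 → Ω → E}
    (hX : ∀ s, Measurable (X s)) (hr : ∀ w s, ContinuousWithinAt (fun s => X s w) (Ici s) s) :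
    Measurable fun q : ℝ≥0 × Ω => X q.1 q.2 := by
  refine measurable_of_tendsto_metrizable (measurable_eval_gridAbove hX) ?_
  exact tendsto_pi_nhds.2 fun q => (hr q.2 q.1).tendsto.comp (tendsto_gridAbove q.1)

/-- Freezing: a bounded right-continuous process at an independent random time may be integrated
by first averaging the process at fixed times. The paths are evaluated along lattice times, where
the evaluation map is measurable for the product `σ`-algebra on path space. -/
theorem integral_randomTime {P : Measure Ω} [IsProbabilityMeasure P] {Z : ℝ≥0 → Ω → ℝ}
    {Y : Ω → ℝ≥0} (hZ : ∀ s, Measurable (Z s)) (hb : ∀ s w, |Z s w| ≤ 1)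
    (hr : ∀ w s, ContinuousWithinAt (fun s => Z s w) (Ici s) s) (hY : Measurable Y)
    (hi : IndepFun (fun w s => Z s w) Y P) :
    ∫ w, Z (Y w) w ∂P = ∫ w, (∫ w', Z (Y w) w' ∂P) ∂P := by
  have hpath : Measurable fun w s => Z s w := measurable_pi_lambda _ hZ
  have hstep : ∀ n, ∫ w, Z (gridAbove n (Y w)) w ∂P =
      ∫ w, (∫ w', Z (gridAbove n (Y w)) w' ∂P) ∂P := by
    intro n
    set e : ℝ≥0 × (ℝ≥0 → ℝ) → ℝ := fun q => q.2 (gridAbove n q.1) with he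
    have hem : Measurable e :=
      measurable_eval_gridAbove (X := fun s (x : ℝ≥0 → ℝ) => x s) (fun s => measurable_pi_apply s) n
    have hprod := (indepFun_iff_map_prod_eq_prod_map_map hY.aemeasurable hpath.aemeasurable).1
      hi.symm
    have hpair : Measurable fun w => (Y w, fun s => Z s w) := hY.prodMk hpath
    have hint : Integrable e (P.map fun w => (Y w, fun s => Z s w)) := by
      rw [integrable_map_measure hem.aestronglyMeasurable hpair.aemeasurable]
      refine Integrable.of_bound (hem.comp hpair).aestronglyMeasurable 1
        (Eventually.of_forall fun w => ?_)
      exact hb _ w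
    calc ∫ w, Z (gridAbove n (Y w)) w ∂P = ∫ q, e q ∂(P.map fun w => (Y w, fun s => Z s w)) := by
          rw [integral_map hpair.aemeasurable hem.aestronglyMeasurable]
      _ = ∫ y, (∫ x, e (y, x) ∂(P.map fun w s => Z s w)) ∂(P.map Y) := by
          rw [hprod] at hint ⊢
          rw [integral_prod _ hint]
      _ = ∫ y, (∫ w', Z (gridAbove n y) w' ∂P) ∂(P.map Y) := by
          congr 1 with y
          exact integral_map hpath.aemeasurable (f := fun x => e (y, x))
            (hem.comp measurable_prodMk_left).aestronglyMeasurable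
      _ = _ := by
          rw [integral_map hY.aemeasurable]
          have hm : StronglyMeasurable fun q : ℝ≥0 × Ω => Z (gridAbove n q.1) q.2 :=
            (measurable_eval_gridAbove hZ n).stronglyMeasurable
          exact hm.integral_prod_right'.aestronglyMeasurable
  have hgm : ∀ n, AEStronglyMeasurable (fun w => ∫ w', Z (gridAbove n (Y w)) w' ∂P) P := by
    intro n
    have hm : StronglyMeasurable fun q : ℝ≥0 × Ω => Z (gridAbove n q.1) q.2 :=
      (measurable_eval_gridAbove hZ n).stronglyMeasurable
    exact (hm.integral_prod_right'.comp_measurable hY).aestronglyMeasurable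
  have hgb : ∀ s, ‖∫ w', Z s w' ∂P‖ ≤ 1 := fun s => by
    simpa using norm_integral_le_of_norm_le_const (μ := P) (C := 1) (f := Z s)
      (Eventually.of_forall fun w => hb s w)
  have h1 : Tendsto (fun n => ∫ w, Z (gridAbove n (Y w)) w ∂P) atTop
      (𝓝 (∫ w, Z (Y w) w ∂P)) := by
    refine tendsto_integral_of_dominated_convergence (fun _ => 1) (fun n => ?_)
      (integrable_const 1) (fun n => Eventually.of_forall fun w => hb _ w)
      (Eventually.of_forall fun w => (hr w (Y w)).tendsto.comp (tendsto_gridAbove _))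
    exact ((measurable_eval_gridAbove hZ n).comp (hY.prodMk measurable_id)).aestronglyMeasurable
  have h2 : Tendsto (fun n => ∫ w, (∫ w', Z (gridAbove n (Y w)) w' ∂P) ∂P) atTop
      (𝓝 (∫ w, (∫ w', Z (Y w) w' ∂P) ∂P)) := by
    refine tendsto_integral_of_dominated_convergence (fun _ => 1) hgm
      (integrable_const 1) (fun n => Eventually.of_forall fun w => hgb _)
      (Eventually.of_forall fun w => ?_)
    refine tendsto_integral_of_dominated_convergence (fun _ => 1)
      (fun n => (hZ _).aestronglyMeasurable)
      (integrable_const 1) (fun n => Eventually.of_forall fun w' => hb _ w')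
      (Eventually.of_forall fun w' => (hr w' (Y w)).tendsto.comp (tendsto_gridAbove _))
  exact tendsto_nhds_unique h1 (by simpa only [hstep] using h2)

/-- A process of random variables with nondecreasing right-continuous paths. -/
structure IsIncreasingProcess {E : Type*} [Preorder E] [TopologicalSpace E] [MeasurableSpace E]
    (X : ℝ≥0 → Ω → E) : Prop where
  measurable : ∀ t, Measurable (X t)
  mono : ∀ w, Monotone fun t => X t w
  right_cont : ∀ w t, ContinuousWithinAt (fun s => X s w) (Ici t) t

namespace IsIncreasingProcess

theorem of_isSubordinator {X : ℝ≥0 → Ω → ℝ≥0} {Φ : ℝ → ℝ} {P : Measure Ω}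
    (h : IsSubordinator X Φ P) : IsIncreasingProcess X :=
  ⟨h.measurable, h.mono, h.right_cont⟩

theorem comp {E : Type*} [Preorder E] [TopologicalSpace E]
    [TopologicalSpace.PseudoMetrizableSpace E] [MeasurableSpace E] [BorelSpace E]
    {X : ℝ≥0 → Ω → E} {Y : ℝ≥0 → Ω → ℝ≥0}
    (hX : IsIncreasingProcess X) (hY : IsIncreasingProcess Y) :
    IsIncreasingProcess fun t w => X (Y t w) w where
  measurable t := (measurable_uncurry_of_right_cont hX.measurable hX.right_cont).comp
    ((hY.measurable t).prodMk measurable_id)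
  mono w := (hX.mono w).comp (hY.mono w)
  right_cont w t := ContinuousWithinAt.comp (g := fun s => X s w) (f := fun s => Y s w)
    (hX.right_cont w (Y t w)) (hY.right_cont w t) fun _ hs => hY.mono w hs

theorem const_mul {Y : ℝ≥0 → Ω → ℝ≥0} (c : ℝ≥0) (hY : IsIncreasingProcess Y) :
    IsIncreasingProcess fun t w => c * Y t w where
  measurable t := (hY.measurable t).const_mul c
  mono w _ _ h := mul_le_mul_right (hY.mono w h) c
  right_cont w t := (hY.right_cont w t).const_mul c

theorem sum {ι : Type*} (s : Finset ι) {X : ι → ℝ≥0 → Ω → ℝ≥0}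
    (h : ∀ i, IsIncreasingProcess (X i)) :
    IsIncreasingProcess fun t w => ∑ i ∈ s, X i t w where
  measurable t := Finset.measurable_fun_sum s fun i _ => (h i).measurable t
  mono w _ _ hst := Finset.sum_le_sum fun i _ => (h i).mono w hst
  right_cont w t := by
    simp only [ContinuousWithinAt]
    exact tendsto_finsetSum s fun i _ => (h i).right_cont w t

end IsIncreasingProcess

/-- The Laplace transform of a weighted sum of subordinators run with an independent
subordinator as clock. -/
theorem integral_exp_sum_subordinated {ι : Type*} [Fintype ι] {P : Measure Ω}
    [IsProbabilityMeasure P] {A : ι → ℝ≥0 → Ω → ℝ≥0} {T : ℝ≥0 → Ω → ℝ≥0} {Φ : ι → ℝ → ℝ}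
    {Ψ : ℝ → ℝ} (hA : ∀ i, IsSubordinator (A i) (Φ i) P) (hT : IsSubordinator T Ψ P)
    (hi : iIndepFun (fun (o : Option ι) w t => (o.elim T A) t w) P) (c : ι → ℝ≥0) (t : ℝ≥0)
    {μ : ℝ} (hμ : 0 ≤ μ) (hΦ : 0 ≤ ∑ i, (c i : ℝ) * Φ i μ) :
    ∫ w, Real.exp (-(μ * ((∑ i, A i (c i * T t w) w : ℝ≥0) : ℝ))) ∂P =
      Real.exp (-(t * Ψ (∑ i, (c i : ℝ) * Φ i μ))) := by
  classical
  have hf : ∀ o : Option ι, Measurable fun w t => (o.elim T A) t w := by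
    rintro (_ | i)
    · exact measurable_pi_lambda _ hT.measurable
    · exact measurable_pi_lambda _ (hA i).measurable
  set Z : ℝ≥0 → Ω → ℝ := fun s w =>
    Real.exp (-(μ * ((∑ i, A i (c i * s) w : ℝ≥0) : ℝ))) with hZ
  have hZinc : IsIncreasingProcess fun s w => ∑ i, A i (c i * s) w :=
    IsIncreasingProcess.sum _ fun i => by
      have hid : IsIncreasingProcess fun (s : ℝ≥0) (_ : Ω) => s :=
        ⟨fun _ => measurable_const, fun _ => monotone_id, fun _ _ => continuousWithinAt_id⟩
      exact (IsIncreasingProcess.of_isSubordinator (hA i)).comp (hid.const_mul (c i))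
  have hexp : Continuous fun y : ℝ≥0 => Real.exp (-(μ * (y : ℝ))) := by fun_prop
  have hind : IndepFun (fun w s => Z s w) (T t) P := by
    set R : Finset (Option ι) := Finset.univ.image some with hR
    have hmem : ∀ i, some i ∈ R := fun i => by simp [hR]
    have hmem' : (none : Option ι) ∈ ({none} : Finset (Option ι)) := by simp
    have h := hi.indepFun_finset R {none} (by simp [hR]) hf
    have hφ : Measurable fun (x : R → ℝ≥0 → ℝ≥0) (s : ℝ≥0) =>
        Real.exp (-(μ * ((∑ i, x ⟨some i, hmem i⟩ (c i * s) : ℝ≥0) : ℝ))) := by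
      refine measurable_pi_lambda _ fun s => ?_
      have hs : Measurable fun x : R → ℝ≥0 → ℝ≥0 => ∑ i, x ⟨some i, hmem i⟩ (c i * s) :=
        Finset.measurable_fun_sum _ fun i _ =>
          (measurable_pi_apply (c i * s)).comp (measurable_pi_apply (⟨some i, hmem i⟩ : R))
      exact hexp.measurable.comp hs
    have hψ : Measurable fun x : ({none} : Finset (Option ι)) → ℝ≥0 → ℝ≥0 => x ⟨none, hmem'⟩ t :=
      (measurable_pi_apply t).comp (measurable_pi_apply (⟨none, hmem'⟩ : ({none} : Finset _)))
    have h3 := h.comp hφ hψ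
    exact h3
  have hfix : ∀ s, ∫ w, Z s w ∂P = Real.exp (-((∑ i, (c i : ℝ) * Φ i μ) * (s : ℝ))) := by
    intro s
    have hiA := hi.precomp (Option.some_injective ι)
    have h := hiA.integral_fun_prod_comp (f := fun i (x : ℝ≥0 → ℝ≥0) =>
      Real.exp (-(μ * (x (c i * s) : ℝ)))) (fun i => (hf (some i)).aemeasurable)
      (fun i =>
      (hexp.measurable.comp (measurable_pi_apply (X := fun _ => ℝ≥0) (c i * s))).aestronglyMeasurable)
    calc ∫ w, Z s w ∂P = ∫ w, ∏ i, Real.exp (-(μ * (A i (c i * s) w : ℝ))) ∂P := by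
          congr 1 with w
          rw [hZ, ← Real.exp_sum]
          simp [Finset.mul_sum]
      _ = ∏ i, ∫ w, Real.exp (-(μ * (A i (c i * s) w : ℝ))) ∂P := h
      _ = ∏ i, Real.exp (-((c i * s : ℝ≥0) * Φ i μ)) := by
          refine Finset.prod_congr rfl fun i _ => (hA i).laplace _ μ hμ
      _ = _ := by
          rw [← Real.exp_sum]
          simp only [Finset.sum_neg_distrib, Finset.sum_mul]
          congr 2
          refine Finset.sum_congr rfl fun i _ => ?_
          push_cast; ring
  have hfreeze := integral_randomTime (P := P) (Z := Z) (Y := T t)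
    (fun s => hexp.measurable.comp (hZinc.measurable s))
    (fun s w => by
      rw [abs_of_pos (Real.exp_pos _), Real.exp_le_one_iff]
      have : (0 : ℝ) ≤ ((∑ i, A i (c i * s) w : ℝ≥0) : ℝ) := NNReal.coe_nonneg _
      nlinarith)
    (fun w s => hexp.continuousAt.comp_continuousWithinAt (hZinc.right_cont w s))
    (hT.measurable t) hind
  rw [← hT.laplace t _ hΦ]
  simpa only [hfix] using hfreeze

end RandomTime

/-! ### Counting processes -/

section Counting

variable {Ω : Type*} [MeasurableSpace Ω] {P : Measure Ω}

/-- The generating function of the Poisson process. -/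
theorem IsPoissonProcess.integral_pow {N : ℝ≥0 → Ω → ℕ} {lam : ℝ≥0}
    (hN : IsPoissonProcess N lam P) {u : ℝ} (hu : |u| ≤ 1) (s : ℝ≥0) :
    ∫ w, u ^ N s w ∂P = Real.exp (-(lam * (1 - u) * s)) := by
  have hlaw : P.map (N s) = poissonMeasure (lam * s) := by
    have := hN.law 0 s
    simpa [hN.zero] using this
  have h1 : ∫ w, u ^ N s w ∂P = ∫ n, u ^ n ∂(poissonMeasure (lam * s)) := by
    rw [← hlaw, integral_map (hN.measurable s).aemeasurable
      (measurable_of_countable _).aestronglyMeasurable]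
  have hint : Integrable (fun n : ℕ => u ^ n) (poissonMeasure (lam * s)) := by
    refine Integrable.of_bound (measurable_of_countable _).aestronglyMeasurable 1
      (Eventually.of_forall fun n => ?_)
    rw [norm_pow]
    exact pow_le_one₀ (norm_nonneg _) hu
  rw [h1, integral_poissonMeasure' hint]
  have h2 := (NormedSpace.expSeries_div_hasSum_exp (((lam * s : ℝ≥0) : ℝ) * u)).mul_left (Real.exp (-(lam * s : ℝ≥0)))
  rw [← Real.exp_eq_exp_ℝ, ← Real.exp_add] at h2
  rw [show -((lam : ℝ) * (1 - u) * s) = -((lam * s : ℝ≥0) : ℝ) + ((lam * s : ℝ≥0) : ℝ) * u by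
    push_cast; ring, ← h2.tsum_eq]
  refine tsum_congr fun n => ?_
  simp only [smul_eq_mul, mul_pow]
  ring

variable [IsProbabilityMeasure P]

/-- The probability generating function as a power series. -/
theorem hasSum_pow_mul_measureReal {X : Ω → ℕ} (hX : Measurable X) {u : ℝ} (hu : |u| ≤ 1) :
    HasSum (fun k : ℕ => u ^ k * P.real {w | X w = k}) (∫ w, u ^ X w ∂P) := by
  have hU : ⋃ k : ℕ, {w | X w = k} = univ := by
    ext w; simp
  have hm : ∀ k : ℕ, MeasurableSet {w | X w = k} := fun k => hX (measurableSet_singleton k)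
  have hint : Integrable (fun w => u ^ X w) P := by
    refine Integrable.of_bound ((measurable_of_countable fun k : ℕ => u ^ k).comp
      hX).aestronglyMeasurable 1 (Eventually.of_forall fun w => ?_)
    rw [norm_pow]
    exact pow_le_one₀ (norm_nonneg _) hu
  have h := hasSum_integral_iUnion (μ := P) (f := fun w => u ^ X w) hm
    (fun i j hij => Set.disjoint_left.2 fun w hi hj => hij (hi.symm.trans hj))
    (by rw [hU]; exact hint.integrableOn)
  rw [hU, setIntegral_univ] at h
  refine h.congr_fun fun k => ?_
  rw [setIntegral_congr_fun (g := fun _ => u ^ k) (hm k) fun w (hw : X w = k) => by simp only [hw]]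
  simp [mul_comm]

/-- Freezing for a function of an integer-valued increasing process. -/
theorem integral_comp_counting_randomTime {M : ℝ≥0 → Ω → ℕ} (hM : IsIncreasingProcess M)
    {Y : Ω → ℝ≥0} (hY : Measurable Y) (hi : IndepFun (fun w t => M t w) Y P) {F : ℕ → ℝ}
    (hF : ∀ n, |F n| ≤ 1) :
    ∫ w, F (M (Y w) w) ∂P = ∫ w, (∫ w', F (M (Y w) w') ∂P) ∂P := by
  have hFm : Measurable F := measurable_of_countable F
  have hZ : ∀ s, Measurable fun w => F (M s w) := fun s => hFm.comp (hM.measurable s)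
  refine integral_randomTime (Z := fun s w => F (M s w)) hZ
    (fun s w => hF _) (fun w s => ?_) hY ?_
  · exact (continuous_of_discreteTopology (f := F)).continuousAt.comp_continuousWithinAt
      (hM.right_cont w s)
  · have hφ : Measurable fun (x : ℝ≥0 → ℕ) (s : ℝ≥0) => F (x s) :=
      measurable_pi_lambda _ fun s => hFm.comp (measurable_pi_apply (X := fun _ => ℕ) s)
    exact hi.comp hφ measurable_id

end Counting

/-! ### Hitting times of increasing processes -/

section HittingTime

variable {Ω : Type*} {W : ℝ≥0 → Ω → ℝ≥0}

theorem hittingTimeProcess_le {t s : ℝ≥0} {w : Ω} (h : t < W s w) :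
    hittingTimeProcess W t w ≤ s :=
  csInf_le (OrderBot.bddBelow _) h

theorem le_of_lt_hittingTimeProcess {t s : ℝ≥0} {w : Ω} (h : s < hittingTimeProcess W t w) :
    W s w ≤ t :=
  not_lt.1 fun h' => absurd (hittingTimeProcess_le h') (not_le.2 h)

theorem le_hittingTimeProcess (hm : ∀ w, Monotone fun t => W t w) {t s : ℝ≥0} {w : Ω}
    (hne : ∃ r, t < W r w) (h : W s w ≤ t) : s ≤ hittingTimeProcess W t w := by
  refine le_csInf hne fun r hr => ?_
  by_contra hlt
  exact absurd ((hm w (not_le.1 hlt).le).trans h) (not_le.2 hr)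

theorem hittingTimeProcess_mono {t t' : ℝ≥0} {w : Ω} (hne : ∃ r, t' < W r w) (h : t ≤ t') :
    hittingTimeProcess W t w ≤ hittingTimeProcess W t' w :=
  csInf_le_csInf (OrderBot.bddBelow _) hne fun _ hr => lt_of_le_of_lt h hr

variable [MeasurableSpace Ω]

theorem measurable_hittingTimeProcess (hW : IsIncreasingProcess W) (t : ℝ≥0) :
    Measurable (hittingTimeProcess W t) := by
  refine measurable_of_Iio fun a => ?_
  have hset : ∀ s, MeasurableSet {w | t < W s w} := fun s =>
    measurableSet_lt measurable_const (hW.measurable s)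
  -- The second part of the union accounts for `sInf ∅ = 0` where the path stays below `t`.
  have e : hittingTimeProcess W t ⁻¹' Iio a =
      (⋃ q ∈ {q : ℚ | (Real.toNNReal q) < a}, {w | t < W (Real.toNNReal q) w}) ∪
        (if 0 < a then (⋃ n : ℕ, {w | t < W n w})ᶜ else ∅) := by
    ext w
    simp only [mem_preimage, mem_Iio, mem_union, mem_iUnion, mem_ofPred_eq, exists_prop]
    constructor
    · intro h
      by_cases hne : ∃ r, t < W r w
      · left
        obtain ⟨s, hs, hsa⟩ := (csInf_lt_iff (OrderBot.bddBelow _) hne).1 h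
        obtain ⟨q, hq1, hq2⟩ := exists_rat_btwn (NNReal.coe_lt_coe.2 hsa)
        have hq0 : (0 : ℝ) ≤ q := s.coe_nonneg.trans hq1.le
        refine ⟨q, (Real.toNNReal_lt_iff_lt_coe hq0).2 hq2, lt_of_lt_of_le hs (hW.mono w ?_)⟩
        exact (Real.le_toNNReal_iff_coe_le hq0).2 hq1.le
      · right
        rw [if_pos (lt_of_le_of_lt zero_le h)]
        simp only [mem_compl_iff, mem_iUnion, mem_ofPred_eq, not_exists]
        exact fun n hn => hne ⟨n, hn⟩
    · rintro (⟨q, hq, hw⟩ | h)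
      · exact lt_of_le_of_lt (hittingTimeProcess_le hw) hq
      · split_ifs at h with ha
        · have hempty : {s | t < W s w} = ∅ := by
            refine eq_empty_of_forall_notMem fun s hs => ?_
            simp only [mem_compl_iff, mem_iUnion, mem_ofPred_eq, not_exists] at h
            obtain ⟨n, hn⟩ := exists_nat_ge s
            exact h n (lt_of_lt_of_le hs (hW.mono w hn))
          rw [hittingTimeProcess, hempty, NNReal.sInf_empty]
          exact ha
        · exact absurd h (notMem_empty _)
  rw [e]
  refine MeasurableSet.union (MeasurableSet.biUnion (to_countable _) fun q _ => hset _) ?_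
  split_ifs
  · exact (MeasurableSet.iUnion fun n => hset _).compl
  · exact MeasurableSet.empty

variable {P : Measure Ω} [IsProbabilityMeasure P] {Ψ : ℝ → ℝ}

/-- Paths are almost surely unbounded, since `𝔼 exp (-W_n) = exp (-n Ψ(1))` tends to `0`. -/
theorem ae_exists_lt_of_laplace (hW : IsIncreasingProcess W)
    (hL : ∀ (s : ℝ≥0) (μ : ℝ), 0 < μ →
      ∫ w, Real.exp (-(μ * (W s w : ℝ))) ∂P = Real.exp (-(s * Ψ μ)))
    (hΨ : 0 < Ψ 1) : ∀ᵐ w ∂P, ∀ t, ∃ s, t < W s w := by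
  have hmeas : ∀ n : ℕ, Measurable fun w => ENNReal.ofReal (Real.exp (-(1 * (W n w : ℝ)))) :=
    fun n => ((by fun_prop : Continuous fun y : ℝ≥0 =>
      Real.exp (-(1 * (y : ℝ)))).measurable.comp (hW.measurable n)).ennreal_ofReal
  have h1 : ∀ n : ℕ, ∫⁻ w, ENNReal.ofReal (Real.exp (-(1 * (W n w : ℝ)))) ∂P =
      ENNReal.ofReal (Real.exp (-((n : ℝ) * Ψ 1))) := by
    intro n
    rw [← ofReal_integral_eq_lintegral_ofReal, hL n 1 one_pos]
    · simp
    · refine Integrable.of_bound ?_ 1 (Eventually.of_forall fun w => ?_)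
      · exact ((by fun_prop : Continuous fun y : ℝ≥0 =>
          Real.exp (-(1 * (y : ℝ)))).measurable.comp (hW.measurable n)).aestronglyMeasurable
      · rw [Real.norm_of_nonneg (Real.exp_nonneg _), Real.exp_le_one_iff]
        simp
    · exact Eventually.of_forall fun w => Real.exp_nonneg _
  have h2 : ∫⁻ w, ⨅ n : ℕ, ENNReal.ofReal (Real.exp (-(1 * (W n w : ℝ)))) ∂P = 0 := by
    refine le_antisymm (ge_of_tendsto' (f := fun n : ℕ =>
      ENNReal.ofReal (Real.exp (-((n : ℝ) * Ψ 1)))) (x := atTop) ?_ fun n => ?_) zero_le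
    · rw [← ENNReal.ofReal_zero]
      refine ENNReal.tendsto_ofReal (Real.tendsto_exp_neg_atTop_nhds_zero.comp ?_)
      exact tendsto_natCast_atTop_atTop.atTop_mul_const hΨ
    · rw [← h1 n]
      exact lintegral_mono fun w => iInf_le _ n
  rw [lintegral_eq_zero_iff (Measurable.iInf hmeas)] at h2
  filter_upwards [h2] with w hw t
  by_contra hno
  push Not at hno
  have : ENNReal.ofReal (Real.exp (-(1 * (t : ℝ)))) ≤
      ⨅ n : ℕ, ENNReal.ofReal (Real.exp (-(1 * (W n w : ℝ)))) := by
    refine le_iInf fun n => ENNReal.ofReal_le_ofReal (Real.exp_le_exp.2 ?_)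
    have : (W n w : ℝ) ≤ t := NNReal.coe_le_coe.2 (hno n)
    linarith
  rw [hw] at this
  simp at this
  exact absurd this (not_le.2 (Real.exp_pos _))

/-- Up to null sets, `s < U_t` means `W_s ≤ t`; integrating over time against an exponential
expresses functionals of the hitting time through the Laplace transform of `W`. -/
theorem lintegral_hittingTimeProcess (hW : IsIncreasingProcess W)
    (hL : ∀ (s : ℝ≥0) (μ : ℝ), 0 < μ →
      ∫ w, Real.exp (-(μ * (W s w : ℝ))) ∂P = Real.exp (-(s * Ψ μ)))
    (hΨ : 0 < Ψ 1) {g : ℝ → ENNReal} (hg : Measurable g) {μ : ℝ} (hμ : 0 < μ) :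
    ∫⁻ t in Ioi (0 : ℝ), ENNReal.ofReal (Real.exp (-(μ * t))) *
        ∫⁻ w, (∫⁻ s in Ioo (0 : ℝ) (hittingTimeProcess W t.toNNReal w : ℝ), g s) ∂P =
      ∫⁻ s in Ioi (0 : ℝ), g s * ENNReal.ofReal (Real.exp (-(Ψ μ * s)) / μ) := by
  set V : ℝ → Ω → ℝ := fun s w => (W s.toNNReal w : ℝ) with hV
  have hVm : Measurable fun q : ℝ × Ω => V q.1 q.2 :=
    ((measurable_uncurry_of_right_cont hW.measurable hW.right_cont).comp
      ((measurable_real_toNNReal.comp measurable_fst).prodMk measurable_snd)).coe_nnreal_real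
  set E : ℝ → ENNReal := fun t => ENNReal.ofReal (Real.exp (-(μ * t))) with hE
  have hEm : Measurable E := by fun_prop
  -- `s < U_t` and `W_s ≤ t` differ at most for `s = U_t`; then use Tonelli's theorem.
  set k : ℝ → Ω → ℝ → ENNReal := fun t w s => if V s w ≤ t then E t * g s else 0 with hk
  have hkm : Measurable fun q : ℝ × Ω × ℝ => k q.1 q.2.1 q.2.2 := by
    refine Measurable.ite (measurableSet_le ?_ measurable_fst) ?_ measurable_const
    · exact hVm.comp ((measurable_snd.comp measurable_snd).prodMk
        (measurable_fst.comp measurable_snd))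
    · exact (hEm.comp measurable_fst).mul (hg.comp (measurable_snd.comp measurable_snd))
  have hleft : ∀ t ∈ Ioi (0 : ℝ), E t *
      ∫⁻ w, (∫⁻ s in Ioo (0 : ℝ) (hittingTimeProcess W t.toNNReal w : ℝ), g s) ∂P =
      ∫⁻ w, (∫⁻ s in Ioi (0 : ℝ), k t w s) ∂P := by
    intro t ht
    rw [← lintegral_const_mul' _ _ ENNReal.ofReal_ne_top]
    refine lintegral_congr_ae ?_
    filter_upwards [ae_exists_lt_of_laplace hW hL hΨ] with w hw
    set τ := hittingTimeProcess W t.toNNReal w with hτ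
    rw [← lintegral_const_mul' _ _ ENNReal.ofReal_ne_top]
    have hne : ∀ᵐ s : ℝ, s ≠ (τ : ℝ) := by simp [ae_iff]
    rw [← lintegral_indicator measurableSet_Ioo, ← lintegral_indicator measurableSet_Ioi]
    refine lintegral_congr_ae ?_
    filter_upwards [hne] with s hs
    by_cases hs0 : 0 < s
    · have hs0' : s ∈ Ioi (0 : ℝ) := hs0
      have hts : (t.toNNReal : ℝ) = t := Real.coe_toNNReal _ (le_of_lt ht)
      have hss : (s.toNNReal : ℝ) = s := Real.coe_toNNReal _ hs0.le
      rw [indicator_of_mem hs0']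
      rcases lt_or_gt_of_ne hs with h | h
      · rw [indicator_of_mem (show s ∈ Ioo (0 : ℝ) τ from ⟨hs0, h⟩)]
        have : W s.toNNReal w ≤ t.toNNReal :=
          le_of_lt_hittingTimeProcess (by rw [← NNReal.coe_lt_coe, hss]; exact h)
        have hVt : V s w ≤ t := by rw [hV, ← hts]; exact NNReal.coe_le_coe.2 this
        simp only [hk, if_pos hVt, hE]
      · rw [indicator_of_notMem (fun h' : s ∈ Ioo (0 : ℝ) τ => absurd h'.2 (not_lt.2 h.le))]
        have hVt : ¬ V s w ≤ t := by
          intro h'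
          have h2 : W s.toNNReal w ≤ t.toNNReal := by
            rw [← NNReal.coe_le_coe, hts]; exact h'
          have := le_hittingTimeProcess hW.mono (hw _) h2
          rw [← NNReal.coe_le_coe, hss] at this
          exact absurd this (not_le.2 h)
        simp only [hk, if_neg hVt]
    · rw [indicator_of_notMem (fun h' : s ∈ Ioo (0 : ℝ) τ => hs0 h'.1),
        indicator_of_notMem (fun h' : s ∈ Ioi (0 : ℝ) => hs0 h')]
  rw [setLIntegral_congr_fun measurableSet_Ioi hleft]
  have hswap : ∫⁻ t in Ioi (0 : ℝ), ∫⁻ w, (∫⁻ s in Ioi (0 : ℝ), k t w s) ∂P =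
      ∫⁻ s in Ioi (0 : ℝ), ∫⁻ w, (∫⁻ t in Ioi (0 : ℝ), k t w s) ∂P := by
    have a1 : ∀ t, ∫⁻ w, (∫⁻ s in Ioi (0 : ℝ), k t w s) ∂P =
        ∫⁻ s in Ioi (0 : ℝ), ∫⁻ w, k t w s ∂P := fun t =>
      lintegral_lintegral_swap (hkm.comp (measurable_const.prodMk measurable_id)).aemeasurable
    simp only [a1]
    rw [lintegral_lintegral_swap]
    · refine lintegral_congr fun s => ?_
      exact lintegral_lintegral_swap (hkm.comp (measurable_fst.prodMk
        (measurable_snd.prodMk measurable_const))).aemeasurable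
    · refine Measurable.aemeasurable ?_
      exact Measurable.lintegral_prod_right' (f := fun q : (ℝ × ℝ) × Ω => k q.1.1 q.2 q.1.2)
        (hkm.comp ((measurable_fst.comp measurable_fst).prodMk
          (measurable_snd.prodMk (measurable_snd.comp measurable_fst))))
  rw [hswap]
  refine setLIntegral_congr_fun measurableSet_Ioi fun s hs => ?_
  have hinner : ∀ w, ∫⁻ t in Ioi (0 : ℝ), k t w s =
      g s * ENNReal.ofReal (Real.exp (-(μ * V s w)) / μ) := by
    intro w
    have hV0 : 0 ≤ V s w := NNReal.coe_nonneg _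
    have e1 : ∀ t, k t w s = g s * (Ici (V s w)).indicator E t := by
      intro t
      by_cases h : V s w ≤ t
      · rw [indicator_of_mem (show t ∈ Ici (V s w) from h)]
        simp only [hk, if_pos h, mul_comm]
      · rw [indicator_of_notMem (show t ∉ Ici (V s w) from h)]
        simp only [hk, if_neg h, mul_zero]
    simp only [e1]
    rw [lintegral_const_mul _ (hEm.indicator measurableSet_Ici),
      lintegral_indicator measurableSet_Ici, Measure.restrict_restrict measurableSet_Ici]
    congr 1
    have hae : (Ici (V s w) ∩ Ioi 0 : Set ℝ) =ᵐ[volume] Ioi (V s w) := by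
      rcases hV0.eq_or_lt with h | h
      · have : (Ici (V s w) ∩ Ioi 0 : Set ℝ) = Ioi (V s w) := by
          rw [← h]; exact inter_eq_self_of_subset_right Ioi_subset_Ici_self
        rw [this]; exact ae_eq_rfl
      · have : (Ici (V s w) ∩ Ioi 0 : Set ℝ) = Ici (V s w) :=
          inter_eq_self_of_subset_left fun x hx => lt_of_lt_of_le h hx
        rw [this]
        exact Ioi_ae_eq_Ici.symm
    rw [setLIntegral_congr hae, hE, ← ofReal_integral_eq_lintegral_ofReal]
    · congr 1
      have := integral_exp_mul_Ioi (neg_neg_of_pos hμ) (V s w)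
      simpa only [neg_mul, neg_div_neg_eq] using this
    · simpa only [neg_mul] using! integrableOn_exp_mul_Ioi (neg_neg_of_pos hμ) (V s w)
    · exact Eventually.of_forall fun t => Real.exp_nonneg _
  simp only [hinner]
  have hs0 : ((s.toNNReal : ℝ≥0) : ℝ) = s := Real.coe_toNNReal _ (le_of_lt hs)
  have hexpm : Measurable fun w => Real.exp (-(μ * V s w)) / μ :=
    ((((hVm.comp measurable_prodMk_left).const_mul μ).neg).exp).div_const μ
  rw [lintegral_const_mul _ hexpm.ennreal_ofReal,
    ← ofReal_integral_eq_lintegral_ofReal, integral_div, hL _ μ hμ, hs0, mul_comm s]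
  · refine Integrable.of_bound hexpm.aestronglyMeasurable (1 / μ)
      (Eventually.of_forall fun w => ?_)
    rw [Real.norm_of_nonneg (by positivity)]
    have : (0 : ℝ) ≤ V s w := NNReal.coe_nonneg _
    gcongr
    rw [Real.exp_le_one_iff]
    nlinarith
  · exact Eventually.of_forall fun w => by positivity

/-- Functionals `G(U_t)` of the hitting time, `G` being a primitive of `g`: they are integrable
with nondecreasing mean, and the transform of the mean is that of `g` at `Ψ μ`, divided by `μ`. -/
theorem hasLaplaceAt_integral_comp_hittingTime (hW : IsIncreasingProcess W)
    (hL : ∀ (s : ℝ≥0) (μ : ℝ), 0 < μ →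
      ∫ w, Real.exp (-(μ * (W s w : ℝ))) ∂P = Real.exp (-(s * Ψ μ)))
    (hΨ : 0 < Ψ 1) {g G : ℝ → ℝ} (hg : Measurable g) (hg0 : ∀ s, 0 < s → 0 ≤ g s)
    (hG : ∀ u, 0 ≤ u → ∫⁻ s in Ioo 0 u, ENNReal.ofReal (g s) = ENNReal.ofReal (G u))
    (hGm : Measurable G) (hG0 : ∀ u, 0 ≤ u → 0 ≤ G u) {μ F : ℝ} (hμ : 0 < μ)
    (hF : HasLaplaceAt g (Ψ μ) F) :
    (∀ t, Integrable (fun w => G (hittingTimeProcess W t w)) P) ∧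
      (Monotone fun t => ∫ w, G (hittingTimeProcess W t w) ∂P) ∧
      HasLaplaceAt (fun t => ∫ w, G (hittingTimeProcess W t.toNNReal w) ∂P) μ (F / μ) := by
  set U := hittingTimeProcess W with hU
  have hGU : ∀ t, Measurable fun w => G (U t w) := fun t =>
    hGm.comp (measurable_hittingTimeProcess hW t).coe_nnreal_real
  have hGmono : ∀ u v, 0 ≤ u → u ≤ v → G u ≤ G v := by
    intro u v hu huv
    rw [← ENNReal.ofReal_le_ofReal_iff (hG0 v (hu.trans huv)), ← hG u hu, ← hG v (hu.trans huv)]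
    exact lintegral_mono_set (Ioo_subset_Ioo_right huv)
  set E : ℝ≥0 → ENNReal := fun t => ∫⁻ w, ENNReal.ofReal (G (U t w)) ∂P with hE
  have hEmono : Monotone E := by
    intro t t' htt
    refine lintegral_mono_ae ?_
    filter_upwards [ae_exists_lt_of_laplace hW hL hΨ] with w hw
    exact ENNReal.ofReal_le_ofReal (hGmono _ _ (NNReal.coe_nonneg _)
      (NNReal.coe_le_coe.2 (hittingTimeProcess_mono (hw t') htt)))
  have hErm : Measurable fun t : ℝ => ENNReal.ofReal (Real.exp (-(μ * t))) * E t.toNNReal := by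
    have : Monotone fun t : ℝ => E t.toNNReal := hEmono.comp fun _ _ h => Real.toNNReal_le_toNNReal h
    exact (by fun_prop : Measurable fun t : ℝ => ENNReal.ofReal (Real.exp (-(μ * t)))).mul
      this.measurable
  have hkey : ∫⁻ t in Ioi (0 : ℝ), ENNReal.ofReal (Real.exp (-(μ * t))) * E t.toNNReal =
      ENNReal.ofReal (F / μ) := by
    have h := lintegral_hittingTimeProcess hW hL hΨ (g := fun s => ENNReal.ofReal (g s))
      hg.ennreal_ofReal hμ
    simp only [hG _ (NNReal.coe_nonneg _)] at h
    rw [hE, h, ← hF.2, ← integral_div, ofReal_integral_eq_lintegral_ofReal (hF.1.div_const μ)]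
    · refine setLIntegral_congr_fun measurableSet_Ioi fun s hs => ?_
      rw [← ENNReal.ofReal_mul (hg0 s hs)]
      congr 1
      ring
    · filter_upwards [ae_restrict_mem measurableSet_Ioi] with s hs
      have := hg0 s hs
      simp only [Pi.zero_apply]
      positivity
  -- The mean is finite at almost all times by `hkey`, hence at all times by monotonicity.
  have hfin : ∀ t, E t < ⊤ := by
    intro t
    have hae := ae_lt_top hErm (hkey.trans_ne ENNReal.ofReal_ne_top)
    rw [ae_restrict_iff' measurableSet_Ioi] at hae
    obtain ⟨r, hr, hr1⟩ := (Measure.dense_of_ae hae).exists_between (lt_add_one (t : ℝ))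
    have hr0 : 0 < r := lt_of_le_of_lt t.coe_nonneg hr1.1
    have h1 := hr hr0
    have hexp : ENNReal.ofReal (Real.exp (-(μ * r))) ≠ 0 := by
      simpa using Real.exp_pos (-(μ * r))
    have h2 : E r.toNNReal < ⊤ := lt_top_iff_ne_top.2 fun h => by
      rw [h, ENNReal.mul_top hexp] at h1
      exact lt_irrefl _ h1
    exact lt_of_le_of_lt (hEmono (NNReal.le_toNNReal_of_coe_le hr1.1.le)) h2
  have hreal : ∀ t, ∫ w, G (U t w) ∂P = (E t).toReal := fun t =>
    integral_eq_lintegral_of_nonneg_ae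
      (Eventually.of_forall fun w => hG0 _ (NNReal.coe_nonneg _)) (hGU t).aestronglyMeasurable
  have hofReal : ∀ t : ℝ, ENNReal.ofReal (Real.exp (-(μ * t)) * (E t.toNNReal).toReal) =
      ENNReal.ofReal (Real.exp (-(μ * t))) * E t.toNNReal := fun t => by
    rw [ENNReal.ofReal_mul (Real.exp_nonneg _), ENNReal.ofReal_toReal (hfin _).ne]
  have hF0 : 0 ≤ F / μ := by
    refine div_nonneg ?_ hμ.le
    rw [← hF.2]
    exact setIntegral_nonneg measurableSet_Ioi fun s hs => mul_nonneg (Real.exp_nonneg _) (hg0 s hs)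
  have hrm : Measurable fun t : ℝ => Real.exp (-(μ * t)) * (E t.toNNReal).toReal := by
    have := hErm.ennreal_toReal
    simpa only [ENNReal.toReal_mul, ENNReal.toReal_ofReal (Real.exp_nonneg _)] using this
  refine ⟨fun t => ⟨(hGU t).aestronglyMeasurable, ?_⟩, fun t t' h => ?_, ?_, ?_⟩
  · rw [hasFiniteIntegral_iff_ofReal
      (Eventually.of_forall fun w => hG0 _ (NNReal.coe_nonneg _))]
    exact hfin t
  · simp only [hreal]
    exact ENNReal.toReal_mono (hfin t').ne (hEmono h)
  · simp only [hreal]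
    refine ⟨hrm.aestronglyMeasurable, ?_⟩
    rw [hasFiniteIntegral_iff_ofReal (Eventually.of_forall fun t => by positivity)]
    simp only [hofReal, hkey]
    exact ENNReal.ofReal_lt_top
  · simp only [hreal]
    rw [integral_eq_lintegral_of_nonneg_ae (Eventually.of_forall fun t => by positivity)
      hrm.aestronglyMeasurable]
    simp only [hofReal, hkey]
    exact ENNReal.toReal_ofReal hF0

end HittingTime

/-! ### Moments of the hitting time of a stable clock -/

theorem lintegral_Ioo_of_hasDerivAt {g G : ℝ → ℝ} (hd : ∀ s, HasDerivAt G (g s) s)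
    (hc : Continuous g) (hg0 : ∀ s, 0 < s → 0 ≤ g s) (hG0 : G 0 = 0) {u : ℝ} (hu : 0 ≤ u) :
    ∫⁻ s in Ioo 0 u, ENNReal.ofReal (g s) = ENNReal.ofReal (G u) := by
  have hi := hc.intervalIntegrable 0 u (μ := volume)
  rw [← ofReal_integral_eq_lintegral_ofReal, ← integral_Ioc_eq_integral_Ioo,
    ← intervalIntegral.integral_of_le hu,
    intervalIntegral.integral_eq_sub_of_hasDerivAt (fun s _ => hd s) hi, hG0, sub_zero]
  · exact ((intervalIntegrable_iff_integrableOn_Ioc_of_le hu).1 hi).mono_set Ioo_subset_Ioc_self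
  · filter_upwards [ae_restrict_mem measurableSet_Ioo] with s hs
    exact hg0 s hs.1

/-- The Laplace exponent `μ ^ β (1 + om μ ^ (-α)) ^ γ`. -/
def clockExponent (α β γ om μ : ℝ) : ℝ := μ ^ β * (1 + om * μ ^ (-α)) ^ γ

theorem rpow_le_clockExponent {α β γ om μ : ℝ} (hγ : 0 ≤ γ) (hom : 0 ≤ om) (hμ : 0 < μ) :
    μ ^ β ≤ clockExponent α β γ om μ := by
  refine le_mul_of_one_le_right (by positivity) (Real.one_le_rpow ?_ hγ)
  have : 0 ≤ om * μ ^ (-α) := by positivity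
  linarith

theorem clockExponent_pos {α β γ om μ : ℝ} (hom : 0 ≤ om) (hμ : 0 < μ) :
    0 < clockExponent α β γ om μ := by
  unfold clockExponent
  positivity

/-- Beyond some point, both `clockExponent` and `μ ^ α` are as large as desired. -/
theorem exists_lt_clockExponent {α β γ om : ℝ} (hα : 0 < α) (hβ : 0 < β) (hγ : 0 ≤ γ)
    (hom : 0 ≤ om) (C : ℝ) :
    ∃ μ₀, 0 < μ₀ ∧ ∀ μ, μ₀ < μ → om < μ ^ α ∧ C < clockExponent α β γ om μ := by
  have h1 := (tendsto_rpow_atTop hα).eventually_gt_atTop om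
  have h2 := (tendsto_rpow_atTop hβ).eventually_gt_atTop C
  obtain ⟨m, hm⟩ := eventually_atTop.1 (h1.and h2)
  refine ⟨max m 1, by positivity, fun μ hμ => ?_⟩
  have hmu := hm μ ((le_max_left _ _).trans hμ.le)
  have hμ0 : 0 < μ := lt_trans (by positivity) hμ
  exact ⟨hmu.1, hmu.2.trans_le (rpow_le_clockExponent hγ hom hμ0)⟩

/-- The function `t ^ (β n) E^{γ n}_{α, β n + 1}(-om t ^ α)`, which is the mean of `U_t ^ n / n!`
for the hitting time `U_t`. -/
def momentFunction (α β γ om : ℝ) (n : ℕ) (t : ℝ) : ℝ :=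
  (t ^ β) ^ n * mittagLeffler α (β * n + 1) (γ * n) (-(om * t ^ α))

section Moment

variable {α β γ om : ℝ}

theorem continuous_momentFunction (hα : 0 < α) (hβ : 0 < β) (n : ℕ) :
    Continuous (momentFunction α β γ om n) :=
  ((Real.continuous_rpow_const hβ.le).pow n).mul ((continuous_mittagLeffler hα _ _).comp
    ((Real.continuous_rpow_const hα.le).const_mul om).neg)

theorem mittagLeffler_zero (κ x : ℝ) : mittagLeffler κ 1 0 x = 1 := by
  unfold mittagLeffler
  rw [tsum_eq_single 0]
  · simp
  · intro r hr
    rw [ascPochhammer_ne_zero_eval_zero ℝ hr]; simp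

theorem momentFunction_zero (t : ℝ) : momentFunction α β γ om 0 t = 1 := by
  simp [momentFunction, mittagLeffler_zero]

theorem momentFunction_succ_zero (hβ : 0 < β) (n : ℕ) : momentFunction α β γ om (n + 1) 0 = 0 := by
  simp [momentFunction, Real.zero_rpow hβ.ne']

theorem momentFunction_eq_prabhakarKernel (n : ℕ) :
    EqOn (prabhakarKernel α om (γ * n) (β * n + 1)) (momentFunction α β γ om n) (Ioi 0) := by
  intro t ht
  rw [prabhakarKernel, momentFunction, add_sub_cancel_right, Real.rpow_mul (le_of_lt ht),
    Real.rpow_natCast]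

theorem hasLaplaceAt_momentFunction (hα : 0 < α) (hβ : 0 < β) (hom : 0 ≤ om) (n : ℕ) {μ : ℝ}
    (hμ : 0 < μ) (h : om < μ ^ α) :
    HasLaplaceAt (momentFunction α β γ om n) μ (1 / (μ * clockExponent α β γ om μ ^ n)) := by
  have h1 := (hasLaplaceAt_prabhakarKernel hα (γ * n) hom (by positivity : 0 < β * n + 1) hμ h).congr
    (momentFunction_eq_prabhakarKernel n)
  convert h1 using 1
  have hpos : 0 < 1 + om * μ ^ (-α) := by positivity
  rw [clockExponent, mul_pow, ← Real.rpow_natCast, ← Real.rpow_natCast, ← Real.rpow_mul hμ.le,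
    ← Real.rpow_mul hpos.le, neg_add, Real.rpow_add hμ, Real.rpow_neg hμ.le (β * n),
    Real.rpow_neg hpos.le, Real.rpow_neg_one]
  field_simp

variable {Ω : Type*} [MeasurableSpace Ω] {W : ℝ≥0 → Ω → ℝ≥0} {P : Measure Ω}

/-- `W` is an increasing process whose value at time `s` has the Laplace transform
`exp (-s Ψ(μ))`, where `Ψ` is `clockExponent`. -/
structure IsStableClock (α β γ om : ℝ) (W : ℝ≥0 → Ω → ℝ≥0) (P : Measure Ω) : Prop where
  increasing : IsIncreasingProcess W
  laplace : ∀ (s : ℝ≥0) (μ : ℝ), 0 < μ →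
    ∫ w, Real.exp (-(μ * (W s w : ℝ))) ∂P = Real.exp (-(s * clockExponent α β γ om μ))

namespace IsStableClock

theorem measurable_hittingTime (hW : IsStableClock α β γ om W P) (t : ℝ≥0) :
    Measurable (hittingTimeProcess W t) :=
  measurable_hittingTimeProcess hW.increasing t

variable [IsProbabilityMeasure P]

theorem ae_hittingTime_mono (hW : IsStableClock α β γ om W P) (hom : 0 ≤ om) :
    ∀ᵐ w ∂P, Monotone fun t => hittingTimeProcess W t w := by
  filter_upwards [ae_exists_lt_of_laplace hW.increasing hW.laplace (clockExponent_pos hom one_pos)]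
    with w hw t t' h
  exact hittingTimeProcess_mono (hw t') h

/-- The `n`-th moment, divided by `n!`, is `momentFunction n`: both have the transform
`1 / (μ Ψ(μ) ^ n)`, and a monotone function is compared with a continuous one. -/
theorem integral_pow_div_factorial (hW : IsStableClock α β γ om W P) (hα : 0 < α) (hβ : 0 < β)
    (hγ : 0 ≤ γ) (hom : 0 ≤ om) (n : ℕ) (t : ℝ≥0) :
    Integrable (fun w => (hittingTimeProcess W t w : ℝ) ^ n / n.factorial) P ∧
      ∫ w, (hittingTimeProcess W t w : ℝ) ^ n / n.factorial ∂P = momentFunction α β γ om n t := by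
  rcases n with _ | n
  · simp [momentFunction_zero]
  have hΨ : ∀ μ, 0 < μ → 0 < clockExponent α β γ om μ := fun μ => clockExponent_pos hom
  have hd : ∀ s : ℝ, HasDerivAt (fun u : ℝ => u ^ (n + 1) / ((n + 1).factorial : ℝ))
      (s ^ n / (n.factorial : ℝ)) s := by
    intro s
    have h := (hasDerivAt_pow (n + 1) s).div_const ((n + 1).factorial : ℝ)
    refine h.congr_deriv ?_
    rw [Nat.factorial_succ]
    push_cast
    field_simp
  have hgL : ∀ c, 0 < c → HasLaplaceAt (fun s => s ^ n / (n.factorial : ℝ)) c (1 / c ^ (n + 1)) := by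
    intro c hc
    have h := (HasLaplaceAt.rpow (a := (n : ℝ) + 1) (by positivity) hc).const_mul
      (1 / (n.factorial : ℝ))
    rw [Real.Gamma_nat_eq_factorial, Real.rpow_neg hc.le] at h
    have e : 1 / (n.factorial : ℝ) * (n.factorial * (c ^ ((n : ℝ) + 1))⁻¹) = 1 / c ^ (n + 1) := by
      rw [← Real.rpow_natCast c (n + 1)]
      push_cast
      field_simp
    rw [e] at h
    refine h.congr fun s _ => ?_
    simp only [add_sub_cancel_right, Real.rpow_natCast]
    ring
  have main := fun (μ : ℝ) (hμ : 0 < μ) => hasLaplaceAt_integral_comp_hittingTime hW.increasing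
    hW.laplace (hΨ 1 one_pos) (g := fun s => s ^ n / (n.factorial : ℝ))
    (G := fun u => u ^ (n + 1) / ((n + 1).factorial : ℝ)) (by fun_prop)
    (fun s hs => by positivity)
    (fun u hu => lintegral_Ioo_of_hasDerivAt hd (by fun_prop) (fun s hs => by positivity)
      (by simp) hu) (by fun_prop) (fun u hu => by positivity) hμ (hgL _ (hΨ μ hμ))
  obtain ⟨hint, hmono, -⟩ := main 1 one_pos
  refine ⟨hint t, ?_⟩
  obtain ⟨μ₀, hμ₀, hlarge⟩ := exists_lt_clockExponent hα hβ hγ hom (C := 0)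
  have hmono' : Monotone fun t : ℝ => ∫ w, (hittingTimeProcess W t.toNNReal w : ℝ) ^ (n + 1) /
      ((n + 1).factorial : ℝ) ∂P := hmono.comp fun _ _ h => Real.toNNReal_le_toNNReal h
  have heq := eqOn_of_hasLaplaceAt_of_monotoneOn (μ₀ := μ₀)
    (F := fun μ => 1 / (μ * clockExponent α β γ om μ ^ (n + 1)))
    (fun μ hμ => by
      have h := (main μ (hμ₀.trans hμ)).2.2
      convert h using 1
      rw [div_div, mul_comm])
    (fun μ hμ => hasLaplaceAt_momentFunction (γ := γ) hα hβ hom (n + 1) (hμ₀.trans hμ)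
      (hlarge μ hμ).1) (hmono'.monotoneOn _)
    (continuous_momentFunction hα hβ (n + 1)).continuousOn
  -- Time `0` is invisible to Laplace transforms; there monotonicity gives the upper bound `0`.
  rcases eq_or_ne t 0 with rfl | ht
  · rw [NNReal.coe_zero, momentFunction_succ_zero hβ]
    refine le_antisymm ?_ (integral_nonneg fun w => by positivity)
    have hlim : Tendsto (momentFunction α β γ om (n + 1)) (𝓝[>] 0) (𝓝 0) := by
      have := (continuous_momentFunction (γ := γ) (om := om) hα hβ (n + 1)).tendsto 0
      rw [momentFunction_succ_zero hβ] at this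
      exact this.mono_left nhdsWithin_le_nhds
    refine ge_of_tendsto hlim ?_
    filter_upwards [self_mem_nhdsWithin] with s hs
    rw [← heq hs]
    exact hmono zero_le
  · have := heq (show (t : ℝ) ∈ Ioi 0 from NNReal.coe_pos.2 (pos_iff_ne_zero.2 ht))
    simpa using this

theorem integrable_exp (hW : IsStableClock α β γ om W P) (hα : 0 < α) (hβ : 0 < β)
    (hγ : 0 ≤ γ) (hom : 0 ≤ om) (C : ℝ) (t : ℝ≥0) :
    Integrable (fun w => Real.exp (C * hittingTimeProcess W t w)) P := by
  have hm : ∀ c : ℝ, Measurable fun w => Real.exp (c * hittingTimeProcess W t w) := fun c =>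
    ((hW.measurable_hittingTime t).coe_nnreal_real.const_mul c).exp
  have hpos : ∀ c : ℝ, 0 < c → Integrable (fun w => Real.exp (c * hittingTimeProcess W t w)) P := by
    intro c hc
    obtain ⟨μ₀, hμ₀, hlarge⟩ := exists_lt_clockExponent hα hβ hγ hom (C := c)
    have hμ : 0 < μ₀ + 1 := by linarith
    -- With `c < Ψ(μ)` the transform of `exp (c s)` exists at `Ψ(μ)`.
    have hL := (hlarge (μ₀ + 1) (by linarith)).2
    have hd : ∀ s : ℝ, HasDerivAt (fun u => Real.exp (c * u) - 1) (c * Real.exp (c * s)) s := by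
      intro s
      have := (((hasDerivAt_id s).const_mul c).exp).sub_const 1
      simpa [mul_comm] using this
    have main := (hasLaplaceAt_integral_comp_hittingTime hW.increasing
      hW.laplace (clockExponent_pos hom one_pos) (g := fun s => c * Real.exp (c * s))
      (G := fun u => Real.exp (c * u) - 1) (by fun_prop) (fun s hs => by positivity)
      (fun u hu => lintegral_Ioo_of_hasDerivAt hd (by fun_prop)
        (fun s hs => by positivity) (by simp) hu) (by fun_prop)
      (fun u hu => sub_nonneg.2 (Real.one_le_exp (by positivity))) hμ
      ((HasLaplaceAt.exp hL).const_mul c)).1 t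
    refine (main.add (integrable_const (1 : ℝ))).congr (Eventually.of_forall fun w => ?_)
    simp only [Pi.add_apply, sub_add_cancel]
  refine Integrable.mono' (hpos (|C| + 1) (by positivity)) (hm C).aestronglyMeasurable
    (Eventually.of_forall fun w => ?_)
  rw [Real.norm_of_nonneg (Real.exp_nonneg _), Real.exp_le_exp]
  gcongr
  linarith [le_abs_self C]

/-- The exponential moments, positive or negative, as power series in the parameter. -/
theorem hasSum_exp (hW : IsStableClock α β γ om W P) (hα : 0 < α) (hβ : 0 < β)
    (hγ : 0 ≤ γ) (hom : 0 ≤ om) (x : ℝ) (t : ℝ≥0) :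
    Summable (fun n : ℕ => |x| ^ n * momentFunction α β γ om n t) ∧
    HasSum (fun n : ℕ => x ^ n * momentFunction α β γ om n t)
      (∫ w, Real.exp (x * hittingTimeProcess W t w) ∂P) := by
  have hmom := fun n => hW.integral_pow_div_factorial hα hβ hγ hom n t
  have hsum : Summable (fun n : ℕ => |x| ^ n * momentFunction α β γ om n t) := by
    refine summable_of_sum_range_le (c := ∫ w, Real.exp (|x| * hittingTimeProcess W t w) ∂P)
      (fun n => ?_) fun N => ?_
    · rw [← (hmom n).2]
      exact mul_nonneg (by positivity) (integral_nonneg fun w => by positivity)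
    · simp only [← (hmom _).2, ← integral_const_mul]
      rw [← integral_finsetSum _ fun n _ => (hmom n).1.const_mul _]
      refine integral_mono (integrable_finsetSum _ fun n _ => (hmom n).1.const_mul _)
        (hW.integrable_exp hα hβ hγ hom _ t) fun w => ?_
      have := Real.sum_le_exp_of_nonneg (x := |x| * hittingTimeProcess W t w) (by positivity) N
      simpa only [mul_pow, mul_div_assoc] using this
  refine ⟨hsum, ?_⟩
  have hnorm : ∀ n, ∫ w, ‖x ^ n * ((hittingTimeProcess W t w : ℝ) ^ n / n.factorial)‖ ∂P =
      |x| ^ n * momentFunction α β γ om n t := by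
    intro n
    rw [← (hmom n).2, ← integral_const_mul]
    refine integral_congr_ae (Eventually.of_forall fun w => ?_)
    simp only [norm_mul, norm_pow, Real.norm_eq_abs]
    rw [abs_of_nonneg (by positivity : 0 ≤ (hittingTimeProcess W t w : ℝ) ^ n / n.factorial)]
  have h := hasSum_integral_of_summable_integral_norm (μ := P)
    (F := fun (n : ℕ) w => x ^ n * ((hittingTimeProcess W t w : ℝ) ^ n / n.factorial))
    (fun n => (hmom n).1.const_mul _) (by simpa only [hnorm] using hsum)
  simp only [integral_const_mul, (hmom _).2] at h
  have hexp : ∀ w, Real.exp (x * hittingTimeProcess W t w) =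
      ∑' n : ℕ, x ^ n * ((hittingTimeProcess W t w : ℝ) ^ n / n.factorial) := by
    intro w
    rw [Real.exp_eq_exp_ℝ,
      ← (NormedSpace.expSeries_div_hasSum_exp (x * (hittingTimeProcess W t w : ℝ))).tsum_eq]
    simp only [mul_pow, mul_div_assoc]
  simpa only [hexp] using h

/-- The transform in time of the Laplace transform of the hitting time. -/
theorem hasLaplaceAt_exp (hW : IsStableClock α β γ om W P) (hom : 0 ≤ om) {x μ : ℝ} (hx : 0 ≤ x)
    (hμ : 0 < μ) :
    HasLaplaceAt (fun t => ∫ w, Real.exp (-(x * hittingTimeProcess W t.toNNReal w)) ∂P) μ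
      (clockExponent α β γ om μ / (μ * (clockExponent α β γ om μ + x))) := by
  have hΨ := clockExponent_pos (α := α) (β := β) (γ := γ) hom hμ
  have hm : ∀ t : ℝ≥0, Integrable (fun w => Real.exp (-(x * hittingTimeProcess W t w))) P := fun t =>
    Integrable.of_bound ((hW.measurable_hittingTime t).coe_nnreal_real.const_mul
      x).neg.exp.aestronglyMeasurable 1 (Eventually.of_forall fun w => by
        rw [Real.norm_of_nonneg (Real.exp_nonneg _), Real.exp_le_one_iff, neg_nonpos]
        positivity)
  have hd : ∀ s : ℝ, HasDerivAt (fun u => 1 - Real.exp (-x * u)) (x * Real.exp (-x * s)) s := by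
    intro s
    have := (((hasDerivAt_id s).const_mul (-x)).exp).const_sub 1
    simpa [mul_comm] using this
  have main := (hasLaplaceAt_integral_comp_hittingTime hW.increasing
      hW.laplace (clockExponent_pos hom one_pos) (g := fun s => x * Real.exp (-x * s))
      (G := fun u => 1 - Real.exp (-x * u)) (by fun_prop) (fun s hs => by positivity)
      (fun u hu => lintegral_Ioo_of_hasDerivAt hd (by fun_prop)
        (fun s hs => by positivity) (by simp) hu) (by fun_prop)
      (fun u hu => sub_nonneg.2 (Real.exp_le_one_iff.2 (by nlinarith))) hμ
      ((HasLaplaceAt.exp (by linarith : -x < clockExponent α β γ om μ)).const_mul x)).2.2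
  convert (HasLaplaceAt.one hμ).sub main using 1
  · ext t
    simp only [neg_mul]
    rw [integral_sub (integrable_const _) (hm _)]
    simp
  · rw [sub_neg_eq_add]
    field_simp
    ring

end IsStableClock

end Moment

/-! ### Taylor coefficients at the origin -/

/-- The `k`-th Taylor coefficient of `f` at `0`. -/
def taylorCoeff (f : ℝ → ℝ) (k : ℕ) : ℝ := iteratedDeriv k f 0 / (k.factorial : ℝ)

theorem taylorCoeff_congr {f g : ℝ → ℝ} (h : f =ᶠ[𝓝 0] g) (k : ℕ) :
    taylorCoeff f k = taylorCoeff g k := by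
  rw [taylorCoeff, taylorCoeff, h.iteratedDeriv_eq]

/-- A power series with bounded terms `c k ρ ^ k` represents its sum on the ball of radius `ρ`. -/
theorem hasFPowerSeriesOnBall_of_bound {c : ℕ → ℝ} {f : ℝ → ℝ} {ρ M : ℝ} (hρ : 0 < ρ)
    (hb : ∀ k, |c k| * ρ ^ k ≤ M) (h : ∀ u, |u| < ρ → HasSum (fun k => c k * u ^ k) (f u)) :
    HasFPowerSeriesOnBall f (FormalMultilinearSeries.ofScalars ℝ c) 0 (ENNReal.ofReal ρ) where
  r_le := by
    refine FormalMultilinearSeries.le_radius_of_bound (r := ρ.toNNReal) _ M fun n => ?_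
    rw [FormalMultilinearSeries.ofScalars_norm, Real.coe_toNNReal _ hρ.le]
    exact hb n
  r_pos := by simpa using hρ
  hasSum := by
    intro y hy
    have hy' : |y| < ρ := by
      rwa [Metric.mem_eball, edist_dist, Real.dist_eq, sub_zero,
        ENNReal.ofReal_lt_ofReal_iff hρ] at hy
    simpa [FormalMultilinearSeries.ofScalars_apply_eq, mul_comm] using h y hy'

/-- A function with a power series expansion near `0` is analytic there. -/
theorem hasFPowerSeriesAt_zero_of_hasSum {c : ℕ → ℝ} {f : ℝ → ℝ} {ρ : ℝ} (hρ : 0 < ρ)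
    (h : ∀ u, |u| < ρ → HasSum (fun k => c k * u ^ k) (f u)) :
    HasFPowerSeriesAt f (FormalMultilinearSeries.ofScalars ℝ c) 0 := by
  have hs := (h (ρ / 2) (by rw [abs_of_pos (by positivity)]; linarith)).summable
  obtain ⟨M, hM⟩ := hs.tendsto_atTop_zero.norm.bddAbove_range
  refine (hasFPowerSeriesOnBall_of_bound (ρ := ρ / 2) (M := M) (by positivity) (fun k => ?_)
    fun u hu => h u (by linarith)).hasFPowerSeriesAt
  have := hM (mem_range_self k)
  rwa [Real.norm_eq_abs, abs_mul, abs_of_pos (by positivity : 0 < (ρ / 2) ^ k)] at this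

theorem taylorCoeff_eq_of_hasFPowerSeriesAt {c : ℕ → ℝ} {f : ℝ → ℝ}
    (h : HasFPowerSeriesAt f (FormalMultilinearSeries.ofScalars ℝ c) 0) (k : ℕ) :
    taylorCoeff f k = c k := by
  have := (h.analyticAt.hasFPowerSeriesAt).eq_formalMultilinearSeries h
  exact congrFun (FormalMultilinearSeries.ofScalars_series_injective ℝ ℝ this) k

theorem taylorCoeff_eq_of_hasSum {c : ℕ → ℝ} {f : ℝ → ℝ} {ρ : ℝ} (hρ : 0 < ρ)
    (h : ∀ u, |u| < ρ → HasSum (fun k => c k * u ^ k) (f u)) (k : ℕ) : taylorCoeff f k = c k :=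
  taylorCoeff_eq_of_hasFPowerSeriesAt (hasFPowerSeriesAt_zero_of_hasSum hρ h) k

/-- The Taylor series of an analytic function converges absolutely near `0`. -/
theorem exists_hasSum_taylorCoeff {f : ℝ → ℝ} (hf : AnalyticAt ℝ f 0) :
    ∃ ρ, 0 < ρ ∧ Summable (fun k => |taylorCoeff f k| * ρ ^ k) ∧
      ∀ u, |u| ≤ ρ → HasSum (fun k => taylorCoeff f k * u ^ k) (f u) := by
  obtain ⟨r, hr⟩ := hf.hasFPowerSeriesAt
  obtain ⟨ρ, hρ0, hρr⟩ := ENNReal.lt_iff_exists_nnreal_btwn.1 hr.r_pos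
  have hρ0' : 0 < (ρ : ℝ) := by exact_mod_cast hρ0
  refine ⟨ρ, hρ0', ?_, fun u hu => ?_⟩
  · have := FormalMultilinearSeries.summable_norm_mul_pow _ (hρr.trans_le hr.r_le)
    simpa only [FormalMultilinearSeries.ofScalars_norm, Real.norm_eq_abs] using! this
  · have hmem : u ∈ Metric.eball (0 : ℝ) r := by
      rw [Metric.mem_eball, edist_dist, Real.dist_eq, sub_zero]
      refine lt_of_le_of_lt (ENNReal.ofReal_le_ofReal hu) ?_
      simpa using hρr
    have := hr.hasSum hmem
    simpa [FormalMultilinearSeries.ofScalars_apply_eq, taylorCoeff, mul_comm] using this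

/-- Leibniz' rule. -/
theorem taylorCoeff_mul {f g : ℝ → ℝ} (hf : AnalyticAt ℝ f 0) (hg : AnalyticAt ℝ g 0) (k : ℕ) :
    taylorCoeff (fun u => f u * g u) k =
      ∑ j ∈ Finset.range (k + 1), taylorCoeff f j * taylorCoeff g (k - j) := by
  rw [taylorCoeff, iteratedDeriv_fun_mul hf.contDiffAt hg.contDiffAt, Finset.sum_div]
  refine Finset.sum_congr rfl fun j hj => ?_
  have hjk : j ≤ k := Nat.lt_succ_iff.1 (Finset.mem_range.1 hj)
  rw [taylorCoeff, taylorCoeff, Nat.cast_choose ℝ hjk]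
  field_simp

theorem taylorCoeff_const (c : ℝ) (k : ℕ) :
    taylorCoeff (fun _ => c) k = if k = 0 then c else 0 := by
  rw [taylorCoeff, iteratedDeriv_const]
  split_ifs with h <;> simp [h]

theorem taylorCoeff_const_mul (c : ℝ) (f : ℝ → ℝ) (k : ℕ) :
    taylorCoeff (fun u => c * f u) k = c * taylorCoeff f k := by
  rw [taylorCoeff, iteratedDeriv_const_mul_field, taylorCoeff, mul_div_assoc]

theorem taylorCoeff_sum {ι : Type*} (s : Finset ι) {f : ι → ℝ → ℝ}
    (hf : ∀ i ∈ s, AnalyticAt ℝ (f i) 0) (k : ℕ) :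
    taylorCoeff (fun u => ∑ i ∈ s, f i u) k = ∑ i ∈ s, taylorCoeff (f i) k := by
  simp only [taylorCoeff]
  rw [iteratedDeriv_fun_sum fun i hi => (hf i hi).contDiffAt, Finset.sum_div]

theorem taylorCoeff_add {f g : ℝ → ℝ} (hf : AnalyticAt ℝ f 0) (hg : AnalyticAt ℝ g 0) (k : ℕ) :
    taylorCoeff (fun u => f u + g u) k = taylorCoeff f k + taylorCoeff g k := by
  simp only [taylorCoeff]
  rw [iteratedDeriv_fun_add hf.contDiffAt hg.contDiffAt, add_div]

/-- Cauchy-type estimate: if the absolute Taylor series of `φ` has the sum `C` at radius `ρ`, then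
`φ ^ n` has Taylor coefficients bounded by `C ^ n ρ ^ (-k)`. -/
theorem abs_taylorCoeff_pow_le {φ : ℝ → ℝ} (hφ : AnalyticAt ℝ φ 0) {ρ : ℝ} (hρ : 0 < ρ)
    (hs : Summable fun k => |taylorCoeff φ k| * ρ ^ k) (n k : ℕ) :
    |taylorCoeff (fun u => φ u ^ n) k| * ρ ^ k ≤ (∑' j, |taylorCoeff φ j| * ρ ^ j) ^ n := by
  induction n generalizing k with
  | zero =>
    simp only [pow_zero, taylorCoeff_const]
    split_ifs with h <;> simp [h]
  | succ n ih =>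
    simp only [pow_succ']
    rw [taylorCoeff_mul (g := fun u => φ u ^ n) hφ (hφ.pow n)]
    set C := ∑' j, |taylorCoeff φ j| * ρ ^ j
    have hC : 0 ≤ C := tsum_nonneg fun j => by positivity
    calc |∑ j ∈ Finset.range (k + 1), taylorCoeff φ j * taylorCoeff (fun u => φ u ^ n) (k - j)| *
          ρ ^ k
        ≤ (∑ j ∈ Finset.range (k + 1),
            |taylorCoeff φ j| * |taylorCoeff (fun u => φ u ^ n) (k - j)|) * ρ ^ k := by
          gcongr
          refine (Finset.abs_sum_le_sum_abs _ _).trans (Finset.sum_le_sum fun j _ => ?_)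
          rw [abs_mul]
      _ = ∑ j ∈ Finset.range (k + 1), (|taylorCoeff φ j| * ρ ^ j) *
            (|taylorCoeff (fun u => φ u ^ n) (k - j)| * ρ ^ (k - j)) := by
          rw [Finset.sum_mul]
          refine Finset.sum_congr rfl fun j hj => ?_
          have hjk : j ≤ k := Nat.lt_succ_iff.1 (Finset.mem_range.1 hj)
          rw [← pow_mul_pow_sub ρ hjk]
          ring
      _ ≤ ∑ j ∈ Finset.range (k + 1), (|taylorCoeff φ j| * ρ ^ j) * C ^ n := by
          gcongr with j _
          exact ih _
      _ ≤ C * C ^ n := by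
          rw [← Finset.sum_mul]
          gcongr
          exact hs.sum_le_tsum _ fun j _ => by positivity

theorem hasSum_taylorCoeff_pow {φ : ℝ → ℝ} (hφ : AnalyticAt ℝ φ 0) {ρ : ℝ} (hρ : 0 < ρ)
    (hs : Summable fun k => |taylorCoeff φ k| * ρ ^ k)
    (h : ∀ u, |u| ≤ ρ → HasSum (fun k => taylorCoeff φ k * u ^ k) (φ u)) (n : ℕ) {u : ℝ}
    (hu : |u| < ρ) : HasSum (fun k => taylorCoeff (fun u => φ u ^ n) k * u ^ k) (φ u ^ n) := by
  have habs : ∀ n, Summable fun k => ‖taylorCoeff (fun u => φ u ^ n) k * u ^ k‖ := by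
    intro n
    refine Summable.of_nonneg_of_le (fun _ => norm_nonneg _) (fun k => ?_)
      ((summable_geometric_of_lt_one (r := |u| / ρ) (by positivity)
        ((div_lt_one hρ).2 hu)).mul_left ((∑' j, |taylorCoeff φ j| * ρ ^ j) ^ n))
    have := abs_taylorCoeff_pow_le hφ hρ hs n k
    rw [norm_mul, norm_pow, Real.norm_eq_abs, Real.norm_eq_abs, div_pow]
    calc |taylorCoeff (fun u => φ u ^ n) k| * |u| ^ k =
        (|taylorCoeff (fun u => φ u ^ n) k| * ρ ^ k) * (|u| ^ k / ρ ^ k) := by field_simp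
      _ ≤ _ := by gcongr
  induction n with
  | zero =>
    simp only [pow_zero, taylorCoeff_const]
    convert hasSum_ite_eq (0 : ℕ) (1 : ℝ) using 2 with k
    split_ifs with hk <;> simp [hk]
  | succ n ih =>
    have h1 : Summable fun k => ‖taylorCoeff φ k * u ^ k‖ := by
      simpa using habs 1
    have hprod := tsum_mul_tsum_eq_tsum_sum_range_of_summable_norm h1 (habs n)
    rw [(h u hu.le).tsum_eq, ih.tsum_eq] at hprod
    rw [pow_succ', hprod]
    have e : ∀ k, taylorCoeff (fun u => φ u ^ (n + 1)) k * u ^ k = ∑ j ∈ Finset.range (k + 1),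
        taylorCoeff φ j * u ^ j * (taylorCoeff (fun u => φ u ^ n) (k - j) * u ^ (k - j)) := by
      intro k
      simp only [pow_succ' _ n]
      rw [taylorCoeff_mul (g := fun u => φ u ^ n) hφ (hφ.pow n), Finset.sum_mul]
      refine Finset.sum_congr rfl fun j hj => ?_
      have hjk : j ≤ k := Nat.lt_succ_iff.1 (Finset.mem_range.1 hj)
      rw [← pow_mul_pow_sub u hjk]
      ring
    have hsum := (habs (n + 1)).of_norm
    simp only [e] at hsum ⊢
    exact hsum.hasSum

/-- Taylor coefficients of the composition of an entire function with an analytic one: by the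
bounds on the coefficients of `φ ^ n` the double series may be summed in either order. -/
theorem hasSum_taylorCoeff_comp {φ f : ℝ → ℝ} (hφ : AnalyticAt ℝ φ 0) {m : ℕ → ℝ}
    (hm : ∀ C : ℝ, 0 ≤ C → Summable fun n => |m n| * C ^ n)
    (hf : f =ᶠ[𝓝 0] fun u => ∑' n, m n * φ u ^ n) (k : ℕ) :
    HasSum (fun n => m n * taylorCoeff (fun u => φ u ^ n) k) (taylorCoeff f k) := by
  obtain ⟨ρ, hρ, hs, hφs⟩ := exists_hasSum_taylorCoeff hφ
  set C := ∑' j, |taylorCoeff φ j| * ρ ^ j with hCdef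
  have hC : 0 ≤ C := tsum_nonneg fun j => by positivity
  set a : ℕ → ℕ → ℝ := fun n k => taylorCoeff (fun u => φ u ^ n) k with ha
  have hak : ∀ n k, |a n k| ≤ C ^ n * (ρ ^ k)⁻¹ := fun n k => by
    rw [← div_eq_mul_inv, le_div_iff₀ (by positivity)]
    exact abs_taylorCoeff_pow_le hφ hρ hs n k
  have hd : ∀ k, Summable fun n => m n * a n k := fun k => by
    refine Summable.of_norm_bounded ((hm C hC).mul_right (ρ ^ k)⁻¹) fun n => ?_
    rw [norm_mul, Real.norm_eq_abs, Real.norm_eq_abs, mul_assoc]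
    gcongr
    exact hak n k
  suffices h : taylorCoeff f k = ∑' n, m n * a n k by
    rw [h]; exact (hd k).hasSum
  rw [taylorCoeff_congr hf]
  refine taylorCoeff_eq_of_hasSum (c := fun k => ∑' n, m n * a n k) hρ (fun u hu => ?_) k
  have hsum : Summable fun q : ℕ × ℕ => m q.1 * (a q.1 q.2 * u ^ q.2) := by
    have hg := summable_geometric_of_lt_one (r := |u| / ρ) (by positivity) ((div_lt_one hρ).2 hu)
    refine Summable.of_norm_bounded ((hm C hC).mul_of_nonneg hg (fun n => by positivity)
      fun k => by positivity) fun q => ?_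
    rw [norm_mul, norm_mul, norm_pow]
    simp only [Real.norm_eq_abs]
    calc |m q.1| * (|a q.1 q.2| * |u| ^ q.2)
        ≤ |m q.1| * (C ^ q.1 * (ρ ^ q.2)⁻¹ * |u| ^ q.2) := by
          gcongr
          exact hak _ _
      _ = _ := by rw [div_pow]; ring
  have hrow : ∀ n, HasSum (fun k => m n * (a n k * u ^ k)) (m n * φ u ^ n) := fun n =>
    (hasSum_taylorCoeff_pow hφ hρ hs hφs n hu).mul_left (m n)
  have h1 : ∑' n, m n * φ u ^ n = ∑' q : ℕ × ℕ, m q.1 * (a q.1 q.2 * u ^ q.2) :=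
    ((hsum.hasSum.prod_fiberwise hrow).tsum_eq)
  rw [h1]
  have hcol : ∀ k, HasSum (fun n => m n * (a n k * u ^ k)) ((∑' n, m n * a n k) * u ^ k) := by
    intro k
    have := (hd k).hasSum.mul_right (u ^ k)
    simpa only [mul_assoc] using this
  exact ((Equiv.prodComm ℕ ℕ).hasSum_iff.2 hsum.hasSum).prod_fiberwise hcol

/-! ### The space symbol and the innermost series -/

theorem taylorCoeff_deriv (f : ℝ → ℝ) (m : ℕ) :
    taylorCoeff (deriv f) m = (m + 1) * taylorCoeff f (m + 1) := by
  rw [taylorCoeff, taylorCoeff, ← iteratedDeriv_succ', Nat.factorial_succ]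
  push_cast
  field_simp

theorem taylorCoeff_id (j : ℕ) : taylorCoeff (fun u => u) j = if j = 1 then 1 else 0 := by
  rw [taylorCoeff, iteratedDeriv_fun_id_zero]
  split_ifs with h <;> simp [h]

/-- The Euler operator `x d/dx` multiplies the `m`-th Taylor coefficient by `m`. -/
theorem taylorCoeff_mul_deriv {f : ℝ → ℝ} (hf : AnalyticAt ℝ f 0) (m : ℕ) :
    taylorCoeff (fun x => x * deriv f x) m = m * taylorCoeff f m := by
  rw [taylorCoeff_mul (f := fun x => x) analyticAt_id hf.deriv]
  simp only [taylorCoeff_id, ite_mul, one_mul, zero_mul, Finset.sum_ite_eq', Finset.mem_range]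
  rcases m with _ | m
  · simp
  · rw [if_pos (by omega), add_tsub_cancel_right, taylorCoeff_deriv]
    push_cast
    ring

theorem _root_.AnalyticAt.rpow_const_of_ne {f : ℝ → ℝ} {x : ℝ} (hf : AnalyticAt ℝ f x) (h : f x ≠ 0)
    (p : ℝ) : AnalyticAt ℝ (fun y => f y ^ p) x :=
  ((Real.contDiffAt_rpow_const_of_ne (p := p) h).comp x hf.contDiffAt).analyticAt

/-- The functions obtained from `H` by applying the operators `ν x d/dx - i`, `i < k`. They are
the derivatives of `u ↦ H ((1 - u) ^ ν)`, up to powers of `u - 1`. -/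
def eulerIterate (ν : ℝ) (H : ℝ → ℝ) : ℕ → ℝ → ℝ
  | 0 => H
  | k + 1 => fun x => ν * (x * deriv (eulerIterate ν H k) x) + -k * eulerIterate ν H k x

theorem analyticOnNhd_eulerIterate {ν : ℝ} {H : ℝ → ℝ} {s : Set ℝ} (hH : AnalyticOnNhd ℝ H s)
    (k : ℕ) : AnalyticOnNhd ℝ (eulerIterate ν H k) s := by
  induction k with
  | zero => exact hH
  | succ k ih =>
    exact fun x hx => (analyticAt_const.mul (analyticAt_id.mul (ih.deriv x hx))).add
      (analyticAt_const.mul (ih x hx))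

theorem taylorCoeff_eulerIterate {ν : ℝ} {H : ℝ → ℝ} (hH : AnalyticAt ℝ H 0) (k m : ℕ) :
    taylorCoeff (eulerIterate ν H k) m = (∏ i ∈ Finset.range k, (ν * m - i)) * taylorCoeff H m := by
  have hH' : AnalyticOnNhd ℝ H {0} := by simpa [AnalyticOnNhd] using hH
  induction k with
  | zero => simp [eulerIterate]
  | succ k ih =>
    have ha : AnalyticAt ℝ (eulerIterate ν H k) 0 := analyticOnNhd_eulerIterate hH' k 0 rfl
    have hb : AnalyticAt ℝ (fun x => x * deriv (eulerIterate ν H k) x) 0 :=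
      analyticAt_id.mul ha.deriv
    rw [eulerIterate, taylorCoeff_add (f := fun x => ν * (x * deriv (eulerIterate ν H k) x))
      (g := fun x => -(k : ℝ) * eulerIterate ν H k x) (analyticAt_const.mul hb)
      (analyticAt_const.mul ha),
      taylorCoeff_const_mul, taylorCoeff_const_mul, taylorCoeff_mul_deriv ha, ih,
      Finset.prod_range_succ]
    ring

theorem iteratedDeriv_comp_one_sub_rpow {ν : ℝ} {H : ℝ → ℝ} (hH : AnalyticOnNhd ℝ H (Ioi 0))
    (k : ℕ) {u : ℝ} (hu : u < 1) :
    iteratedDeriv k (fun u => H ((1 - u) ^ ν)) u =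
      (-1) ^ k * (1 - u) ^ (-(k : ℝ)) * eulerIterate ν H k ((1 - u) ^ ν) := by
  induction k generalizing u with
  | zero => simp [eulerIterate]
  | succ k ih =>
    have h1u : 0 < 1 - u := by linarith
    rw [iteratedDeriv_succ]
    have hev : iteratedDeriv k (fun u => H ((1 - u) ^ ν)) =ᶠ[𝓝 u] fun u =>
        (-1) ^ k * (1 - u) ^ (-(k : ℝ)) * eulerIterate ν H k ((1 - u) ^ ν) := by
      filter_upwards [gt_mem_nhds hu] with v hv
      exact ih hv
    rw [hev.deriv_eq]
    have hpow : ∀ p : ℝ, HasDerivAt (fun v : ℝ => (1 - v) ^ p) (-(p * (1 - u) ^ (p - 1))) u := by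
      intro p
      have := ((hasDerivAt_id u).const_sub 1).rpow_const (p := p) (Or.inl h1u.ne')
      refine this.congr_deriv ?_
      simp only [id]
      ring
    have hy : 0 < (1 - u) ^ ν := Real.rpow_pos_of_pos h1u _
    have hD : HasDerivAt (eulerIterate ν H k) (deriv (eulerIterate ν H k) ((1 - u) ^ ν))
        ((1 - u) ^ ν) :=
      (analyticOnNhd_eulerIterate hH k _ hy).differentiableAt.hasDerivAt
    have := (((hpow (-(k : ℝ))).const_mul ((-1 : ℝ) ^ k)).mul (hD.comp u (hpow ν)))
    refine (HasDerivAt.deriv (f := fun u => (-1) ^ k * (1 - u) ^ (-(k : ℝ)) *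
      eulerIterate ν H k ((1 - u) ^ ν)) this).trans ?_
    simp only [eulerIterate, Function.comp]
    have e1 : (1 - u) ^ (-((k + 1 : ℕ) : ℝ)) = (1 - u) ^ (-(k : ℝ)) / (1 - u) := by
      rw [← Real.rpow_sub_one h1u.ne']; push_cast; ring_nf
    rw [Real.rpow_sub_one h1u.ne', Real.rpow_sub_one h1u.ne', e1, pow_succ]
    field_simp
    ring

/-- If the Taylor series of `D` at `0` converges at `1`, be it conditionally, it converges to
`D 1`, provided that `D` is analytic on `[0, 1]`: use the identity theorem on `[0, 1)` and Abel's
limit theorem at `1`. -/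
theorem eq_of_tendsto_taylorCoeff {D : ℝ → ℝ} {ε : ℝ} (hε : 0 < ε)
    (hD : AnalyticOnNhd ℝ D (Ioi (-ε))) {L : ℝ}
    (hL : Tendsto (fun K => ∑ m ∈ Finset.range K, taylorCoeff D m) atTop (𝓝 L)) : D 1 = L := by
  set c := taylorCoeff D
  have hc0 : Tendsto c atTop (𝓝 0) := by
    have h1 := (hL.comp (tendsto_add_atTop_nat 1)).sub hL
    simpa [Finset.sum_range_succ] using h1
  obtain ⟨M, hM⟩ := hc0.norm.bddAbove_range
  have hM' : ∀ k, |c k| ≤ M := fun k => hM (mem_range_self k)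
  have hsum : ∀ x : ℝ, |x| < 1 → HasSum (fun k => c k * x ^ k) (∑' k, c k * x ^ k) := by
    intro x hx
    refine Summable.hasSum (Summable.of_norm_bounded
      ((summable_geometric_of_lt_one (abs_nonneg x) hx).mul_left M) fun k => ?_)
    rw [norm_mul, norm_pow, Real.norm_eq_abs, Real.norm_eq_abs]
    gcongr
    exact hM' k
  have hS := hasFPowerSeriesOnBall_of_bound (M := M) one_pos (by simpa using hM') hsum
  set U : Set ℝ := Ioo (max (-1) (-ε)) 1 with hU
  have hSan : AnalyticOnNhd ℝ (fun x => ∑' k, c k * x ^ k) U := by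
    intro x hx
    refine hS.analyticAt_of_mem ?_
    rw [Metric.mem_eball, edist_dist, Real.dist_eq, sub_zero, ENNReal.ofReal_lt_ofReal_iff one_pos,
      abs_lt]
    exact ⟨(le_max_left _ _).trans_lt hx.1, hx.2⟩
  have hDan : AnalyticOnNhd ℝ D U := fun x hx => hD x ((le_max_right _ _).trans_lt hx.1)
  have h0 : (0 : ℝ) ∈ U := ⟨max_lt (by norm_num) (by linarith), one_pos⟩
  have hev : D =ᶠ[𝓝 0] fun x => ∑' k, c k * x ^ k := by
    obtain ⟨ρ, hρ, -, hDs⟩ := exists_hasSum_taylorCoeff (hDan 0 h0)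
    filter_upwards [Metric.closedBall_mem_nhds (0 : ℝ) hρ] with x hx
    rw [Metric.mem_closedBall, Real.dist_eq, sub_zero] at hx
    exact (hDs x hx).tsum_eq.symm
  have heq := hDan.eqOn_of_preconnected_of_eventuallyEq hSan isPreconnected_Ioo h0 hev
  have hlim1 := Real.tendsto_tsum_powerSeries_nhdsWithin_lt hL
  have hlim2 : Tendsto D (𝓝[<] 1) (𝓝 (D 1)) :=
    ((hD 1 (by simp only [mem_Ioi]; linarith)).continuousAt.tendsto).mono_left nhdsWithin_le_nhds
  refine tendsto_nhds_unique (hlim2.congr' ?_) hlim1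
  filter_upwards [Ioo_mem_nhdsLT h0.2] with x hx
  exact heq ⟨h0.1.trans hx.1, hx.2⟩

/-- The convention `Γ(-n) = 0` of the library and `1 / 0 = 0` make the quotient vanish at the poles
of `Γ` in the denominator, where the product has a zero factor. -/
theorem Gamma_div_Gamma_eq_prod {x : ℝ} (hx : 0 ≤ x) (k : ℕ) :
    Real.Gamma (x + 1) / Real.Gamma (x - k + 1) = ∏ i ∈ Finset.range k, (x - i) := by
  induction k with
  | zero =>
    have := (Real.Gamma_pos_of_pos (by linarith : 0 < x + 1)).ne'
    simp [this]
  | succ k ih =>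
    rw [Finset.prod_range_succ, ← ih]
    push_cast
    rw [show x - (k + 1) + 1 = x - k by ring]
    rcases eq_or_ne (x - k) 0 with h | h
    · simp [h]
    · rw [Real.Gamma_add_one h]
      field_simp

theorem analyticOnNhd_affine_rpow {η κ : ℝ} (hκ : 0 < κ) (a : ℝ) :
    AnalyticOnNhd ℝ (fun x => (η + κ * x) ^ a) (Ioi (-(η / κ))) := by
  intro x hx
  refine AnalyticAt.rpow_const_of_ne (analyticAt_const.add (analyticAt_const.mul analyticAt_id))
    (ne_of_gt ?_) a
  have : -(η / κ) < x := hx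
  rw [neg_lt, lt_div_iff₀ hκ] at this
  simp only [Pi.add_apply, Pi.mul_apply, id]
  linarith

theorem hasSum_affine_rpow {η κ : ℝ} (hη : 0 < η) (hκ : 0 < κ) (a : ℝ) {x : ℝ}
    (hx : |x| < η / κ) :
    HasSum (fun m : ℕ => Ring.choose a m * η ^ (a - m) * κ ^ m * x ^ m) ((η + κ * x) ^ a) := by
  have hx1 : |κ * x / η| < 1 := by
    rw [abs_div, abs_mul, abs_of_pos hκ, abs_of_pos hη, div_lt_one hη]
    rwa [lt_div_iff₀ hκ, mul_comm] at hx
  have h := (Real.one_add_rpow_hasFPowerSeriesOnBall_zero (a := a)).hasSum (y := κ * x / η)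
    (by rw [Metric.mem_eball, edist_dist, Real.dist_eq, sub_zero, ENNReal.ofReal_lt_one]; exact hx1)
  simp only [binomialSeries, FormalMultilinearSeries.ofScalars_apply_eq, zero_add,
    smul_eq_mul] at h
  have h2 := h.mul_left (η ^ a)
  have hpos : 0 < 1 + κ * x / η := by linarith [(abs_lt.1 hx1).1]
  rw [← Real.mul_rpow hη.le hpos.le, mul_add, mul_one, mul_div_cancel₀ _ hη.ne'] at h2
  refine h2.congr_fun fun m => ?_
  rw [Real.rpow_sub hη, Real.rpow_natCast, div_pow, mul_pow]
  field_simp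

theorem taylorCoeff_affine_rpow {η κ : ℝ} (hη : 0 < η) (hκ : 0 < κ) (a : ℝ) (m : ℕ) :
    taylorCoeff (fun x => (η + κ * x) ^ a) m = Ring.choose a m * η ^ (a - m) * κ ^ m :=
  taylorCoeff_eq_of_hasSum (div_pos hη hκ) (fun _ hu => hasSum_affine_rpow hη hκ a hu) m

section Symbol

variable {η lam ν δ : ℝ}

/-- The innermost series is the Taylor series, taken at `1`, of an iterate of Euler operators applied
to `x ↦ (η + lam ^ ν x) ^ (r δ)`. -/
theorem innerTerm_eq_taylorCoeff (hη : 0 < η) (hlam : 0 < lam) (hν : 0 < ν) (k r m : ℕ) :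
    innerTerm η lam ν δ k r m =
      taylorCoeff (eulerIterate ν (fun x => (η + lam ^ ν * x) ^ (r * δ)) k) m := by
  have hκ : 0 < lam ^ ν := Real.rpow_pos_of_pos hlam _
  have h0 : (0 : ℝ) ∈ Ioi (-(η / lam ^ ν)) := by simpa using div_pos hη hκ
  rw [taylorCoeff_eulerIterate (analyticOnNhd_affine_rpow hκ _ 0 h0),
    taylorCoeff_affine_rpow hη hκ, innerTerm, Gamma_div_Gamma_eq_prod (by positivity),
    Real.rpow_mul hlam.le, Real.rpow_natCast, mul_comm δ]
  ring

/-- The sum of the innermost series, which may converge only conditionally, is up to a factor the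
`k`-th Taylor coefficient of a power of `η + lam ^ ν (1 - u) ^ ν`. -/
theorem taylorCoeff_symbol_rpow (hη : 0 < η) (hlam : 0 < lam) (hν : 0 < ν) {k r : ℕ} {L : ℝ}
    (hL : Tendsto (fun K => ∑ m ∈ Finset.range K, innerTerm η lam ν δ k r m) atTop (𝓝 L)) :
    taylorCoeff (fun u => (η + lam ^ ν * (1 - u) ^ ν) ^ (r * δ)) k =
      (-1) ^ k / k.factorial * L := by
  have hκ : 0 < lam ^ ν := Real.rpow_pos_of_pos hlam _
  have hH := analyticOnNhd_affine_rpow (η := η) hκ (r * δ)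
  simp only [innerTerm_eq_taylorCoeff hη hlam hν] at hL
  have h1 := eq_of_tendsto_taylorCoeff (div_pos hη hκ) (analyticOnNhd_eulerIterate hH k) hL
  rw [taylorCoeff, iteratedDeriv_comp_one_sub_rpow (H := fun x => (η + lam ^ ν * x) ^ (r * δ))
    (hH.mono (Ioi_subset_Ioi (by have := div_pos hη hκ; linarith))) k one_pos]
  simp only [sub_zero, Real.one_rpow, mul_one, h1]
  ring

theorem analyticAt_symbol_rpow (hη : 0 < η) (hlam : 0 < lam) (a : ℝ) :
    AnalyticAt ℝ (fun u => (η + lam ^ ν * (1 - u) ^ ν) ^ a) 0 := by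
  have hκ : 0 < lam ^ ν := Real.rpow_pos_of_pos hlam _
  refine AnalyticAt.rpow_const_of_ne (analyticAt_const.add (analyticAt_const.mul
    ((analyticAt_const.sub analyticAt_id).rpow_const_of_ne ?_ ν))) ?_ a
  · simp
  · simp only [Pi.add_apply, Pi.mul_apply, Pi.sub_apply, id, sub_zero, Real.one_rpow]
    positivity

theorem analyticAt_spaceSymbol (hη : 0 < η) (hlam : 0 < lam) :
    AnalyticAt ℝ (spaceSymbol η lam ν δ) 0 :=
  (analyticAt_symbol_rpow hη hlam δ).sub analyticAt_const

theorem taylorCoeff_spaceSymbol_pow (hη : 0 < η) (hlam : 0 < lam) (hν : 0 < ν) {k : ℕ}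
    {L : ℕ → ℝ} (hL : ∀ r, Tendsto (fun K => ∑ m ∈ Finset.range K, innerTerm η lam ν δ k r m) atTop
      (𝓝 (L r))) (n : ℕ) :
    taylorCoeff (fun u => spaceSymbol η lam ν δ u ^ n) k = (-1) ^ k / k.factorial *
      ∑ r ∈ Finset.range (n + 1), (n.choose r : ℝ) * (-(η ^ δ)) ^ (n - r) * L r := by
  have hκ : 0 < lam ^ ν := Real.rpow_pos_of_pos hlam _
  have hev : (fun u => spaceSymbol η lam ν δ u ^ n) =ᶠ[𝓝 0] fun u =>
      ∑ r ∈ Finset.range (n + 1), ((n.choose r : ℝ) * (-(η ^ δ)) ^ (n - r)) *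
        (η + lam ^ ν * (1 - u) ^ ν) ^ (r * δ) := by
    filter_upwards [gt_mem_nhds (one_pos : (0 : ℝ) < 1)] with u hu
    have hX : 0 < η + lam ^ ν * (1 - u) ^ ν := by
      have : 0 ≤ (1 - u) ^ ν := Real.rpow_nonneg (by linarith) _
      positivity
    rw [spaceSymbol, sub_eq_add_neg, add_pow]
    refine Finset.sum_congr rfl fun r _ => ?_
    rw [mul_comm (r : ℝ) δ, Real.rpow_mul hX.le, Real.rpow_natCast]
    ring
  rw [taylorCoeff_congr hev, taylorCoeff_sum
    (f := fun r u => ((n.choose r : ℝ) * (-(η ^ δ)) ^ (n - r)) *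
      (η + lam ^ ν * (1 - u) ^ ν) ^ (r * δ)) _ fun r _ =>
    analyticAt_const.mul (analyticAt_symbol_rpow hη hlam _), Finset.mul_sum]
  refine Finset.sum_congr rfl fun r _ => ?_
  rw [taylorCoeff_const_mul, taylorCoeff_symbol_rpow hη hlam hν (hL r)]
  ring

/-- A polynomial factor does not shrink the disc of convergence of a power series. -/
theorem summable_prod_sub_mul_pow {c : ℕ → ℝ} {R : ℝ} (ν : ℝ)
    (h : ∀ x, |x| < R → Summable fun m => c m * x ^ m) (k : ℕ) {x : ℝ} (hx : |x| < R) :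
    Summable fun m : ℕ => (∏ i ∈ Finset.range k, (ν * m - i)) * c m * x ^ m := by
  induction k generalizing x with
  | zero => simpa using h x hx
  | succ k ih =>
    obtain ⟨y, hxy, hyR⟩ := exists_between hx
    have hy0 : 0 < y := (abs_nonneg x).trans_lt hxy
    have hs := (ih (x := y) (by rwa [abs_of_pos hy0])).norm
    have hq1 : |x| / y < 1 := (div_lt_one hy0).2 hxy
    have hlim : Tendsto (fun m : ℕ => |ν| * (m * (|x| / y) ^ m) + k * (|x| / y) ^ m) atTop
        (𝓝 (|ν| * 0 + k * 0)) :=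
      ((tendsto_self_mul_const_pow_of_lt_one (by positivity) hq1).const_mul _).add
        ((tendsto_pow_atTop_nhds_zero_of_lt_one (by positivity) hq1).const_mul _)
    rw [mul_zero, mul_zero, add_zero] at hlim
    refine Summable.of_norm_bounded_eventually_nat hs ?_
    filter_upwards [hlim.eventually_le_const one_pos] with m hm
    rw [Finset.prod_range_succ]
    have h1 : |ν * m - k| * (|x| / y) ^ m ≤ 1 := by
      refine le_trans ?_ hm
      have : |ν * m - k| ≤ |ν| * m + k := by
        refine (abs_sub _ _).trans ?_
        rw [abs_mul, Nat.abs_cast, Nat.abs_cast]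
      calc |ν * m - k| * (|x| / y) ^ m ≤ (|ν| * m + k) * (|x| / y) ^ m := by gcongr
        _ = _ := by ring
    simp only [norm_mul, norm_pow, Real.norm_eq_abs, abs_of_pos hy0]
    calc |∏ i ∈ Finset.range k, (ν * m - i)| * |ν * m - k| * |c m| * |x| ^ m
        = |∏ i ∈ Finset.range k, (ν * m - i)| * |c m| * y ^ m *
          (|ν * m - k| * (|x| / y) ^ m) := by
          rw [div_pow]; field_simp
      _ ≤ |∏ i ∈ Finset.range k, (ν * m - i)| * |c m| * y ^ m * 1 := by gcongr
      _ = _ := mul_one _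

/-- For `lam ^ ν < η` the point `1` lies inside the disc of convergence; for an integer `δ` the series
terminates. -/
theorem summable_innerTerm (hη : 0 < η) (hlam : 0 < lam) (hν : 0 < ν)
    (h : lam ^ ν < η ∨ ∃ d : ℕ, δ = d) (k r : ℕ) : Summable (innerTerm η lam ν δ k r) := by
  have hκ : 0 < lam ^ ν := Real.rpow_pos_of_pos hlam _
  rcases h with h | ⟨d, rfl⟩
  · have hs := summable_prod_sub_mul_pow ν (fun x hx => (hasSum_affine_rpow hη hκ (r * δ) hx).summable) k
      (x := 1) (by rwa [abs_one, one_lt_div hκ])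
    refine hs.congr fun m => ?_
    rw [innerTerm, Gamma_div_Gamma_eq_prod (by positivity), Real.rpow_mul hlam.le,
      Real.rpow_natCast, mul_comm δ, one_pow]
    ring
  · refine summable_of_ne_finset_zero (s := Finset.range (r * d + 1)) fun m hm => ?_
    rw [innerTerm, ← Nat.cast_mul, Ring.choose_natCast, Nat.choose_eq_zero_of_lt]
    · simp
    · simpa using hm

end Symbol

/-! ### The time-changed processes -/

section Laws

variable {Ω : Type*} [MeasurableSpace Ω] {P : Measure Ω}

theorem isIncreasingProcess_sum_subordinated {ι : Type*} [Fintype ι] {A : ι → ℝ≥0 → Ω → ℝ≥0}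
    {T : ℝ≥0 → Ω → ℝ≥0} {Φ : ι → ℝ → ℝ} {Ψ : ℝ → ℝ} (hA : ∀ i, IsSubordinator (A i) (Φ i) P)
    (hT : IsSubordinator T Ψ P) (c : ι → ℝ≥0) :
    IsIncreasingProcess fun t w => ∑ i, A i (c i * T t w) w :=
  IsIncreasingProcess.sum _ fun i => (IsIncreasingProcess.of_isSubordinator (hA i)).comp
    ((IsIncreasingProcess.of_isSubordinator hT).const_mul (c i))

/-- `M` is an integer-valued increasing process with `𝔼 u ^ (M s) = exp (-s φ(u))`. -/
structure IsCountingProcess (φ : ℝ → ℝ) (M : ℝ≥0 → Ω → ℕ) (P : Measure Ω) : Prop where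
  increasing : IsIncreasingProcess M
  pgf : ∀ (s : ℝ≥0) (u : ℝ), |u| ≤ 1 → ∫ w, u ^ M s w ∂P = Real.exp (-(s * φ u))

variable [IsProbabilityMeasure P] {η lam om : ℝ≥0} {ν δ α β γ : ℝ}

theorem rpow_pow_rpow_div {a x : ℝ} {n : ℕ} (ha : 0 ≤ a) (hn : n ≠ 0) :
    (a ^ n) ^ (x / n) = a ^ x := by
  rw [← Real.rpow_natCast, ← Real.rpow_mul ha, mul_div_cancel₀ _ (Nat.cast_ne_zero.2 hn)]

/-- By the binomial theorem the weighted stable sum has the Laplace exponent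
`(η + μ ^ ν) ^ n - η ^ n` with `n = ⌈δ⌉`, and the tempered clock takes the power `δ / n`. -/
theorem integral_exp_subordinatedStableSum (hδ : 0 < δ)
    {A : Fin ⌈δ⌉₊ → ℝ≥0 → Ω → ℝ≥0} {T : ℝ≥0 → Ω → ℝ≥0}
    (hA : ∀ i, IsStableSubordinator (A i) (ν * ((i : ℕ) + 1)) P)
    (hT : IsTemperedStableSubordinator T (δ / ⌈δ⌉₊) ((η : ℝ) ^ ⌈δ⌉₊) P)
    (hAT : iIndepFun (fun (o : Option (Fin ⌈δ⌉₊)) w t => (o.elim T A) t w) P)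
    (t : ℝ≥0) {μ : ℝ} (hμ : 0 ≤ μ) :
    ∫ w, Real.exp (-(μ * (subordinatedStableSum η ⌈δ⌉₊ A T t w : ℝ))) ∂P =
      Real.exp (-(t * ((η + μ ^ ν) ^ δ - (η : ℝ) ^ δ))) := by
  set n := ⌈δ⌉₊ with hn
  have hn0 : n ≠ 0 := (Nat.ceil_pos.2 hδ).ne'
  have hx : 0 ≤ μ ^ ν := Real.rpow_nonneg hμ ν
  have hsum : ∑ i : Fin n, (((n.choose (i + 1) : ℝ≥0) * η ^ (n - (i + 1)) : ℝ≥0) : ℝ) *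
      μ ^ (ν * ((i : ℕ) + 1)) = (η + μ ^ ν) ^ n - (η : ℝ) ^ n := by
    have h1 : (η + μ ^ ν) ^ n = ∑ i ∈ Finset.range (n + 1),
        (μ ^ ν) ^ i * (η : ℝ) ^ (n - i) * n.choose i := by rw [add_comm, add_pow]
    rw [h1, Finset.sum_range_succ', Finset.sum_range]
    simp only [pow_zero, Nat.sub_zero, Nat.choose_zero_right, Nat.cast_one, mul_one, one_mul,
      add_sub_cancel_right]
    refine Finset.sum_congr rfl fun i _ => ?_
    have e : μ ^ (ν * ((i : ℕ) + 1)) = (μ ^ ν) ^ ((i : ℕ) + 1) := by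
      rw [← Real.rpow_natCast, ← Real.rpow_mul hμ]
      push_cast
      rfl
    rw [e]
    push_cast
    ring
  have h := integral_exp_sum_subordinated hA hT hAT
    (fun i => (n.choose (i + 1) : ℝ≥0) * η ^ (n - (i + 1))) t hμ (by
      rw [hsum, sub_nonneg]
      gcongr
      linarith)
  rw [hsum] at h
  refine h.trans ?_
  rw [add_sub_cancel, rpow_pow_rpow_div (by positivity) hn0,
    rpow_pow_rpow_div (by positivity) hn0]

theorem isCountingProcess_subordinated (hδ : 0 < δ)
    {A : Fin ⌈δ⌉₊ → ℝ≥0 → Ω → ℝ≥0} {T : ℝ≥0 → Ω → ℝ≥0}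
    (hA : ∀ i, IsStableSubordinator (A i) (ν * ((i : ℕ) + 1)) P)
    (hT : IsTemperedStableSubordinator T (δ / ⌈δ⌉₊) ((η : ℝ) ^ ⌈δ⌉₊) P)
    (hAT : iIndepFun (fun (o : Option (Fin ⌈δ⌉₊)) w t => (o.elim T A) t w) P)
    {N : ℝ≥0 → Ω → ℕ} (hN : IsPoissonProcess N lam P)
    (hNV : IndepFun (fun w t => N t w) (fun w t => subordinatedStableSum η ⌈δ⌉₊ A T t w) P) :
    IsCountingProcess (spaceSymbol η lam ν δ)
      (fun t w => N (subordinatedStableSum η ⌈δ⌉₊ A T t w) w) P where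
  increasing := IsIncreasingProcess.comp ⟨hN.measurable, hN.mono, hN.right_cont⟩
    (isIncreasingProcess_sum_subordinated hA hT _)
  pgf s u hu := by
    have hV : IsIncreasingProcess (subordinatedStableSum η ⌈δ⌉₊ A T) :=
      isIncreasingProcess_sum_subordinated hA hT _
    have hu1 : 0 ≤ 1 - u := by linarith [(abs_le.1 hu).2]
    have h := integral_comp_counting_randomTime (P := P) (M := N) (F := fun n => u ^ n)
      ⟨hN.measurable, hN.mono, hN.right_cont⟩ (hV.measurable s)
      (hNV.comp measurable_id (measurable_pi_apply (X := fun _ => ℝ≥0) s))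
      (fun n => by rw [abs_pow]; exact pow_le_one₀ (abs_nonneg u) hu)
    rw [h]
    simp only [hN.integral_pow hu]
    rw [integral_exp_subordinatedStableSum hδ hA hT hAT s (mul_nonneg lam.coe_nonneg hu1),
      Real.mul_rpow lam.coe_nonneg hu1, spaceSymbol]

theorem ceilRatio_mul_ceil (γ : ℝ) (hγ : 0 ≤ γ) : (⌈γ⌉₊ : ℝ) * ceilRatio γ = γ := by
  rw [ceilRatio]
  split_ifs with h
  · simp [h]
  · rw [mul_div_cancel₀]
    exact Nat.cast_ne_zero.2 (Nat.ceil_pos.2 (hγ.lt_of_ne' h)).ne'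

theorem ceilRatio_pos (hγ : 0 ≤ γ) : 0 < ceilRatio γ := by
  rw [ceilRatio]
  split_ifs with h
  · exact one_pos
  · have h' := hγ.lt_of_ne' h
    exact div_pos h' (Nat.cast_pos.2 (Nat.ceil_pos.2 h'))

/-- The sum over `r` is a binomial expansion with exponent `⌈γ⌉`, and the clock `S` raises it to the
power `γ / ⌈γ⌉`. -/
theorem isStableClock_clockedStableSum (hγ : 0 ≤ γ)
    {B : Fin (⌈γ⌉₊ + 1) → ℝ≥0 → Ω → ℝ≥0} {S : ℝ≥0 → Ω → ℝ≥0}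
    (hB : ∀ r, IsStableSubordinator (B r) (β / ceilRatio γ - (r : ℕ) * α) P)
    (hS : IsStableSubordinator S (ceilRatio γ) P)
    (hBS : iIndepFun (fun (o : Option (Fin (⌈γ⌉₊ + 1))) w t => (o.elim S B) t w) P) :
    IsStableClock α β γ om (clockedStableSum om ⌈γ⌉₊ B S) P where
  increasing := isIncreasingProcess_sum_subordinated hB hS _
  laplace s μ hμ := by
    set c := ⌈γ⌉₊ with hc
    have hρ := ceilRatio_pos hγ
    have hx : 0 ≤ om * μ ^ (-α) := by positivity
    have hsum : ∑ r : Fin (c + 1), (((c.choose r : ℝ≥0) * om ^ (r : ℕ) : ℝ≥0) : ℝ) *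
        μ ^ (β / ceilRatio γ - (r : ℕ) * α) =
        μ ^ (β / ceilRatio γ) * (1 + om * μ ^ (-α)) ^ c := by
      rw [add_comm (1 : ℝ), add_pow, Finset.mul_sum, Finset.sum_range]
      refine Finset.sum_congr rfl fun r _ => ?_
      have e : μ ^ (β / ceilRatio γ - (r : ℕ) * α) =
          μ ^ (β / ceilRatio γ) * (μ ^ (-α)) ^ (r : ℕ) := by
        rw [← Real.rpow_natCast, ← Real.rpow_mul hμ.le, ← Real.rpow_add hμ]
        ring_nf
      rw [e, one_pow, mul_pow]
      push_cast
      ring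
    have h := integral_exp_sum_subordinated hB hS hBS
      (fun r => (c.choose r : ℝ≥0) * om ^ (r : ℕ)) s hμ.le (by rw [hsum]; positivity)
    rw [hsum] at h
    refine h.trans ?_
    rw [Real.mul_rpow (by positivity) (by positivity), ← Real.rpow_mul hμ.le,
      div_mul_cancel₀ _ hρ.ne', ← Real.rpow_natCast, ← Real.rpow_mul (by positivity),
      ceilRatio_mul_ceil γ hγ, clockExponent]

theorem spaceSymbol_nonneg (hδ : 0 < δ) {u : ℝ} (hu : u ≤ 1) :
    0 ≤ spaceSymbol η lam ν δ u := by
  have : (0 : ℝ) ≤ (lam : ℝ) ^ ν * (1 - u) ^ ν :=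
    mul_nonneg (by positivity) (Real.rpow_nonneg (by linarith) _)
  rw [spaceSymbol, sub_nonneg]
  exact Real.rpow_le_rpow (by positivity) (by linarith) hδ.le

end Laws

/-! ### State probabilities of the counting process at the hitting time -/

section State

variable {Ω : Type*} [MeasurableSpace Ω] {P : Measure Ω}
  {φ : ℝ → ℝ} {M : ℝ≥0 → Ω → ℕ} {W : ℝ≥0 → Ω → ℝ≥0} {α β γ om : ℝ}

theorem measureReal_eq_integral_indicator {X : Ω → ℕ} (hX : Measurable X) (k : ℕ) :
    P.real {w | X w = k} = ∫ w, (if X w = k then (1 : ℝ) else 0) ∂P := by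
  have h := integral_indicator_one (μ := P) (hX (measurableSet_singleton k))
  rw [show {w | X w = k} = X ⁻¹' {k} from rfl, ← h]
  refine integral_congr_ae (Eventually.of_forall fun w => ?_)
  by_cases hw : X w = k <;> simp [hw, indicator]

theorem measurable_counting_hittingTime (hM : IsCountingProcess φ M P)
    (hW : IsStableClock α β γ om W P) (t : ℝ≥0) :
    Measurable fun w => M (hittingTimeProcess W t w) w :=
  (measurable_uncurry_of_right_cont hM.increasing.measurable hM.increasing.right_cont).comp
    ((hW.measurable_hittingTime t).prodMk measurable_id)

variable [IsProbabilityMeasure P]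

/-- Conditioning on the hitting time. -/
theorem integral_comp_counting_hittingTime (hM : IsCountingProcess φ M P)
    (hW : IsStableClock α β γ om W P)
    (hi : IndepFun (fun w t => M t w) (fun w t => hittingTimeProcess W t w) P) {F : ℕ → ℝ}
    (hF : ∀ n, |F n| ≤ 1) (t : ℝ≥0) :
    ∫ w, F (M (hittingTimeProcess W t w) w) ∂P =
      ∫ w, (∫ w', F (M (hittingTimeProcess W t w) w') ∂P) ∂P :=
  integral_comp_counting_randomTime hM.increasing (hW.measurable_hittingTime t)
    (hi.comp measurable_id (measurable_pi_apply (X := fun _ => ℝ≥0) t)) hF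

theorem stateProb_eq_integral (hM : IsCountingProcess φ M P) (hW : IsStableClock α β γ om W P)
    (hi : IndepFun (fun w t => M t w) (fun w t => hittingTimeProcess W t w) P) (k : ℕ) (t : ℝ) :
    stateProb P (fun t w => M (hittingTimeProcess W t w) w) k t =
      ∫ w, P.real {w' | M (hittingTimeProcess W t.toNNReal w) w' = k} ∂P := by
  rw [stateProb, measureReal_eq_integral_indicator (measurable_counting_hittingTime hM hW _),
    integral_comp_counting_hittingTime hM hW hi (F := fun n => if n = k then (1 : ℝ) else 0)]
  · simp only [measureReal_eq_integral_indicator (hM.increasing.measurable _) k]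
  · intro n
    split_ifs <;> simp

/-- The probability generating function of the state at time `t` is the Laplace transform of
the hitting time at `φ(u)`. -/
theorem hasSum_pow_mul_stateProb (hM : IsCountingProcess φ M P)
    (hW : IsStableClock α β γ om W P)
    (hi : IndepFun (fun w t => M t w) (fun w t => hittingTimeProcess W t w) P) {u : ℝ}
    (hu : |u| ≤ 1) (t : ℝ) :
    HasSum (fun k => u ^ k * stateProb P (fun t w => M (hittingTimeProcess W t w) w) k t)
      (∫ w, Real.exp (-(φ u * hittingTimeProcess W t.toNNReal w)) ∂P) := by
  have h := hasSum_pow_mul_measureReal (P := P)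
    (measurable_counting_hittingTime hM hW t.toNNReal) hu
  rw [integral_comp_counting_hittingTime hM hW hi (F := fun n => u ^ n)
    (fun n => by rw [abs_pow]; exact pow_le_one₀ (abs_nonneg u) hu)] at h
  simp only [hM.pgf _ u hu] at h
  simpa only [mul_comm (φ u), stateProb] using h

/-- The Laplace transform of the hitting time as a series in its moments. -/
theorem hasSum_exp_neg_hittingTime (hW : IsStableClock α β γ om W P) (hα : 0 < α) (hβ : 0 < β)
    (hγ : 0 ≤ γ) (hom : 0 ≤ om) (x : ℝ) {t : ℝ} (ht : 0 ≤ t) :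
    Summable (fun n : ℕ => |x| ^ n * momentFunction α β γ om n t) ∧
    HasSum (fun n : ℕ => (-x) ^ n * momentFunction α β γ om n t)
      (∫ w, Real.exp (-(x * hittingTimeProcess W t.toNNReal w)) ∂P) := by
  have h := hW.hasSum_exp hα hβ hγ hom (-x) t.toNNReal
  simpa only [abs_neg, Real.coe_toNNReal t ht, neg_mul] using h

/-- Expand `𝔼 exp (-φ(u) U_t)` in powers of `φ(u)` and compare coefficients of `u ^ k` with those of
the probability generating function. -/
theorem hasSum_stateProb_taylorCoeff (hM : IsCountingProcess φ M P)
    (hW : IsStableClock α β γ om W P)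
    (hi : IndepFun (fun w t => M t w) (fun w t => hittingTimeProcess W t w) P) (hα : 0 < α)
    (hβ : 0 < β) (hγ : 0 ≤ γ) (hom : 0 ≤ om) (hφ : AnalyticAt ℝ φ 0) (k : ℕ) {t : ℝ}
    (ht : 0 ≤ t) :
    HasSum (fun n : ℕ => (-1) ^ n * momentFunction α β γ om n t *
        taylorCoeff (fun u => φ u ^ n) k)
      (stateProb P (fun t w => M (hittingTimeProcess W t w) w) k t) := by
  set f : ℝ → ℝ := fun u => ∫ w, Real.exp (-(φ u * hittingTimeProcess W t.toNNReal w)) ∂P with hf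
  have hcoeff : taylorCoeff f k = stateProb P (fun t w => M (hittingTimeProcess W t w) w) k t :=
    taylorCoeff_eq_of_hasSum one_pos (fun u hu =>
      (hasSum_pow_mul_stateProb hM hW hi hu.le t).congr_fun fun k => mul_comm _ _) k
  rw [← hcoeff]
  refine hasSum_taylorCoeff_comp (m := fun n => (-1) ^ n * momentFunction α β γ om n t) hφ
    (fun C hC => ?_) (Eventually.of_forall fun u => ?_) k
  · have h := (hasSum_exp_neg_hittingTime hW hα hβ hγ hom C ht).1.norm
    refine h.congr fun n => ?_
    rw [norm_mul, norm_pow, Real.norm_eq_abs, Real.norm_eq_abs, abs_abs, abs_of_nonneg hC, abs_mul,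
      abs_pow, abs_neg, abs_one, one_pow, one_mul, mul_comm]
  · rw [hf]
    dsimp only
    rw [← (hasSum_exp_neg_hittingTime hW hα hβ hγ hom (φ u) ht).2.tsum_eq]
    refine tsum_congr fun n => ?_
    rw [neg_pow]
    ring

theorem stateProb_zero (hM : IsCountingProcess φ M P) (hW : IsStableClock α β γ om W P)
    (hi : IndepFun (fun w t => M t w) (fun w t => hittingTimeProcess W t w) P) (hα : 0 < α)
    (hβ : 0 < β) (hγ : 0 ≤ γ) (hom : 0 ≤ om) (hφ : AnalyticAt ℝ φ 0) (k : ℕ) :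
    stateProb P (fun t w => M (hittingTimeProcess W t w) w) k 0 = if k = 0 then 1 else 0 := by
  refine (hasSum_stateProb_taylorCoeff hM hW hi hα hβ hγ hom hφ k le_rfl).unique ?_
  convert hasSum_single (f := fun n : ℕ => (-1) ^ n * momentFunction α β γ om n 0 *
        taylorCoeff (fun u => φ u ^ n) k) 0 fun n hn => ?_ using 1
  · simp [momentFunction_zero, taylorCoeff_const]
  · obtain ⟨m, rfl⟩ := Nat.exists_eq_succ_of_ne_zero hn
    simp [momentFunction_succ_zero hβ]

end State

/-! ### Regularity of the state probabilities -/

theorem _root_.AbsolutelyContinuousOnInterval.of_dist_le_mul {f g : ℝ → ℝ} {a b C : ℝ}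
    (hg : AbsolutelyContinuousOnInterval g a b)
    (h : ∀ x ∈ uIcc a b, ∀ y ∈ uIcc a b, dist (f x) (f y) ≤ C * dist (g x) (g y)) :
    AbsolutelyContinuousOnInterval f a b := by
  have hg' := Tendsto.const_mul C hg
  rw [mul_zero] at hg'
  refine squeeze_zero' (Eventually.of_forall fun E => Finset.sum_nonneg fun _ _ => dist_nonneg)
    ?_ hg'
  refine eventually_inf_principal.2 (Eventually.of_forall fun E hE => ?_)
  rw [Finset.mul_sum]
  exact Finset.sum_le_sum fun i hi => h _ (hE.1 i hi).1 _ (hE.1 i hi).2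

section Regularity

variable {Ω : Type*} [MeasurableSpace Ω] {P : Measure Ω} [IsProbabilityMeasure P]
  {φ : ℝ → ℝ} {M : ℝ≥0 → Ω → ℕ} {W : ℝ≥0 → Ω → ℝ≥0} {α β γ om : ℝ}

/-- The first moment of the hitting time is the integral of a Prabhakar kernel. -/
theorem momentFunction_one_eq_integral (hα : 0 < α) (hβ : 0 < β) (hγ : 0 ≤ γ) (hom : 0 ≤ om)
    {t : ℝ} (ht : 0 ≤ t) :
    IntervalIntegrable (prabhakarKernel α om γ β) volume 0 t ∧
    momentFunction α β γ om 1 t = ∫ y in (0 : ℝ)..t, prabhakarKernel α om γ β y := by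
  obtain ⟨μ₀, hμ₀, hlarge⟩ := exists_lt_clockExponent hα hβ hγ hom (C := 0)
  have hk : ∀ μ, μ₀ < μ → HasLaplaceAt (prabhakarKernel α om γ β) μ
      (1 / clockExponent α β γ om μ) := by
    intro μ hμ
    have hμ' := hμ₀.trans hμ
    have h := hasLaplaceAt_prabhakarKernel hα γ hom hβ hμ' (hlarge μ hμ).1
    rw [Real.rpow_neg hμ'.le, Real.rpow_neg (by positivity), ← mul_inv, ← one_div] at h
    exact h
  have hint : ∀ b, 0 ≤ b → IntervalIntegrable (prabhakarKernel α om γ β) volume 0 b := fun b hb =>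
    (hk (μ₀ + 1) (by linarith)).intervalIntegrable le_rfl hb
  refine ⟨hint t ht, ?_⟩
  rcases ht.eq_or_lt with rfl | ht
  · rw [intervalIntegral.integral_same, momentFunction_succ_zero hβ]
  refine eqOn_of_hasLaplaceAt (μ₀ := μ₀) (F := fun μ => 1 / (μ * clockExponent α β γ om μ ^ 1))
    (fun μ hμ => hasLaplaceAt_momentFunction hα hβ hom 1 (hμ₀.trans hμ) (hlarge μ hμ).1)
    (g := fun t => ∫ y in (0 : ℝ)..t, prabhakarKernel α om γ β y) (fun μ hμ => ?_)
    (continuous_momentFunction hα hβ 1).continuousOn (fun s hs => ?_) ht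
  · have h := (HasLaplaceAt.one (hμ₀.trans hμ)).conv (hk μ hμ)
    simp only [one_mul] at h
    rw [pow_one, ← one_div_mul_one_div]
    exact h
  · have hs' : 0 < s := hs
    have hc := (intervalIntegral.continuousOn_primitive_interval' (hint (s + 1) (by linarith))
      left_mem_uIcc)
    rw [uIcc_of_le (by linarith)] at hc
    exact (hc.continuousAt (Icc_mem_nhds hs' (by linarith))).continuousWithinAt

theorem hasSum_pow_mul_counting (hM : IsCountingProcess φ M P) (s : ℝ≥0) {u : ℝ} (hu : |u| ≤ 1) :
    HasSum (fun k : ℕ => u ^ k * P.real {w | M s w = k}) (Real.exp (-(s * φ u))) := by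
  rw [← hM.pgf s u hu]
  exact hasSum_pow_mul_measureReal (hM.increasing.measurable s) hu

/-- The generating function is multiplicative in time, so that the laws of the counting process
form a convolution semigroup. -/
theorem measureReal_counting_add (hM : IsCountingProcess φ M P) (s h : ℝ≥0) (k : ℕ) :
    P.real {w | M (s + h) w = k} = ∑ j ∈ Finset.range (k + 1),
      P.real {w | M h w = j} * P.real {w | M s w = (k - j : ℕ)} := by
  have hs : ∀ (s : ℝ≥0) (u : ℝ), |u| < 1 →
      HasSum (fun k : ℕ => P.real {w | M s w = k} * u ^ k) (Real.exp (-(s * φ u))) := fun s u hu =>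
    (hasSum_pow_mul_counting hM s hu.le).congr_fun fun k => mul_comm _ _
  have han : ∀ s : ℝ≥0, AnalyticAt ℝ (fun u => Real.exp (-(s * φ u))) 0 := fun s =>
    (hasFPowerSeriesAt_zero_of_hasSum one_pos (hs s)).analyticAt
  rw [← taylorCoeff_eq_of_hasSum one_pos (hs (s + h)) k]
  have e : (fun u => Real.exp (-(((s + h : ℝ≥0) : ℝ) * φ u))) =
      fun u => Real.exp (-(h * φ u)) * Real.exp (-(s * φ u)) := by
    ext u
    rw [← Real.exp_add]
    push_cast
    ring_nf
  rw [e, taylorCoeff_mul (f := fun u => Real.exp (-(h * φ u)))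
    (g := fun u => Real.exp (-(s * φ u))) (han h) (han s)]
  refine Finset.sum_congr rfl fun j _ => ?_
  rw [taylorCoeff_eq_of_hasSum one_pos (hs h), taylorCoeff_eq_of_hasSum one_pos (hs s)]

/-- The law of the counting process is Lipschitz in time: in the convolution with the law
of `M h` the mass at `0`, which is `exp (-h φ(0))`, is separated from the rest. -/
theorem abs_measureReal_counting_sub_le (hM : IsCountingProcess φ M P) (k : ℕ) {s s' : ℝ≥0}
    (hss : s ≤ s') :
    |P.real {w | M s' w = k} - P.real {w | M s w = k}| ≤ φ 0 * (s' - s) := by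
  obtain ⟨h, rfl⟩ := exists_add_of_le hss
  set q : ℝ≥0 → ℕ → ℝ := fun s k => P.real {w | M s w = k} with hq
  have hq0 : ∀ s k, 0 ≤ q s k := fun s k => measureReal_nonneg
  have hq1 : ∀ s k, q s k ≤ 1 := fun s k => measureReal_le_one
  have hone : HasSum (q h) 1 := by
    have h1 := hasSum_pow_mul_measureReal (P := P) (hM.increasing.measurable h)
      (u := 1) (by simp)
    simpa using h1
  have hzero : q h 0 = Real.exp (-(h * φ 0)) := by
    refine HasSum.unique ?_ (hasSum_pow_mul_counting hM h (u := 0) (by simp))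
    convert hasSum_single (f := fun k : ℕ => (0 : ℝ) ^ k * P.real {w | M h w = k}) 0
      fun n hn => ?_ using 1
    · simp [hq]
    · simp [hn]
  have hsum : ∑ j ∈ Finset.range k, q h (j + 1) ≤ 1 - q h 0 := by
    have h2 := sum_le_hasSum (Finset.range (k + 1)) (fun j _ => hq0 h j) hone
    rw [Finset.sum_range_succ'] at h2
    linarith
  have hadd : q (s + h) k = (∑ j ∈ Finset.range k, q h (j + 1) * q s (k - (j + 1))) +
      q h 0 * q s k := by
    rw [hq]
    dsimp only
    rw [measureReal_counting_add hM, Finset.sum_range_succ']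
    simp
  have hle : ∑ j ∈ Finset.range k, q h (j + 1) * q s (k - (j + 1)) ≤ 1 - q h 0 :=
    (Finset.sum_le_sum fun j _ => mul_le_of_le_one_right (hq0 _ _) (hq1 _ _)).trans hsum
  have hge : 0 ≤ ∑ j ∈ Finset.range k, q h (j + 1) * q s (k - (j + 1)) :=
    Finset.sum_nonneg fun j _ => mul_nonneg (hq0 _ _) (hq0 _ _)
  have hexp : 1 - q h 0 ≤ φ 0 * h := by
    have := Real.add_one_le_exp (-(h * φ 0))
    rw [hzero]
    linarith
  have e : φ 0 * (((s + h : ℝ≥0) : ℝ) - s) = φ 0 * h := by push_cast; ring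
  rw [e]
  refine le_trans ?_ hexp
  change |q (s + h) k - q s k| ≤ _
  have hp : (1 - q h 0) * q s k ≤ 1 - q h 0 :=
    mul_le_of_le_one_right (by linarith [hq1 h 0]) (hq1 s k)
  have hp' : 0 ≤ (1 - q h 0) * q s k := mul_nonneg (by linarith [hq1 h 0]) (hq0 s k)
  rw [abs_le, hadd]
  constructor <;> linarith

/-- The state probabilities vary less than the mean hitting time. -/
theorem abs_stateProb_sub_le (hM : IsCountingProcess φ M P) (hW : IsStableClock α β γ om W P)
    (hi : IndepFun (fun w t => M t w) (fun w t => hittingTimeProcess W t w) P) (hα : 0 < α)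
    (hβ : 0 < β) (hγ : 0 ≤ γ) (hom : 0 ≤ om) (k : ℕ) {t t' : ℝ} (htt : t ≤ t') :
    |stateProb P (fun t w => M (hittingTimeProcess W t w) w) k t' -
        stateProb P (fun t w => M (hittingTimeProcess W t w) w) k t| ≤
      φ 0 * (momentFunction α β γ om 1 t'.toNNReal - momentFunction α β γ om 1 t.toNNReal) := by
  have hmom := fun t => hW.integral_pow_div_factorial hα hβ hγ hom 1 t
  simp only [pow_one, Nat.factorial_one, Nat.cast_one, div_one] at hmom
  have hqm : ∀ t : ℝ≥0, Integrable
      (fun w => P.real {w' | M (hittingTimeProcess W t w) w' = k}) P := by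
    intro t
    have hqc : Measurable fun s : ℝ≥0 => P.real {w' | M s w' = k} := by
      have hc : Continuous fun s : ℝ≥0 => P.real {w' | M s w' = k} := by
        refine (LipschitzWith.of_dist_le_mul (K := (φ 0).toNNReal) fun s s' => ?_).continuous
        rcases le_total s s' with h | h
        · rw [dist_comm, dist_comm s s', Real.dist_eq, NNReal.dist_eq,
            abs_of_nonneg (sub_nonneg.2 (NNReal.coe_le_coe.2 h))]
          refine (abs_measureReal_counting_sub_le hM k h).trans ?_
          gcongr
          · exact sub_nonneg.2 (NNReal.coe_le_coe.2 h)
          · exact Real.le_coe_toNNReal _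
        · rw [Real.dist_eq, NNReal.dist_eq,
            abs_of_nonneg (sub_nonneg.2 (NNReal.coe_le_coe.2 h))]
          refine (abs_measureReal_counting_sub_le hM k h).trans ?_
          gcongr
          · exact sub_nonneg.2 (NNReal.coe_le_coe.2 h)
          · exact Real.le_coe_toNNReal _
      exact hc.measurable
    refine Integrable.of_bound (hqc.comp (hW.measurable_hittingTime t)).aestronglyMeasurable 1
      (Eventually.of_forall fun w => ?_)
    rw [Real.norm_of_nonneg measureReal_nonneg]
    exact measureReal_le_one
  rw [stateProb_eq_integral hM hW hi, stateProb_eq_integral hM hW hi, ← integral_sub (hqm _) (hqm _),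
    ← (hmom _).2, ← (hmom _).2, ← integral_sub (hmom _).1 (hmom _).1, ← integral_const_mul]
  refine (abs_integral_le_integral_abs).trans (integral_mono_ae ((hqm _).sub (hqm _)).abs
    (((hmom _).1.sub (hmom _).1).const_mul _) ?_)
  filter_upwards [hW.ae_hittingTime_mono hom] with w hw
  exact abs_measureReal_counting_sub_le hM k (hw (Real.toNNReal_le_toNNReal htt))

theorem dist_stateProb_le (hM : IsCountingProcess φ M P) (hW : IsStableClock α β γ om W P)
    (hi : IndepFun (fun w t => M t w) (fun w t => hittingTimeProcess W t w) P) (hα : 0 < α)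
    (hβ : 0 < β) (hγ : 0 ≤ γ) (hom : 0 ≤ om) (hφ0 : 0 ≤ φ 0) (k : ℕ) (t t' : ℝ) :
    dist (stateProb P (fun t w => M (hittingTimeProcess W t w) w) k t)
        (stateProb P (fun t w => M (hittingTimeProcess W t w) w) k t') ≤
      φ 0 * dist (momentFunction α β γ om 1 t.toNNReal)
        (momentFunction α β γ om 1 t'.toNNReal) := by
  rcases le_total t t' with h | h
  · rw [dist_comm, dist_comm (momentFunction _ _ _ _ _ _), Real.dist_eq, Real.dist_eq]
    exact (abs_stateProb_sub_le hM hW hi hα hβ hγ hom k h).trans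
      (mul_le_mul_of_nonneg_left (le_abs_self _) hφ0)
  · rw [Real.dist_eq, Real.dist_eq]
    exact (abs_stateProb_sub_le hM hW hi hα hβ hγ hom k h).trans
      (mul_le_mul_of_nonneg_left (le_abs_self _) hφ0)

theorem continuous_stateProb (hM : IsCountingProcess φ M P) (hW : IsStableClock α β γ om W P)
    (hi : IndepFun (fun w t => M t w) (fun w t => hittingTimeProcess W t w) P) (hα : 0 < α)
    (hβ : 0 < β) (hγ : 0 ≤ γ) (hom : 0 ≤ om) (hφ0 : 0 ≤ φ 0) (k : ℕ) :
    Continuous (stateProb P (fun t w => M (hittingTimeProcess W t w) w) k) := by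
  have hm : Continuous fun t : ℝ => momentFunction α β γ om 1 t.toNNReal :=
    (continuous_momentFunction hα hβ 1).comp (by fun_prop)
  rw [continuous_iff_continuousAt]
  intro t
  rw [ContinuousAt, tendsto_iff_dist_tendsto_zero]
  have h := (tendsto_iff_dist_tendsto_zero.1 (hm.tendsto t)).const_mul (φ 0)
  rw [mul_zero] at h
  exact squeeze_zero (fun _ => dist_nonneg)
    (fun s => dist_stateProb_le hM hW hi hα hβ hγ hom hφ0 k s t) h

theorem absolutelyContinuousOnInterval_stateProb (hM : IsCountingProcess φ M P)
    (hW : IsStableClock α β γ om W P)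
    (hi : IndepFun (fun w t => M t w) (fun w t => hittingTimeProcess W t w) P) (hα : 0 < α)
    (hβ : 0 < β) (hγ : 0 ≤ γ) (hom : 0 ≤ om) (hφ0 : 0 ≤ φ 0) (k : ℕ) {b : ℝ} (hb : 0 < b) :
    AbsolutelyContinuousOnInterval
      (stateProb P (fun t w => M (hittingTimeProcess W t w) w) k) 0 b := by
  have hint := (momentFunction_one_eq_integral hα hβ hγ hom hb.le).1
  refine (hint.absolutelyContinuousOnInterval_intervalIntegral
    left_mem_uIcc).of_dist_le_mul (C := φ 0) fun x hx y hy => ?_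
  rw [uIcc_of_le hb.le] at hx hy
  refine (dist_stateProb_le hM hW hi hα hβ hγ hom hφ0 k x y).trans_eq ?_
  rw [Real.coe_toNNReal x hx.1, Real.coe_toNNReal y hy.1,
    (momentFunction_one_eq_integral hα hβ hγ hom hx.1).2,
    (momentFunction_one_eq_integral hα hβ hγ hom hy.1).2]

end Regularity

/-! ### Fractional calculus through Laplace transforms -/

/-- The convolution on the half-line of a locally integrable function with a continuous function
that vanishes on the negative half-line is continuous. -/
theorem continuous_conv {k g : ℝ → ℝ} (hk : ∀ b, 0 ≤ b → IntervalIntegrable k volume 0 b)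
    (hg : Continuous g) (hg0 : ∀ t ≤ 0, g t = 0) :
    Continuous fun t => ∫ y in (0 : ℝ)..t, k (t - y) * g y := by
  have hfix : ∀ b : ℝ, 0 ≤ b → Continuous fun t => ∫ y in (0 : ℝ)..b, k y * g (t - y) := by
    intro b hb
    rw [continuous_iff_continuousAt]
    intro t
    obtain ⟨C, hC⟩ := (isCompact_Icc (a := t - 1 - b) (b := t + 1)).exists_bound_of_continuousOn
      hg.continuousOn
    refine intervalIntegral.continuousAt_of_dominated_interval (bound := fun y => ‖k y‖ * C)
      (Eventually.of_forall fun s => ?_) ?_ ((hk b hb).norm.mul_const C)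
      (Eventually.of_forall fun y _ => by fun_prop)
    · exact (intervalIntegrable_iff.1 ((hk b hb).mul_continuousOn (g := fun y => g (s - y))
        (by fun_prop))).aestronglyMeasurable
    · filter_upwards [Ioo_mem_nhds (sub_one_lt t) (lt_add_one t)] with s hs
      refine Eventually.of_forall fun y hy => ?_
      rw [uIoc_of_le hb] at hy
      rw [norm_mul]
      gcongr
      exact hC _ ⟨by linarith [hs.1, hy.2], by linarith [hs.2, hy.1]⟩
  -- Since `g` vanishes on `(-∞, 0]`, the upper limit of the reflected integral may be fixed.
  have heq : ∀ b t : ℝ, 0 ≤ b → t ≤ b →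
      ∫ y in (0 : ℝ)..t, k (t - y) * g y = ∫ y in (0 : ℝ)..b, k y * g (t - y) := by
    intro b t hb htb
    rcases le_total t 0 with ht | ht
    · rw [intervalIntegral.integral_congr (g := fun _ => (0 : ℝ)) fun y hy => ?_,
        intervalIntegral.integral_congr (a := 0) (b := b) (g := fun _ => (0 : ℝ)) fun y hy => ?_]
      · simp
      · rw [uIcc_of_le hb] at hy
        simp [hg0 (t - y) (by linarith [hy.1])]
      · rw [uIcc_of_ge ht] at hy
        simp [hg0 y hy.2]
    · have h1 := intervalIntegral.integral_comp_sub_left (fun y => k y * g (t - y))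
        (a := 0) (b := t) t
      simp only [sub_sub_cancel, sub_self, sub_zero] at h1
      rw [h1]
      have hint : ∀ c, 0 ≤ c → IntervalIntegrable (fun y => k y * g (t - y)) volume 0 c :=
        fun c hc => (hk c hc).mul_continuousOn (by fun_prop)
      rw [← intervalIntegral.integral_add_adjacent_intervals (hint t ht)
        ((hint t ht).symm.trans (hint b hb)),
        intervalIntegral.integral_congr (a := t) (b := b) (g := fun _ => (0 : ℝ)) fun y hy => ?_]
      · simp
      · rw [uIcc_of_le htb] at hy
        simp [hg0 (t - y) (by linarith [hy.1])]
  rw [continuous_iff_continuousAt]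
  intro t
  refine ((hfix (max t 0 + 1) (by positivity)).continuousAt (x := t)).congr ?_
  filter_upwards [gt_mem_nhds (show t < max t 0 + 1 by linarith [le_max_left t 0])] with s hs
  exact (heq _ s (by positivity) hs.le).symm

theorem conv_of_nonpos {k g : ℝ → ℝ} (hg0 : ∀ t ≤ 0, g t = 0) {t : ℝ} (ht : t ≤ 0) :
    ∫ y in (0 : ℝ)..t, k (t - y) * g y = 0 := by
  rw [intervalIntegral.integral_congr (g := fun _ => (0 : ℝ)) fun y hy => ?_]
  · simp
  · rw [uIcc_of_ge ht] at hy
    simp [hg0 y hy.2]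

/-- The `n`-fold integral of `h` from `0`. -/
def iteratedIntegral (h : ℝ → ℝ) : ℕ → ℝ → ℝ
  | 0 => h
  | n + 1 => fun t => ∫ y in (0 : ℝ)..t, iteratedIntegral h n y

theorem contDiff_iteratedIntegral {h : ℝ → ℝ} (hh : Continuous h) (n : ℕ) :
    ContDiff ℝ n (iteratedIntegral h n) ∧ iteratedDeriv n (iteratedIntegral h n) = h := by
  induction n with
  | zero => exact ⟨contDiff_zero.2 hh, iteratedDeriv_zero⟩
  | succ n ih =>
    have hd : ∀ t, HasDerivAt (iteratedIntegral h (n + 1)) (iteratedIntegral h n t) t := fun t =>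
      ih.1.continuous.integral_hasStrictDerivAt 0 t |>.hasDerivAt
    have hd' : deriv (iteratedIntegral h (n + 1)) = iteratedIntegral h n :=
      funext fun t => (hd t).deriv
    refine ⟨?_, ?_⟩
    · rw [Nat.cast_succ, contDiff_succ_iff_deriv]
      refine ⟨fun t => (hd t).differentiableAt, by simp, ?_⟩
      rw [hd']
      exact ih.1
    · rw [iteratedDeriv_succ', hd']
      exact ih.2

theorem hasLaplaceAt_iteratedIntegral {h : ℝ → ℝ} {μ H : ℝ} (hμ : 0 < μ) (hh : HasLaplaceAt h μ H)
    (n : ℕ) : HasLaplaceAt (iteratedIntegral h n) μ ((1 / μ) ^ n * H) := by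
  induction n with
  | zero => simpa [iteratedIntegral] using hh
  | succ n ih =>
    have := (HasLaplaceAt.one hμ).conv ih
    simp only [one_mul] at this
    rw [pow_succ', mul_assoc]
    exact this

theorem intervalIntegrable_rpow_sub_one {a : ℝ} (ha : 0 < a) (b : ℝ) :
    IntervalIntegrable (fun t : ℝ => t ^ (a - 1)) volume 0 b :=
  intervalIntegral.intervalIntegrable_rpow' (by linarith)

theorem taylorRemainder_eq {β : ℝ} (hβ : 0 < β) (hβ1 : β ≤ 1) {f : ℝ → ℝ} (hf : Continuous f) :
    taylorRemainder β f = fun t => f t - f 0 := by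
  have hc : ⌈β⌉₊ = 1 := by
    rw [Nat.ceil_eq_iff one_ne_zero]
    simpa using ⟨hβ, hβ1⟩
  have hlim : limUnder (𝓝[>] (0 : ℝ)) f = f 0 :=
    ((hf.tendsto 0).mono_left nhdsWithin_le_nhds).limUnder_eq
  ext t
  simp [taylorRemainder, hc, hlim]

/-- The regularized Prabhakar derivative of a function is read off from Laplace transforms: if
`h` has `Ψ` times the transform of `f - f(0)`, where `Ψ` is the Laplace exponent of the clock,
then the fractional integral occurring in the derivative is the iterated integral of `h`. -/
theorem regPrabhakarDeriv_of_hasLaplaceAt {α β γ om θ : ℝ} (hα : 0 < α) (hβ : 0 < β)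
    (hβ1 : β ≤ 1) (hom : 0 ≤ om) (hθ : 0 < θ) {f h : ℝ → ℝ}
    (hf : Continuous f) (hf0 : ∀ t ≤ 0, f t = f 0) (hh : Continuous h) {G : ℝ → ℝ} {μ₀ : ℝ}
    (hμ₀ : 0 < μ₀) (hlarge : ∀ μ, μ₀ < μ → om < μ ^ α)
    (hfG : ∀ μ, μ₀ < μ → HasLaplaceAt (fun t => f t - f 0) μ (G μ))
    (hhG : ∀ μ, μ₀ < μ → HasLaplaceAt h μ (clockExponent α β γ om μ * G μ)) :
    HasRegPrabhakarDeriv θ γ α β (-om) f ∧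
      ∀ t, 0 < t → regPrabhakarDeriv θ γ α β (-om) f t = h t := by
  set m := rlOrder (β + θ) with hm
  set a : ℝ := m - (β + θ) with ha
  have ha0 : 0 < a := by
    rw [ha, hm, rlOrder, sub_pos]
    push_cast
    exact Nat.lt_floor_add_one _
  set g : ℝ → ℝ := fun t => f t - f 0 with hg
  set K : ℝ → ℝ := fun t => ∫ y in (0 : ℝ)..t, prabhakarKernel α om (-γ) θ (t - y) * g y with hK
  have hKeq : prabhakarIntegral θ γ α (-om) g = K := by
    ext t
    simp only [prabhakarIntegral, hK, prabhakarKernel, neg_mul]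
  set J : ℝ → ℝ := fun t => 1 / Real.Gamma a * ∫ y in (0 : ℝ)..t, (t - y) ^ (a - 1) * K y with hJ
  have hJeq : rlIntegral a (prabhakarIntegral θ γ α (-om) (taylorRemainder β f)) = J := by
    rw [taylorRemainder_eq hβ hβ1 hf, hKeq]
    rfl
  have hgc : Continuous g := by fun_prop
  have hg0 : ∀ t ≤ 0, g t = 0 := fun t ht => sub_eq_zero.2 (hf0 t ht)
  have hkL : ∀ μ, μ₀ < μ → HasLaplaceAt (prabhakarKernel α om (-γ) θ) μ
      (μ ^ (-θ) * (1 + om * μ ^ (-α)) ^ γ) := by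
    intro μ hμ
    have := hasLaplaceAt_prabhakarKernel hα (-γ) hom hθ (hμ₀.trans hμ) (hlarge μ hμ)
    rwa [neg_neg] at this
  have hKc : Continuous K := continuous_conv
    (fun b hb => (hkL (μ₀ + 1) (by linarith)).intervalIntegrable le_rfl hb) hgc hg0
  have hK0 : ∀ t ≤ 0, K t = 0 := fun t ht => conv_of_nonpos hg0 ht
  have hJc : Continuous J := continuous_const.mul (continuous_conv
    (k := fun t => t ^ (a - 1)) (fun b _ => intervalIntegrable_rpow_sub_one ha0 b) hKc hK0)
  have heq : EqOn J (iteratedIntegral h m) (Ioi 0) := by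
    refine eqOn_of_hasLaplaceAt (μ₀ := μ₀)
      (F := fun μ => (1 / μ) ^ m * (clockExponent α β γ om μ * G μ)) (fun μ hμ => ?_)
      (fun μ hμ => hasLaplaceAt_iteratedIntegral (hμ₀.trans hμ) (hhG μ hμ) m)
      hJc.continuousOn (contDiff_iteratedIntegral hh m).1.continuous.continuousOn
    have hμ' := hμ₀.trans hμ
    have hL := ((HasLaplaceAt.rpow ha0 hμ').conv ((hkL μ hμ).conv (hfG μ hμ))).const_mul
      (1 / Real.Gamma a)
    have e : 1 / Real.Gamma a * (Real.Gamma a * μ ^ (-a) *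
        (μ ^ (-θ) * (1 + om * μ ^ (-α)) ^ γ * G μ)) =
        (1 / μ) ^ m * (clockExponent α β γ om μ * G μ) := by
      have e1 : μ ^ (-a) * μ ^ (-θ) = (1 / μ) ^ m * μ ^ β := by
        rw [one_div, inv_pow, ← Real.rpow_natCast, ← Real.rpow_neg hμ'.le, ← Real.rpow_add hμ',
          ← Real.rpow_add hμ', ha]
        ring_nf
      rw [clockExponent, ← mul_assoc ((1 / μ) ^ m), ← mul_assoc ((1 / μ) ^ m), ← e1]
      have := (Real.Gamma_pos_of_pos ha0).ne'
      field_simp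
    rw [e] at hL
    exact hL
  refine ⟨?_, fun t ht => ?_⟩
  · rw [HasRegPrabhakarDeriv, ← hm, ← ha, hJeq]
    exact (contDiff_iteratedIntegral hh m).1.contDiffOn.congr heq
  · rw [regPrabhakarDeriv, prabhakarDeriv, rlDeriv, ← hm, ← ha, hJeq]
    have hev : J =ᶠ[𝓝 t] iteratedIntegral h m := by
      filter_upwards [Ioi_mem_nhds ht] with s hs
      exact heq hs
    rw [hev.iteratedDeriv_eq, (contDiff_iteratedIntegral hh m).2]

/-! ### The Cauchy problem -/

theorem hasLaplaceAt_of_continuous_of_abs_le_one {f : ℝ → ℝ} (hf : Continuous f)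
    (hb : ∀ t, |f t| ≤ 1) {μ : ℝ} (hμ : 0 < μ) :
    HasLaplaceAt f μ (∫ t in Ioi (0 : ℝ), Real.exp (-(μ * t)) * f t) := by
  refine ⟨?_, rfl⟩
  refine (HasLaplaceAt.one hμ).1.mono' (by fun_prop) (Eventually.of_forall fun t => ?_)
  rw [norm_mul, Real.norm_of_nonneg (Real.exp_nonneg _)]
  exact mul_le_mul_of_nonneg_left (hb t) (Real.exp_nonneg _)

section Cauchy

variable {Ω : Type*} [MeasurableSpace Ω] {P : Measure Ω} [IsProbabilityMeasure P]
  {φ : ℝ → ℝ} {M : ℝ≥0 → Ω → ℕ} {W : ℝ≥0 → Ω → ℝ≥0} {α β γ om : ℝ}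

/-- The Laplace transforms in time of the state probabilities solve a triangular system: they are
the Taylor coefficients of `Ψ / (μ (Ψ + φ))`. -/
theorem exists_hasLaplaceAt_stateProb (hM : IsCountingProcess φ M P)
    (hW : IsStableClock α β γ om W P)
    (hi : IndepFun (fun w t => M t w) (fun w t => hittingTimeProcess W t w) P) (hα : 0 < α)
    (hβ : 0 < β) (hγ : 0 ≤ γ) (hom : 0 ≤ om) (hφ0 : ∀ u, |u| ≤ 1 → 0 ≤ φ u)
    (hφ : AnalyticAt ℝ φ 0) {μ : ℝ} (hμ : 0 < μ) :
    ∃ Q : ℕ → ℝ,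
      (∀ k, HasLaplaceAt (stateProb P (fun t w => M (hittingTimeProcess W t w) w) k) μ (Q k)) ∧
      ∀ k, shiftOperator φ Q k =
        clockExponent α β γ om μ * ((if k = 0 then 1 else 0) / μ - Q k) := by
  set p := stateProb P (fun t w => M (hittingTimeProcess W t w) w) with hp
  set Ψ := clockExponent α β γ om μ with hΨ
  have hΨ0 : 0 < Ψ := clockExponent_pos hom hμ
  have hp0 : ∀ k t, 0 ≤ p k t := fun k t => measureReal_nonneg
  have hp1 : ∀ k t, p k t ≤ 1 := fun k t => measureReal_le_one
  set Q : ℕ → ℝ := fun k => ∫ t in Ioi (0 : ℝ), Real.exp (-(μ * t)) * p k t with hQ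
  have hL : ∀ k, HasLaplaceAt (p k) μ (Q k) := fun k =>
    hasLaplaceAt_of_continuous_of_abs_le_one
      (continuous_stateProb hM hW hi hα hβ hγ hom (hφ0 0 (by simp)) k)
      (fun t => by rw [abs_of_nonneg (hp0 k t)]; exact hp1 k t) hμ
  have hQ0 : ∀ k, 0 ≤ Q k := fun k =>
    setIntegral_nonneg measurableSet_Ioi fun t _ => mul_nonneg (Real.exp_nonneg _) (hp0 k t)
  have hQ1 : ∀ k, Q k ≤ 1 / μ := by
    intro k
    rw [← (HasLaplaceAt.one hμ).2]
    refine setIntegral_mono_on (hL k).1 (HasLaplaceAt.one hμ).1 measurableSet_Ioi fun t _ => ?_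
    exact mul_le_mul_of_nonneg_left (hp1 k t) (Real.exp_nonneg _)
  have hgen : ∀ u : ℝ, |u| < 1 → HasSum (fun k => Q k * u ^ k) (Ψ / (μ * (Ψ + φ u))) := by
    intro u hu
    have hf := hW.hasLaplaceAt_exp hom (hφ0 u hu.le) hμ
    have hfsum : ∀ t : ℝ, ∫ w, Real.exp (-(φ u * hittingTimeProcess W t.toNNReal w)) ∂P =
        ∑' k, u ^ k * p k t := fun t => (hasSum_pow_mul_stateProb hM hW hi hu.le t).tsum_eq.symm
    simp only [hfsum] at hf
    have hA : ∀ v : ℝ, |v| < 1 → Summable fun k => v ^ k * Q k := by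
      intro v hv
      refine Summable.of_norm_bounded
        ((summable_geometric_of_lt_one (abs_nonneg v) hv).mul_right (1 / μ)) fun k => ?_
      rw [norm_mul, norm_pow, Real.norm_eq_abs, Real.norm_of_nonneg (hQ0 k)]
      gcongr
      exact hQ1 k
    have habs : ∀ k, HasLaplaceAt (fun t => |u ^ k * p k t|) μ (|u| ^ k * Q k) := by
      intro k
      refine ((hL k).const_mul (|u| ^ k)).congr fun t _ => ?_
      simp only [abs_mul, abs_pow, abs_of_nonneg (hp0 k t)]
    have hs := HasLaplaceAt.hasSum (fun k => (hL k).const_mul (u ^ k)) habs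
      (hA |u| (by rwa [abs_abs])) hf.aestronglyMeasurable
    have hval := hs.2.symm.trans hf.2
    have h := (hA u hu).hasSum
    rw [hval] at h
    exact h.congr_fun fun k => mul_comm _ _
  refine ⟨Q, hL, fun k => ?_⟩
  have hR := (hasFPowerSeriesAt_zero_of_hasSum one_pos hgen).analyticAt
  have hev : (fun u => (Ψ + φ u) * (Ψ / (μ * (Ψ + φ u)))) =ᶠ[𝓝 0] fun _ => Ψ / μ := by
    filter_upwards [Metric.ball_mem_nhds (0 : ℝ) one_pos] with u hu
    rw [Metric.mem_ball, Real.dist_eq, sub_zero] at hu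
    have : 0 < Ψ + φ u := by linarith [hφ0 u hu.le]
    field_simp
  have hT := taylorCoeff_congr hev k
  rw [taylorCoeff_mul (f := fun u => Ψ + φ u) (g := fun u => Ψ / (μ * (Ψ + φ u)))
    (analyticAt_const.add hφ) hR, taylorCoeff_const] at hT
  simp only [taylorCoeff_eq_of_hasSum one_pos hgen,
    taylorCoeff_add (f := fun _ => Ψ) analyticAt_const hφ, taylorCoeff_const, add_mul,
    Finset.sum_add_distrib, ite_mul, zero_mul, Finset.sum_ite_eq', Finset.mem_range,
    Nat.succ_pos, if_true, Nat.sub_zero] at hT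
  have hS : shiftOperator φ Q k = ∑ j ∈ Finset.range (k + 1), taylorCoeff φ j * Q (k - j) := rfl
  rw [hS]
  split_ifs at hT ⊢ with hk <;> [rw [mul_sub, mul_one_div]; rw [zero_div, mul_sub, mul_zero]] <;>
    linarith

/-- The triangular system for the Laplace transforms, read in the time variable. -/
theorem regPrabhakarDeriv_stateProb (hM : IsCountingProcess φ M P)
    (hW : IsStableClock α β γ om W P)
    (hi : IndepFun (fun w t => M t w) (fun w t => hittingTimeProcess W t w) P) (hα : 0 < α)
    (hβ : 0 < β) (hβ1 : β ≤ 1) (hγ : 0 ≤ γ) (hom : 0 ≤ om) (hφ0 : ∀ u, |u| ≤ 1 → 0 ≤ φ u)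
    (hφ : AnalyticAt ℝ φ 0) {θ : ℝ} (hθ : 0 < θ) (k : ℕ) :
    HasRegPrabhakarDeriv θ γ α β (-om)
        (stateProb P (fun t w => M (hittingTimeProcess W t w) w) k) ∧
      ∀ t, 0 < t → regPrabhakarDeriv θ γ α β (-om)
        (stateProb P (fun t w => M (hittingTimeProcess W t w) w) k) t =
        -shiftOperator φ
          (fun j => stateProb P (fun t w => M (hittingTimeProcess W t w) w) j t) k := by
  set p := stateProb P (fun t w => M (hittingTimeProcess W t w) w) with hp
  obtain ⟨μ₀, hμ₀, hlarge⟩ := exists_lt_clockExponent hα hβ hγ hom (C := 0)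
  have hsys := fun (μ : ℝ) (hμ : 0 < μ) =>
    exists_hasLaplaceAt_stateProb hM hW hi hα hβ hγ hom hφ0 hφ hμ
  have hpc : ∀ k, Continuous (p k) :=
    continuous_stateProb hM hW hi hα hβ hγ hom (hφ0 0 (by simp))
  have hpz : p k 0 = if k = 0 then 1 else 0 := stateProb_zero hM hW hi hα hβ hγ hom hφ k
  set G : ℝ → ℝ := fun μ => (∫ t in Ioi (0 : ℝ), Real.exp (-(μ * t)) * p k t) - p k 0 * (1 / μ)
    with hG
  refine regPrabhakarDeriv_of_hasLaplaceAt (G := G)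
    (h := fun t => -shiftOperator φ (fun j => p j t) k) hα hβ hβ1 hom hθ
    (hpc k) (fun t ht => ?_) ?_ hμ₀ (fun μ hμ => (hlarge μ hμ).1) (fun μ hμ => ?_)
    (fun μ hμ => ?_)
  · rw [hp, stateProb, stateProb, Real.toNNReal_of_nonpos ht, Real.toNNReal_zero]
  · unfold shiftOperator
    fun_prop
  · obtain ⟨Q, hQ, -⟩ := hsys μ (hμ₀.trans hμ)
    have h := (hQ k).sub ((HasLaplaceAt.one (hμ₀.trans hμ)).const_mul (p k 0))
    rw [hG]
    dsimp only
    rw [(hQ k).2]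
    simpa only [mul_one] using h
  · obtain ⟨Q, hQ, hS⟩ := hsys μ (hμ₀.trans hμ)
    have h := (HasLaplaceAt.finset_sum (Finset.range (k + 1)) fun j _ =>
      (hQ (k - j)).const_mul (iteratedDeriv j φ 0 / (j.factorial : ℝ))).neg
    have e : -∑ j ∈ Finset.range (k + 1), iteratedDeriv j φ 0 / (j.factorial : ℝ) * Q (k - j) =
        clockExponent α β γ om μ * G μ := by
      have := hS k
      rw [shiftOperator] at this
      rw [this, hG]
      dsimp only
      rw [(hQ k).2, hpz]
      ring
    rw [e] at h
    exact h

end Cauchy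

end

theorem theorem3p3 {Ω : Type*} [MeasurableSpace Ω] (P : Measure Ω) [IsProbabilityMeasure P]
    (ν δ α β γ : ℝ) (η lam om : ℝ≥0)
    (hη : 0 < η) (hlam : 0 < lam) (hom : 0 < om)
    (hδ : 0 < δ) (hν : 0 < ν) (hνδ : ν * ⌈δ⌉₊ < 1)
    (hγ : 0 ≤ γ) (hα : 0 < α) (hα1 : α ≤ 1) (hβ : 0 < β) (hβ1 : β ≤ 1)
    (hidx : γ ≠ 0 → ∀ r : ℕ, r ≤ ⌈γ⌉₊ →
      0 < β * ⌈γ⌉₊ / γ - r * α ∧ β * ⌈γ⌉₊ / γ - r * α < 1)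
    -- the space time-change
    (A : Fin ⌈δ⌉₊ → ℝ≥0 → Ω → ℝ≥0) (T : ℝ≥0 → Ω → ℝ≥0)
    (hA : ∀ i, IsStableSubordinator (A i) (ν * ((i : ℕ) + 1)) P)
    (hT : IsTemperedStableSubordinator T (δ / ⌈δ⌉₊) ((η : ℝ) ^ ⌈δ⌉₊) P)
    (hAT : iIndepFun (fun (o : Option (Fin ⌈δ⌉₊)) w t => (o.elim T A) t w) P)
    -- the Poisson process
    (N : ℝ≥0 → Ω → ℕ) (hN : IsPoissonProcess N lam P)
    (hNV : IndepFun (fun w t => N t w) (fun w t => subordinatedStableSum η ⌈δ⌉₊ A T t w) P)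
    -- the hitting-time process
    (B : Fin (⌈γ⌉₊ + 1) → ℝ≥0 → Ω → ℝ≥0) (S : ℝ≥0 → Ω → ℝ≥0)
    (hB : ∀ r, IsStableSubordinator (B r) (β / ceilRatio γ - (r : ℕ) * α) P)
    (hS : IsStableSubordinator S (ceilRatio γ) P)
    (hBS : iIndepFun (fun (o : Option (Fin (⌈γ⌉₊ + 1))) w t => (o.elim S B) t w) P)
    (U : ℝ≥0 → Ω → ℝ≥0) (hU : U = hittingTimeProcess (clockedStableSum om ⌈γ⌉₊ B S))
    (hNU : IndepFun (fun w t => N (subordinatedStableSum η ⌈δ⌉₊ A T t w) w)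
      (fun w t => U t w) P)
    -- the state probabilities of the time-changed process
    (p : ℕ → ℝ → ℝ)
    (hp : p = stateProb P fun t w => N (subordinatedStableSum η ⌈δ⌉₊ A T (U t w) w) w) :
    -- probability generating function
    (∀ t : ℝ, 0 ≤ t → ∀ u ∈ Icc (-1 : ℝ) 1,
      Summable (genTerm η lam ν δ α β γ om u t) ∧
      HasSum (fun k => u ^ k * p k t) (∑' n, genTerm η lam ν δ α β γ om u t n)) ∧
    -- state probabilities, whenever the innermost series converge
    (∀ (k : ℕ) (L : ℕ → ℝ),
      (∀ r, Tendsto (fun K => ∑ m ∈ Finset.range K, innerTerm η lam ν δ k r m) atTop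
        (𝓝 (L r))) →
      ∀ t : ℝ, 0 ≤ t → HasSum (outerTerm η δ α β γ om k L t) (p k t)) ∧
    -- the innermost series do converge if `lam ^ ν < η` or `δ` is an integer
    (((lam : ℝ) ^ ν < η ∨ ∃ d : ℕ, δ = d) →
      ∀ k r : ℕ, Summable (innerTerm η lam ν δ k r)) ∧
    -- Cauchy problem
    (∀ k : ℕ,
      p k 0 = (if k = 0 then 1 else 0) ∧
      (∀ b : ℝ, 0 < b → AbsolutelyContinuousOnInterval (p k) 0 b) ∧
      ∀ θ : ℝ, 0 < θ →
        HasRegPrabhakarDeriv θ γ α β (-om) (p k) ∧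
        ∀ t : ℝ, 0 < t →
          regPrabhakarDeriv θ γ α β (-om) (p k) t =
            -shiftOperator (spaceSymbol η lam ν δ) (fun j => p j t) k) := by
  subst hU hp
  have hM := isCountingProcess_subordinated hδ hA hT hAT hN hNV
  have hW : IsStableClock α β γ om (clockedStableSum om ⌈γ⌉₊ B S) P :=
    isStableClock_clockedStableSum hγ hB hS hBS
  have hφ : AnalyticAt ℝ (spaceSymbol η lam ν δ) 0 :=
    analyticAt_spaceSymbol (NNReal.coe_pos.2 hη) (NNReal.coe_pos.2 hlam)
  have hφ0 : ∀ u, |u| ≤ 1 → 0 ≤ spaceSymbol η lam ν δ u := fun u hu =>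
    spaceSymbol_nonneg hδ (abs_le.1 hu).2
  have hom0 : (0 : ℝ) ≤ om := om.coe_nonneg
  refine ⟨fun t ht u hu => ?_, fun k L hL t ht => ?_,
    fun h k r => summable_innerTerm (NNReal.coe_pos.2 hη) (NNReal.coe_pos.2 hlam) hν h k r,
    fun k => ⟨stateProb_zero hM hW hNU hα hβ hγ hom0 hφ k,
      fun b hb => absolutelyContinuousOnInterval_stateProb hM hW hNU hα hβ hγ hom0
        (hφ0 0 (by simp)) k hb,
      fun θ hθ => regPrabhakarDeriv_stateProb hM hW hNU hα hβ hβ1 hγ hom0 hφ0 hφ hθ k⟩⟩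
  · have hgen : genTerm η lam ν δ α β γ om u t = fun n =>
        (-spaceSymbol η lam ν δ u) ^ n * momentFunction α β γ om n t := by
      ext n
      rw [genTerm, momentFunction, ← neg_mul, mul_pow, mul_assoc]
    have hsum := (hasSum_exp_neg_hittingTime hW hα hβ hγ hom0 (spaceSymbol η lam ν δ u) ht).2
    rw [hgen]
    refine ⟨hsum.summable, ?_⟩
    rw [hsum.tsum_eq]
    exact hasSum_pow_mul_stateProb hM hW hNU (abs_le.2 hu) t
  · refine (hasSum_stateProb_taylorCoeff hM hW hNU hα hβ hγ hom0 hφ k ht).congr_fun fun n => ?_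
    rw [taylorCoeff_spaceSymbol_pow (NNReal.coe_pos.2 hη) (NNReal.coe_pos.2 hlam) hν hL, outerTerm,
      momentFunction, neg_pow (t ^ β)]
    ring
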